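/- Let $\Lambda=\mathbb{C}[p_1,p_2,\dots]$ be the algebra of symmetric functions in infinitely many variables $\mathbf{x}=(x_1,x_2,\dots)$ over $\mathbb{C}$, where $p_k=\sum_i x_i^k$ are the power sums. Let $m\ge 1$ be an integer, and let $\langle\cdot,\cdot\rangle_m$ be the bilinear form on $\Lambda$ for which the monomials in the power sums are pairwise orthogonal and $$\langle p_1^{i_1}\cdots p_k^{i_k},\,p_1^{i_1}\cdots p_k^{i_k}\rangle_m=m^{-\sum_{t} i_t}\prod_{t=1}^k t^{i_t}\,i_t!\,.$$ For partitions $\mu,\lambda$ of the same integer write $\mu<\lambda$ if $\mu\ne\lambda$ and $\mu_1+\dots+\mu_i\le\lambda_1+\dots+\lambda_i$ for all $i$, and let $m_\lambda$ denote the monomial symmetric function (the sum of all distinct monomials obtained from $x_1^{\lambda_1}x_2^{\lambda_2}\cdots$ by permuting the variables). Then there is exactly one family $(J_\lambda(m;\mathbf{x}))_\lambda$ of elements of $\Lambda$, indexed by all partitions, the Jack polynomials with coupling constant $m$, such that $$J_\lambda(m;\mathbf{x})\in m_\lambda+\operatorname{span}_{\mathbb{C}}\{m_\mu:\mu<\lambda\},\qquad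 \langle J_\lambda(m;\mathbf{x}),J_\mu(m;\mathbf{x})\rangle_m=0\ \text{ for }\lambda\ne\mu .$$ For all integers $s,r\ge 0$ and the rectangular partition $\lambda=(s^r)=(\underbrace{s,\dots,s}_{r})$, this family satisfies $$\mathbb{C}\left[\frac{\partial}{\partial p_1},\frac{\partial}{\partial p_2},\dots\right]\cdot J_\lambda(m;\mathbf{x})=\operatorname{span}_{\mathbb{C}}\{J_\mu(m;\mathbf{x}):\mu\subset\lambda\},$$ where $\mu\subset\lambda$ means that the Young diagram of $\mu$ is contained in that of $\lambda$. -/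

import Mathlib

/-! Symmetric functions over `ℂ`, written as polynomials in the power sums `p₁, p₂, …`, and
Jack polynomials.  Partitions are Young diagrams: the part `λ_{i+1}` is `YoungDiagram.rowLen i`,
and `μ ≤ ν` is containment of diagrams. -/

namespace JackRect

noncomputable section

/-- The algebra `Λ = ℂ[p₁, p₂, …]`; the variable `X k`, `k ≥ 1`, is the power sum `p_k`. -/
abbrev SymFun : Type := MvPolynomial ℕ+ ℂ

/-- The power sum `∑ᵢ xᵢ ^ k` as a formal power series in the variables `x₀, x₁, …`. -/
def powerSum (k : ℕ+) : MvPowerSeries ℕ ℂ :=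
  open Classical in fun d => if ∃ i : ℕ, d = Finsupp.single i (k : ℕ) then 1 else 0

/-- The expansion of a symmetric function in the variables `x₀, x₁, …`. -/
def expand : SymFun →ₐ[ℂ] MvPowerSeries ℕ ℂ := MvPolynomial.aeval powerSum

/-- The monomial symmetric function `m_μ`: the sum of all distinct monomials whose nonzero
exponents are, up to order, the parts of `μ`. -/
def monomialSym (μ : YoungDiagram) : MvPowerSeries ℕ ℂ :=
  fun d => if d.support.val.map d = (μ.rowLens : Multiset ℕ) then 1 else 0

/-- `DomLT μ ν`: the partitions `μ ≠ ν` have the same size and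
`μ₁ + ⋯ + μᵢ ≤ ν₁ + ⋯ + νᵢ` for all `i`. -/
def DomLT (μ ν : YoungDiagram) : Prop :=
  μ ≠ ν ∧ μ.card = ν.card ∧
    ∀ i : ℕ, ∑ j ∈ Finset.range i, μ.rowLen j ≤ ∑ j ∈ Finset.range i, ν.rowLen j

/-- The squared norm of `∏ₖ p_k ^ d_k`, namely `a ^ (-∑ d_k) * ∏ k ^ d_k * d_k !`. -/
def normSq (a : ℂ) (d : ℕ+ →₀ ℕ) : ℂ :=
  d.prod fun k i => a⁻¹ ^ i * (((k : ℕ) : ℂ) ^ i * (i.factorial : ℂ))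

/-- The bilinear scalar product on `Λ` with coupling constant `a`, for which the products of
power sums are orthogonal with squared norms `normSq a`. -/
def scalar (a : ℂ) (f g : SymFun) : ℂ :=
  ∑ d ∈ f.support, f.coeff d * g.coeff d * normSq a d

/-- `J` is the family of Jack polynomials with coupling constant `a`: each `J_ν` equals `m_ν`
plus a linear combination of the `m_μ` with `μ < ν` in the dominance order, and distinct members
are orthogonal. -/
structure IsJackFamily (a : ℂ) (J : YoungDiagram → SymFun) : Prop where
  triangular : ∀ ν : YoungDiagram,
    expand (J ν) - monomialSym ν ∈ Submodule.span ℂ (monomialSym '' {μ | DomLT μ ν})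
  orthogonal : ∀ μ ν : YoungDiagram, μ ≠ ν → scalar a (J μ) (J ν) = 0

/-- The rectangular diagram `(s ^ r)` with `r` rows of length `s`. -/
def rect (s r : ℕ) : YoungDiagram where
  cells := Finset.range r ×ˢ Finset.range s
  isLowerSet := by
    rintro ⟨i, j⟩ ⟨i', j'⟩ ⟨hi, hj⟩ h
    simp only [Finset.coe_product, Set.mem_prod, Finset.mem_coe, Finset.mem_range] at h ⊢
    exact ⟨lt_of_le_of_lt hi h.1, lt_of_le_of_lt hj h.2⟩

/-- The algebra `ℂ[∂/∂p₁, ∂/∂p₂, …]` of operators on `Λ`. -/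
def diffOps : Subalgebra ℂ (Module.End ℂ SymFun) :=
  Algebra.adjoin ℂ (Set.range fun k : ℕ+ => (MvPolynomial.pderiv k : Derivation ℂ SymFun SymFun).toLinearMap)

/-- The subspace `ℂ[∂/∂p₁, ∂/∂p₂, …] · f` of `Λ`. -/
def diffOrbit (f : SymFun) : Submodule ℂ SymFun :=
  (Subalgebra.toSubmodule diffOps).map (LinearMap.applyₗ f)

end

end JackRect

namespace JackRect

noncomputable section

open MvPolynomial

/-! ### The scalar product -/

theorem scalar_eq_sum (a : ℂ) (f g : SymFun) (s : Finset (ℕ+ →₀ ℕ)) (hs : f.support ⊆ s) :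
    scalar a f g = ∑ d ∈ s, f.coeff d * g.coeff d * normSq a d := by
  refine Finset.sum_subset hs fun d _ hd => ?_
  rw [notMem_support_iff.1 hd]; ring

theorem scalar_comm (a : ℂ) (f g : SymFun) : scalar a f g = scalar a g f := by
  classical
  rw [scalar_eq_sum a f g _ Finset.subset_union_left,
    scalar_eq_sum a g f _ (Finset.subset_union_right (s₁ := f.support))]
  exact Finset.sum_congr rfl fun d _ => by ring

theorem scalar_add_right (a : ℂ) (f g h : SymFun) :
    scalar a f (g + h) = scalar a f g + scalar a f h := by
  simp only [scalar, coeff_add, mul_add, add_mul, Finset.sum_add_distrib]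

theorem scalar_smul_right (a c : ℂ) (f g : SymFun) :
    scalar a f (c • g) = c * scalar a f g := by
  simp only [scalar, coeff_smul, Finset.mul_sum, smul_eq_mul]
  exact Finset.sum_congr rfl fun d _ => by ring

theorem scalar_add_left (a : ℂ) (f g h : SymFun) :
    scalar a (f + g) h = scalar a f h + scalar a g h := by
  simp only [scalar_comm a _ h, scalar_add_right]

theorem scalar_smul_left (a c : ℂ) (f g : SymFun) :
    scalar a (c • f) g = c * scalar a f g := by
  simp only [scalar_comm a _ g, scalar_smul_right]

/-- The scalar product as a bilinear map. -/
def scalarₗ (a : ℂ) : SymFun →ₗ[ℂ] SymFun →ₗ[ℂ] ℂ :=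
  LinearMap.mk₂ ℂ (scalar a) (scalar_add_left a) (scalar_smul_left a) (scalar_add_right a)
    (scalar_smul_right a)

@[simp] theorem scalarₗ_apply (a : ℂ) (f g : SymFun) : scalarₗ a f g = scalar a f g := rfl

theorem scalar_sum_right {ι : Type*} (a : ℂ) (f : SymFun) (s : Finset ι) (g : ι → SymFun) :
    scalar a f (∑ i ∈ s, g i) = ∑ i ∈ s, scalar a f (g i) :=
  map_sum (scalarₗ a f) g s

theorem scalar_sum_left {ι : Type*} (a : ℂ) (f : SymFun) (s : Finset ι) (g : ι → SymFun) :
    scalar a (∑ i ∈ s, g i) f = ∑ i ∈ s, scalar a (g i) f := by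
  simp only [scalar_comm a _ f, scalar_sum_right]

@[simp] theorem scalar_zero_right (a : ℂ) (f : SymFun) : scalar a f 0 = 0 :=
  map_zero (scalarₗ a f)

@[simp] theorem scalar_zero_left (a : ℂ) (f : SymFun) : scalar a 0 f = 0 := by
  rw [scalar_comm, scalar_zero_right]

theorem scalar_sub_right (a : ℂ) (f g h : SymFun) :
    scalar a f (g - h) = scalar a f g - scalar a f h := map_sub (scalarₗ a f) g h

theorem scalar_sub_left (a : ℂ) (f g h : SymFun) :
    scalar a (f - g) h = scalar a f h - scalar a g h := by
  simp only [scalar_comm a _ h, scalar_sub_right]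

theorem scalar_monomial_left (a : ℂ) (d : ℕ+ →₀ ℕ) (c : ℂ) (g : SymFun) :
    scalar a (monomial d c) g = c * g.coeff d * normSq a d := by
  classical
  rw [scalar_eq_sum a _ g {d} support_monomial_subset]
  simp

theorem normSq_add_single (a : ℂ) (d : ℕ+ →₀ ℕ) (k : ℕ+) :
    normSq a (d + Finsupp.single k 1) = normSq a d * (a⁻¹ * (k : ℕ) * ((d k : ℂ) + 1)) := by
  classical
  unfold normSq
  have hk : ∀ e : ℕ+ →₀ ℕ, (e.prod fun k i => a⁻¹ ^ i * (((k : ℕ) : ℂ) ^ i * (i.factorial : ℂ))) =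
      (a⁻¹ ^ (e k) * (((k : ℕ) : ℂ) ^ (e k) * ((e k).factorial : ℂ))) *
      ((e.erase k).prod fun k i => a⁻¹ ^ i * (((k : ℕ) : ℂ) ^ i * (i.factorial : ℂ))) := by
    intro e
    refine (Finsupp.mul_prod_erase' e k
      (fun k i => a⁻¹ ^ i * (((k : ℕ) : ℂ) ^ i * (i.factorial : ℂ))) fun i => ?_).symm
    simp
  rw [hk, hk d, Finsupp.erase_add, Finsupp.erase_single, add_zero]
  simp only [Finsupp.add_apply, Finsupp.single_eq_same, Nat.factorial_succ, pow_succ]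
  push_cast
  ring

/-- Multiplication by `p_k` is adjoint to a multiple of `∂/∂p_k`. -/
theorem scalar_X_mul (a : ℂ) (k : ℕ+) (f g : SymFun) :
    scalar a (X k * f) g = a⁻¹ * (k : ℕ) * scalar a f (pderiv k g) := by
  classical
  induction f using MvPolynomial.induction_on' with
  | add p q hp hq => rw [mul_add, scalar_add_left, hp, hq, scalar_add_left]; ring
  | monomial d c =>
    have : (X k * monomial d c : SymFun) = monomial (d + Finsupp.single k 1) c := by
      rw [X, monomial_mul, one_mul, add_comm]
    rw [this, scalar_monomial_left, scalar_monomial_left, normSq_add_single, coeff_pderiv]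
    ring

theorem scalar_mul_X_right (a : ℂ) (k : ℕ+) (f g : SymFun) :
    scalar a f (X k * g) = a⁻¹ * (k : ℕ) * scalar a (pderiv k f) g := by
  rw [scalar_comm, scalar_X_mul, scalar_comm]

/-! ### Complex conjugation and positivity -/

/-- Complex conjugation of the coefficients of a symmetric function. -/
def conj : SymFun →+* SymFun := MvPolynomial.map (starRingEnd ℂ)

theorem coeff_conj (f : SymFun) (d : ℕ+ →₀ ℕ) :
    (conj f).coeff d = starRingEnd ℂ (f.coeff d) := coeff_map _ _ _

@[simp] theorem conj_conj (f : SymFun) : conj (conj f) = f := by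
  ext d; simp [coeff_conj]

theorem conj_smul (c : ℂ) (f : SymFun) : conj (c • f) = starRingEnd ℂ c • conj f := by
  ext d; simp [coeff_conj]

theorem conj_pderiv (k : ℕ+) (f : SymFun) : conj (pderiv k f) = pderiv k (conj f) :=
  pderiv_map.symm

theorem normSq_natCast (m : ℕ) (d : ℕ+ →₀ ℕ) :
    ∃ x : ℝ, normSq (m : ℂ) d = x ∧ (0 < m → 0 < x) := by
  refine ⟨d.prod fun k i => (m : ℝ)⁻¹ ^ i * (((k : ℕ) : ℝ) ^ i * (i.factorial : ℝ)), ?_, ?_⟩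
  · unfold normSq Finsupp.prod
    push_cast
    rfl
  · intro hm
    refine Finset.prod_pos fun k _ => ?_
    have := k.pos
    have := Nat.factorial_pos (d k)
    positivity

theorem conj_scalar (m : ℕ) (f g : SymFun) :
    scalar (m : ℂ) (conj f) (conj g) = starRingEnd ℂ (scalar (m : ℂ) f g) := by
  rw [scalar_eq_sum _ (conj f) _ f.support (support_map_subset _ _), scalar, map_sum]
  refine Finset.sum_congr rfl fun d _ => ?_
  obtain ⟨x, hx, -⟩ := normSq_natCast m d
  rw [coeff_conj, coeff_conj, map_mul, map_mul, hx, Complex.conj_ofReal]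

theorem eq_zero_of_scalar_conj {m : ℕ} (hm : 0 < m) (f : SymFun)
    (h : scalar (m : ℂ) f (conj f) = 0) : f = 0 := by
  choose x hx hpos using normSq_natCast m
  have h1 : scalar (m : ℂ) f (conj f) =
      ((∑ d ∈ f.support, Complex.normSq (f.coeff d) * x d : ℝ) : ℂ) := by
    rw [scalar]
    push_cast
    refine Finset.sum_congr rfl fun d _ => ?_
    rw [coeff_conj, Complex.mul_conj, hx]
  rw [h1, Complex.ofReal_eq_zero, Finset.sum_eq_zero_iff_of_nonneg
    (fun d _ => mul_nonneg (Complex.normSq_nonneg _) (hpos d hm).le)] at h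
  ext d
  by_cases hd : d ∈ f.support
  · have := h d hd
    rw [mul_eq_zero, Complex.normSq_eq_zero] at this
    rcases this with h' | h'
    · simpa using h'
    · exact absurd h' (hpos d hm).ne'
  · simpa using hd

/-- The form is nondegenerate on every subspace stable under conjugation. -/
theorem eq_zero_of_scalar_eq_zero {m : ℕ} (hm : 0 < m) (V : Submodule ℂ SymFun)
    (hV : ∀ f ∈ V, conj f ∈ V) (f : SymFun) (hf : f ∈ V)
    (h : ∀ g ∈ V, scalar (m : ℂ) f g = 0) : f = 0 :=
  eq_zero_of_scalar_conj hm f (h _ (hV f hf))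

/-- Orthogonal projection to a finite-dimensional subspace stable under conjugation. -/
theorem exists_orthogonal_projection {m : ℕ} (hm : 0 < m) (V : Submodule ℂ SymFun)
    [FiniteDimensional ℂ V] (hV : ∀ f ∈ V, conj f ∈ V) (f : SymFun) :
    ∃ v ∈ V, ∀ g ∈ V, scalar (m : ℂ) (f - v) g = 0 := by
  let Φ : V →ₗ[ℂ] Module.Dual ℂ V := (scalarₗ (m : ℂ)).compl₁₂ V.subtype V.subtype
  have hinj : Function.Injective Φ := by
    rw [injective_iff_map_eq_zero]
    intro v hv
    apply Subtype.ext
    exact eq_zero_of_scalar_eq_zero hm V hV v v.2 fun g hg => LinearMap.congr_fun hv ⟨g, hg⟩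
  have hsurj : Function.Surjective Φ :=
    (LinearMap.injective_iff_surjective_of_finrank_eq_finrank
      (Subspace.dual_finrank_eq).symm).1 hinj
  obtain ⟨v, hv⟩ := hsurj ((scalarₗ (m : ℂ) f) ∘ₗ V.subtype)
  refine ⟨v, v.2, fun g hg => ?_⟩
  have := LinearMap.congr_fun hv ⟨g, hg⟩
  rw [scalar_sub_left, sub_eq_zero]
  exact this.symm

end

noncomputable section

open MvPolynomial

/-! ### Partitions and exponents -/

theorem youngDiagram_ext {μ ν : YoungDiagram} (h : ∀ i, μ.rowLen i = ν.rowLen i) : μ = ν := by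
  apply YoungDiagram.ext
  ext ⟨i, j⟩
  rw [YoungDiagram.mem_cells, YoungDiagram.mem_cells, YoungDiagram.mem_iff_lt_rowLen,
    YoungDiagram.mem_iff_lt_rowLen, h]

theorem rowLen_pos_iff {μ : YoungDiagram} {i : ℕ} : 0 < μ.rowLen i ↔ i < μ.colLen 0 := by
  rw [← YoungDiagram.mem_iff_lt_rowLen, YoungDiagram.mem_iff_lt_colLen]

theorem rowLen_eq_zero {μ : YoungDiagram} {i : ℕ} (h : μ.colLen 0 ≤ i) : μ.rowLen i = 0 := by
  by_contra hne
  exact absurd (rowLen_pos_iff.1 (Nat.pos_of_ne_zero hne)) (not_lt.2 h)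

theorem card_eq_sum_rowLen (μ : YoungDiagram) {n : ℕ} (hn : μ.colLen 0 ≤ n) :
    μ.card = ∑ i ∈ Finset.range n, μ.rowLen i := by
  change μ.cells.card = _
  rw [Finset.card_eq_sum_card_fiberwise (f := Prod.fst) (t := Finset.range n)]
  · refine Finset.sum_congr rfl fun i _ => ?_
    rw [YoungDiagram.rowLen_eq_card]
    rfl
  · rintro ⟨i, j⟩ hij
    rw [Finset.mem_coe, YoungDiagram.mem_cells] at hij
    have h0 : (i, 0) ∈ μ := μ.up_left_mem le_rfl (Nat.zero_le j) hij
    rw [YoungDiagram.mem_iff_lt_colLen] at h0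
    simpa using lt_of_lt_of_le h0 hn

theorem colLen_le_card (μ : YoungDiagram) : μ.colLen 0 ≤ μ.card := by
  rw [card_eq_sum_rowLen μ le_rfl]
  calc μ.colLen 0 = ∑ i ∈ Finset.range (μ.colLen 0), 1 := by simp
    _ ≤ _ := Finset.sum_le_sum fun i hi => rowLen_pos_iff.2 (Finset.mem_range.1 hi)

theorem exists_youngDiagram_of_antitone {n : ℕ} (v : Fin n → ℕ) (hv : Antitone v) :
    ∃ μ : YoungDiagram, μ.colLen 0 ≤ n ∧ ∀ i : Fin n, μ.rowLen i = v i := by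
  let w : ℕ → ℕ := fun i => if h : i < n then v ⟨i, h⟩ else 0
  have hw : Antitone w := by
    intro i j hij
    by_cases hj : j < n
    · simp only [w, hj, lt_of_le_of_lt hij hj, dif_pos]
      exact hv hij
    · simp only [w, hj, dif_neg, not_false_eq_true, Nat.zero_le]
  let μ : YoungDiagram :=
    { cells := (Finset.range n ×ˢ Finset.range (w 0)).filter fun c => c.2 < w c.1
      isLowerSet := by
        rintro ⟨i, j⟩ ⟨i', j'⟩ ⟨hi, hj⟩ h
        simp only [Finset.coe_filter, Finset.mem_product, Finset.mem_range,
          Set.mem_ofPred_eq] at h hi hj ⊢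
        have := hw hi
        omega }
  have hmem : ∀ i j, (i, j) ∈ μ ↔ j < w i := by
    intro i j
    rw [← YoungDiagram.mem_cells]
    simp only [μ, Finset.mem_filter, Finset.mem_product, Finset.mem_range, and_iff_right_iff_imp]
    intro h
    refine ⟨?_, lt_of_lt_of_le h (hw (Nat.zero_le i))⟩
    by_contra hi
    simp [w, hi] at h
  have hrow : ∀ i, μ.rowLen i = w i := fun i =>
    eq_of_forall_lt_iff fun j => by rw [← YoungDiagram.mem_iff_lt_rowLen, hmem]
  refine ⟨μ, ?_, fun i => by simp [hrow, w]⟩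
  by_contra hlt
  have := rowLen_pos_iff.2 (not_le.1 hlt)
  simp [hrow, w] at this

/-- Every exponent is a rearrangement of a partition. -/
theorem exists_rowLen_perm {n : ℕ} (η : Fin n → ℕ) :
    ∃ μ : YoungDiagram, μ.colLen 0 ≤ n ∧
      ∃ σ : Equiv.Perm (Fin n), ∀ i, η i = μ.rowLen (σ i) := by
  let τ : Equiv.Perm (Fin n) := Fin.revPerm.trans (Tuple.sort η)
  obtain ⟨μ, h1, h2⟩ := exists_youngDiagram_of_antitone (η ∘ τ) (by
    intro i j hij
    exact Tuple.monotone_sort η (Fin.rev_le_rev.2 hij))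
  refine ⟨μ, h1, τ.symm, fun i => ?_⟩
  rw [h2]
  simp

/-- The exponent of the leading monomial of `m_μ` in `n` variables. -/
def vec (n : ℕ) (μ : YoungDiagram) : Fin n →₀ ℕ :=
  Finsupp.equivFunOnFinite.symm fun i => μ.rowLen i

@[simp] theorem vec_apply (n : ℕ) (μ : YoungDiagram) (i : Fin n) : vec n μ i = μ.rowLen i := rfl

theorem vec_injective {n : ℕ} {μ ν : YoungDiagram} (hμ : μ.colLen 0 ≤ n) (hν : ν.colLen 0 ≤ n)
    (h : vec n μ = vec n ν) : μ = ν := by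
  refine youngDiagram_ext fun i => ?_
  by_cases hi : i < n
  · exact DFunLike.congr_fun h (⟨i, hi⟩ : Fin n)
  · rw [rowLen_eq_zero (by omega), rowLen_eq_zero (by omega)]

theorem degree_vec {n : ℕ} {μ : YoungDiagram} (hμ : μ.colLen 0 ≤ n) :
    (vec n μ).degree = μ.card := by
  rw [card_eq_sum_rowLen μ hμ, Finsupp.degree_eq_sum, Finset.sum_range]
  rfl

theorem rowLens_injective {μ ν : YoungDiagram}
    (h : (μ.rowLens : Multiset ℕ) = (ν.rowLens : Multiset ℕ)) : μ = ν := by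
  have h1 : μ.rowLens = ν.rowLens :=
    (Multiset.coe_eq_coe.1 h).eq_of_pairwise' μ.rowLens_sorted.pairwise ν.rowLens_sorted.pairwise
  apply YoungDiagram.equivListRowLens.injective
  exact Subtype.ext h1

/-- Extension of an exponent by zero. -/
abbrev pad {n : ℕ} (η : Fin n →₀ ℕ) : ℕ →₀ ℕ := η.embDomain Fin.valEmbedding

theorem exists_eq_pad (d : ℕ →₀ ℕ) : ∃ (n : ℕ) (η : Fin n →₀ ℕ), d = pad η := by
  obtain ⟨n, hn⟩ := d.support.exists_nat_subset_range
  refine ⟨n, Finsupp.equivFunOnFinite.symm fun i => d i, ?_⟩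
  ext i
  by_cases hi : i < n
  · rw [show i = Fin.valEmbedding (⟨i, hi⟩ : Fin n) from rfl, pad, Finsupp.embDomain_apply_self]
    rfl
  · rw [Finsupp.embDomain_of_notMem_range]
    · by_contra hne
      exact hi (Finset.mem_range.1 (hn (Finsupp.mem_support_iff.2 hne)))
    · rintro ⟨j, rfl⟩
      exact hi j.2

theorem multiset_pad {n : ℕ} {μ : YoungDiagram} (hμ : μ.colLen 0 ≤ n) (σ : Equiv.Perm (Fin n))
    (η : Fin n →₀ ℕ) (h : ∀ i, η i = μ.rowLen (σ i)) :
    (pad η).support.val.map (pad η) = (μ.rowLens : Multiset ℕ) := by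
  rw [Finsupp.support_embDomain, Finset.map_val, Multiset.map_map]
  have h1 : ∀ i : Fin n, ((pad η) ∘ Fin.valEmbedding) i = μ.rowLen (σ i) := fun i => by
    rw [Function.comp_apply, Finsupp.embDomain_apply_self, h]
  rw [Multiset.map_congr rfl fun i _ => h1 i]
  have h2 : (μ.rowLens : Multiset ℕ) = (Finset.range (μ.colLen 0)).val.map μ.rowLen := rfl
  have h3 : Finset.range (μ.colLen 0) = η.support.map (σ.toEmbedding.trans Fin.valEmbedding) := by
    ext i
    simp only [Finset.mem_range, Finset.mem_map, Finsupp.mem_support_iff, h]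
    rw [← rowLen_pos_iff]
    constructor
    · intro hi
      have hin : i < n := lt_of_lt_of_le (rowLen_pos_iff.1 hi) hμ
      exact ⟨σ.symm ⟨i, hin⟩, by simpa using hi.ne', by simp⟩
    · rintro ⟨j, hj, rfl⟩
      exact Nat.pos_of_ne_zero hj
  rw [h2, h3, Finset.map_val, Multiset.map_map]
  rfl

theorem monomialSym_pad {n : ℕ} {μ ν : YoungDiagram} (hμ : μ.colLen 0 ≤ n)
    (σ : Equiv.Perm (Fin n)) (η : Fin n →₀ ℕ) (h : ∀ i, η i = μ.rowLen (σ i)) [Decidable (μ = ν)] :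
    MvPowerSeries.coeff (pad η) (monomialSym ν) = if μ = ν then 1 else 0 := by
  change (if (pad η).support.val.map (pad η) = (ν.rowLens : Multiset ℕ) then (1 : ℂ) else 0) = _
  rw [multiset_pad hμ σ η h]
  by_cases hμν : μ = ν
  · simp [hμν]
  · rw [if_neg hμν, if_neg fun h => hμν (rowLens_injective h)]

instance finite_card_eq (N : ℕ) : Finite {μ : YoungDiagram // μ.card = N} := by
  refine Finite.of_injective
    (β := {s : Finset (ℕ × ℕ) // s ⊆ Finset.range N ×ˢ Finset.range N})
    (fun μ => ⟨μ.1.cells, ?_⟩) ?_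
  · rintro ⟨i, j⟩ hij
    have hij' : (i, j) ∈ μ.1 := hij
    have h1 := colLen_le_card μ.1
    have h2 := colLen_le_card μ.1.transpose
    have h3 : μ.1.transpose.card = μ.1.card := by
      simp only [YoungDiagram.card, YoungDiagram.transpose]
      simp
    have h4 := YoungDiagram.mem_iff_lt_colLen.1 (μ.1.up_left_mem le_rfl (Nat.zero_le j) hij')
    have h5 := YoungDiagram.mem_iff_lt_rowLen.1 (μ.1.up_left_mem (Nat.zero_le i) le_rfl hij')
    rw [YoungDiagram.colLen_transpose] at h2
    have h6 := μ.2
    simp only [Finset.mem_product, Finset.mem_range]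
    omega
  · intro μ ν h
    apply Subtype.ext
    apply YoungDiagram.ext
    exact congrArg Subtype.val h

/-- The exponent, in the power sums, of `∏ p_{μ_i}`. -/
def powerExp (μ : YoungDiagram) : ℕ+ →₀ ℕ :=
  Multiset.toFinsupp ((μ.rowLens : Multiset ℕ).map Nat.toPNat')

/-- The degree, in the variables `x_i`, of a monomial in the power sums. -/
abbrev wt : ℕ+ → ℕ := fun k => k

theorem map_toPNat'_rowLens (μ : YoungDiagram) :
    ((μ.rowLens : Multiset ℕ).map Nat.toPNat').map (fun k : ℕ+ => (k : ℕ)) = μ.rowLens := by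
  rw [Multiset.map_map]
  conv_rhs => rw [← Multiset.map_id (μ.rowLens : Multiset ℕ)]
  refine Multiset.map_congr rfl fun x hx => ?_
  have := μ.pos_of_mem_rowLens x hx
  simp [Nat.toPNat'_coe, this]

theorem powerExp_injective : Function.Injective powerExp := by
  intro μ ν h
  apply rowLens_injective
  rw [← map_toPNat'_rowLens μ, ← map_toPNat'_rowLens ν]
  rw [Multiset.toFinsupp.injective h]

theorem weight_toFinsupp (s : Multiset ℕ+) :
    Finsupp.weight wt (Multiset.toFinsupp s) = (s.map fun k : ℕ+ => (k : ℕ)).sum := by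
  induction s using Multiset.induction_on with
  | empty => simp
  | cons a s ih =>
    rw [← Multiset.singleton_add, map_add, map_add, ih]
    simp [Finsupp.weight_single]

theorem weight_powerExp (μ : YoungDiagram) : Finsupp.weight wt (powerExp μ) = μ.card := by
  rw [powerExp, weight_toFinsupp, map_toPNat'_rowLens, card_eq_sum_rowLen μ le_rfl]
  rfl

end

noncomputable section

open MvPolynomial

/-! ### Restriction to finitely many variables -/

/-- Restriction of a symmetric function to the variables `x₀, …, x_{n-1}`. -/
def res (n : ℕ) : SymFun →ₐ[ℂ] MvPolynomial (Fin n) ℂ :=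
  aeval fun k : ℕ+ => psum (Fin n) ℂ k

@[simp] theorem res_X (n : ℕ) (k : ℕ+) : res n (X k) = psum (Fin n) ℂ k := aeval_X _ _

theorem killCompl_powerSum (n : ℕ) (k : ℕ+) :
    MvPowerSeries.killCompl (R := ℂ) (Fin.valEmbedding (n := n)) (powerSum k) =
      ((psum (Fin n) ℂ k : MvPolynomial (Fin n) ℂ) : MvPowerSeries (Fin n) ℂ) := by
  classical
  ext η
  rw [MvPowerSeries.coeff_killCompl, MvPolynomial.coeff_coe, psum, coeff_sum]
  simp only [coeff_X_pow]
  change (if ∃ i : ℕ, _ = Finsupp.single i (k : ℕ) then (1 : ℂ) else 0) = _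
  split_ifs with h
  · obtain ⟨i, hi⟩ := h
    have hk : (k : ℕ) ≠ 0 := k.pos.ne'
    have hin : i ∈ Set.range (Fin.valEmbedding (n := n)) := by
      by_contra hni
      have h1 := DFunLike.congr_fun hi i
      rw [Finsupp.embDomain_of_notMem_range _ _ _ hni, Finsupp.single_eq_same] at h1
      exact hk h1.symm
    obtain ⟨j, rfl⟩ := hin
    rw [← Finsupp.embDomain_single] at hi
    have := Finsupp.embDomain_injective _ hi
    subst this
    rw [Finset.sum_eq_single j]
    · simp
    · intro b _ hb
      rw [if_neg]
      intro h2
      exact hb ((Finsupp.single_left_inj hk).1 h2)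
    · simp
  · symm
    refine Finset.sum_eq_zero fun i _ => if_neg fun h2 => h ⟨i, ?_⟩
    rw [← h2, Finsupp.embDomain_single]
    rfl

theorem killCompl_expand (n : ℕ) (f : SymFun) :
    MvPowerSeries.killCompl (R := ℂ) (Fin.valEmbedding (n := n)) (expand f) =
      (res n f : MvPowerSeries (Fin n) ℂ) := by
  have : (MvPowerSeries.killCompl (R := ℂ) (Fin.valEmbedding (n := n))).comp expand =
      (MvPolynomial.coeToMvPowerSeries.algHom (R := ℂ) ℂ).comp (res n) := by
    apply MvPolynomial.algHom_ext
    intro k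
    simp only [AlgHom.comp_apply, res_X, expand, aeval_X, killCompl_powerSum]
    simp [MvPolynomial.coeToMvPowerSeries.algHom_apply]
  have h := DFunLike.congr_fun this f
  simpa [MvPolynomial.coeToMvPowerSeries.algHom_apply] using h

theorem coeff_expand_pad {n : ℕ} (f : SymFun) (η : Fin n →₀ ℕ) :
    MvPowerSeries.coeff (pad η) (expand f) = (res n f).coeff η := by
  rw [← MvPolynomial.coeff_coe, ← killCompl_expand, MvPowerSeries.coeff_killCompl]

theorem res_isSymmetric (n : ℕ) (f : SymFun) : (res n f).IsSymmetric := by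
  change res n f ∈ symmetricSubalgebra (Fin n) ℂ
  induction f using MvPolynomial.induction_on with
  | C c =>
    have : res n (C c) = algebraMap ℂ _ c := (res n).commutes c
    rw [this]
    exact (symmetricSubalgebra (Fin n) ℂ).algebraMap_mem c
  | add p q hp hq => rw [map_add]; exact add_mem hp hq
  | mul_X p k hp =>
    rw [map_mul, res_X]
    exact mul_mem hp (psum_isSymmetric _ _ _)

theorem coeff_symmetric {n : ℕ} {F : MvPolynomial (Fin n) ℂ} (hF : F.IsSymmetric)
    (σ : Equiv.Perm (Fin n)) (η ζ : Fin n →₀ ℕ) (h : ∀ i, η i = ζ (σ i)) :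
    F.coeff η = F.coeff ζ := by
  have h1 : ζ = η.mapDomain σ := by
    ext i
    rw [← σ.apply_symm_apply i, Finsupp.mapDomain_apply σ.injective, h]
  rw [h1]
  conv_rhs => rw [← hF σ]
  rw [coeff_rename_mapDomain _ σ.injective]

/-- The coefficient of `m_μ` in a symmetric function. -/
def monCoeff (μ : YoungDiagram) : SymFun →ₗ[ℂ] ℂ :=
  MvPolynomial.lcoeff ℂ (vec (μ.colLen 0) μ) ∘ₗ (res (μ.colLen 0)).toLinearMap

theorem pad_vec {n : ℕ} {μ : YoungDiagram} (hμ : μ.colLen 0 ≤ n) :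
    pad (vec n μ) = pad (vec (μ.colLen 0) μ) := by
  have key : ∀ k, μ.colLen 0 ≤ k → ∀ i, pad (vec k μ) i = μ.rowLen i := by
    intro k hk i
    by_cases hi : i < k
    · rw [show i = Fin.valEmbedding (⟨i, hi⟩ : Fin k) from rfl, pad, Finsupp.embDomain_apply_self]
      rfl
    · rw [Finsupp.embDomain_of_notMem_range, rowLen_eq_zero (by omega)]
      rintro ⟨j, rfl⟩
      exact hi j.2
  ext i
  rw [key n hμ, key _ le_rfl]

theorem monCoeff_eq {n : ℕ} {μ : YoungDiagram} (hμ : μ.colLen 0 ≤ n) (f : SymFun) :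
    monCoeff μ f = (res n f).coeff (vec n μ) := by
  rw [← coeff_expand_pad, pad_vec hμ, coeff_expand_pad]
  rfl

theorem coeff_res {n : ℕ} {μ : YoungDiagram} (hμ : μ.colLen 0 ≤ n) (σ : Equiv.Perm (Fin n))
    (η : Fin n →₀ ℕ) (h : ∀ i, η i = μ.rowLen (σ i)) (f : SymFun) :
    (res n f).coeff η = monCoeff μ f := by
  rw [monCoeff_eq hμ, coeff_symmetric (res_isSymmetric n f) σ η (vec n μ) h]

theorem exists_coeff_res {n : ℕ} (η : Fin n →₀ ℕ) :
    ∃ μ : YoungDiagram, μ.colLen 0 ≤ n ∧ ∃ σ : Equiv.Perm (Fin n),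
      (∀ i, η i = μ.rowLen (σ i)) ∧ ∀ f, (res n f).coeff η = monCoeff μ f := by
  obtain ⟨μ, h1, σ, h2⟩ := exists_rowLen_perm η
  exact ⟨μ, h1, σ, h2, coeff_res h1 σ η h2⟩

theorem res_eq_zero_iff {n : ℕ} (f : SymFun) :
    res n f = 0 ↔ ∀ μ : YoungDiagram, μ.colLen 0 ≤ n → monCoeff μ f = 0 := by
  constructor
  · intro h μ hμ
    rw [monCoeff_eq hμ, h, coeff_zero]
  · intro h
    ext η
    obtain ⟨μ, h1, -, -, h2⟩ := exists_coeff_res η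
    rw [h2, h μ h1, coeff_zero]

/-! ### Adding one variable -/

/-- The substitution `p_j ↦ p_j + w ^ j`. -/
def shift : SymFun →ₐ[ℂ] Polynomial SymFun :=
  aeval fun j : ℕ+ => Polynomial.C (X j) + Polynomial.X ^ (j : ℕ)

/-- The coefficient of `w ^ k` after adding a variable `w`. -/
def shiftCoeff (k : ℕ) (f : SymFun) : SymFun := (shift f).coeff k

/-- The derivation `∂/∂p_j`, or `0` for `j = 0`. -/
def dp (j : ℕ) : Derivation ℂ SymFun SymFun :=
  if h : 0 < j then pderiv ⟨j, h⟩ else 0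

theorem dp_coe (k : ℕ+) : dp k = pderiv k := by
  rw [dp, dif_pos k.pos]
  rfl

@[simp] theorem dp_zero : dp 0 = 0 := rfl

theorem dp_X (j : ℕ) (i : ℕ+) : dp j (X i) = if (i : ℕ) = j then 1 else 0 := by
  classical
  unfold dp
  split_ifs with h h' h'
  · subst h'
    exact pderiv_X_self i
  · exact pderiv_X_of_ne fun h2 => h' (congrArg PNat.val h2)
  · exact absurd i.pos (by omega)
  · rfl

theorem finSuccEquiv_res (n : ℕ) (f : SymFun) :
    finSuccEquiv ℂ n (res (n + 1) f) = (shift f).map (res n : SymFun →+* _) := by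
  have : ((finSuccEquiv ℂ n : _ →ₐ[ℂ] _)).comp (res (n + 1)) =
      (Polynomial.mapAlgHom (res n)).comp shift := by
    apply MvPolynomial.algHom_ext
    intro k
    simp only [AlgHom.comp_apply, res_X, shift, aeval_X, psum, Fin.sum_univ_succ, map_add,
      map_sum, map_pow, Polynomial.coe_mapAlgHom]
    simp [finSuccEquiv_X_zero, finSuccEquiv_X_succ, add_comm, psum]
  exact DFunLike.congr_fun this f

theorem coeff_res_shiftCoeff (n k : ℕ) (f : SymFun) (η : Fin n →₀ ℕ) :
    (res n (shiftCoeff k f)).coeff η = (res (n + 1) f).coeff (η.cons k) := by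
  rw [← finSuccEquiv_coeff_coeff, finSuccEquiv_res, Polynomial.coeff_map]
  rfl

theorem shiftCoeff_add (k : ℕ) (f g : SymFun) :
    shiftCoeff k (f + g) = shiftCoeff k f + shiftCoeff k g := by
  simp [shiftCoeff]

theorem shiftCoeff_C (k : ℕ) (c : ℂ) : shiftCoeff k (C c) = if k = 0 then C c else 0 := by
  have : shift (C c) = Polynomial.C (C c) := shift.commutes c
  rw [shiftCoeff, this, Polynomial.coeff_C]

theorem shiftCoeff_mul_X (k : ℕ) (f : SymFun) (i : ℕ+) :
    shiftCoeff k (f * X i) =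
      shiftCoeff k f * X i + if (i : ℕ) ≤ k then shiftCoeff (k - i) f else 0 := by
  have : shift (X i) = Polynomial.C (X i) + Polynomial.X ^ (i : ℕ) := aeval_X _ _
  rw [shiftCoeff, map_mul, this, mul_add, Polynomial.coeff_add, Polynomial.coeff_mul_C,
    Polynomial.coeff_mul_X_pow']
  rfl

theorem shiftCoeff_zero (f : SymFun) : shiftCoeff 0 f = f := by
  induction f using MvPolynomial.induction_on with
  | C c => simp [shiftCoeff_C]
  | add p q hp hq => rw [shiftCoeff_add, hp, hq]
  | mul_X p i hp => simp [shiftCoeff_mul_X, hp]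

theorem shiftCoeff_dp (k j : ℕ) (f : SymFun) :
    shiftCoeff k (dp j f) = dp j (shiftCoeff k f) := by
  induction f using MvPolynomial.induction_on generalizing k with
  | C c =>
    have h0 : dp j (C c) = 0 := (dp j).map_algebraMap c
    rw [h0, shiftCoeff_C]
    split_ifs
    · simp [h0, shiftCoeff]
    · simp [shiftCoeff]
  | add p q hp hq => rw [map_add, shiftCoeff_add, hp, hq, shiftCoeff_add, map_add]
  | mul_X p i hp =>
    rw [shiftCoeff_mul_X, Derivation.leibniz, dp_X, map_add, Derivation.leibniz, dp_X,
      shiftCoeff_add, smul_eq_mul, smul_eq_mul, smul_eq_mul, smul_eq_mul, mul_comm (X i) (dp j p),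
      shiftCoeff_mul_X, hp]
    have e1 : shiftCoeff k (p * if (i : ℕ) = j then 1 else 0) =
        shiftCoeff k p * if (i : ℕ) = j then 1 else 0 := by
      split_ifs
      · simp
      · simp [shiftCoeff]
    rw [e1]
    split_ifs <;> simp [hp] <;> ring

/-- The logarithmic derivative of the shift. -/
theorem nsmul_shiftCoeff (k : ℕ) (f : SymFun) :
    k • shiftCoeff k f = ∑ j ∈ Finset.range (k + 1), j • dp j (shiftCoeff (k - j) f) := by
  induction f using MvPolynomial.induction_on generalizing k with
  | C c =>
    have h0 : ∀ j, dp j (C c) = 0 := fun j => (dp j).map_algebraMap c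
    rw [shiftCoeff_C, Finset.sum_eq_zero]
    · split_ifs with h <;> simp [h]
    · intro j _
      rw [shiftCoeff_C]
      split_ifs <;> simp [h0]
  | add p q hp hq => simp only [shiftCoeff_add, smul_add, hp, hq, map_add, Finset.sum_add_distrib]
  | mul_X p i hp =>
    have h1 : ∀ j ∈ Finset.range (k + 1), j • dp j (shiftCoeff (k - j) (p * X i)) =
        (j • dp j (shiftCoeff (k - j) p)) * X i +
        ((if (i : ℕ) = j then j • shiftCoeff (k - j) p else 0) +
        if j + i ≤ k then j • dp j (shiftCoeff (k - i - j) p) else 0) := by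
      intro j hj
      have hj' : j ≤ k := Nat.lt_succ_iff.1 (Finset.mem_range.1 hj)
      rw [shiftCoeff_mul_X, map_add, Derivation.leibniz, dp_X]
      by_cases hle : j + i ≤ k
      · rw [if_pos hle, if_pos (show (i : ℕ) ≤ k - j by omega), show k - j - i = k - i - j by omega]
        simp only [smul_eq_mul, nsmul_eq_mul]
        split_ifs <;> ring
      · rw [if_neg hle, if_neg (show ¬(i : ℕ) ≤ k - j by omega)]
        simp only [smul_eq_mul, nsmul_eq_mul, map_zero]
        split_ifs <;> ring
    rw [Finset.sum_congr rfl h1, Finset.sum_add_distrib, Finset.sum_add_distrib,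
      ← Finset.sum_mul, ← hp, Finset.sum_ite_eq, shiftCoeff_mul_X]
    by_cases hik : (i : ℕ) ≤ k
    · rw [if_pos hik, if_pos (Finset.mem_range.2 (by omega))]
      have h2 : ∑ j ∈ Finset.range (k + 1),
          (if j + i ≤ k then j • dp j (shiftCoeff (k - i - j) p) else 0) =
          ∑ j ∈ Finset.range (k - i + 1), j • dp j (shiftCoeff (k - i - j) p) := by
        rw [← Finset.sum_filter]
        refine Finset.sum_congr ?_ fun _ _ => rfl
        ext j
        simp only [Finset.mem_filter, Finset.mem_range]
        omega
      rw [h2, ← hp]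
      obtain ⟨l, hl⟩ := Nat.exists_eq_add_of_le hik
      rw [show k - i = l by omega, hl]
      simp only [nsmul_eq_mul]
      push_cast
      ring
    · rw [if_neg hik, if_neg (by rw [Finset.mem_range]; omega), Finset.sum_eq_zero]
      · simp only [nsmul_eq_mul]
        ring
      · intro j _
        rw [if_neg (by omega)]

/-- A symmetric function vanishing in any number of variables is zero. -/
theorem eq_zero_of_res (f : SymFun) (h : ∀ n, res n f = 0) : f = 0 := by
  let Z : Submodule ℂ SymFun := ⨅ n, LinearMap.ker (res n).toLinearMap
  have hZ : ∀ g, g ∈ Z ↔ ∀ n, res n g = 0 := by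
    intro g
    simp [Z, Submodule.mem_iInf]
  have hT : ∀ k, ∀ g ∈ Z, shiftCoeff k g ∈ Z := by
    intro k g hg
    rw [hZ] at hg ⊢
    intro n
    ext η
    rw [coeff_res_shiftCoeff, hg]
    rfl
  have hD : ∀ k, ∀ g ∈ Z, dp k g ∈ Z := by
    intro k
    induction k using Nat.strong_induction_on with
    | _ k ih =>
      intro g hg
      rcases Nat.eq_zero_or_pos k with rfl | hk
      · simp
      have h1 := nsmul_shiftCoeff k g
      rw [Finset.sum_range_succ, Nat.sub_self, shiftCoeff_zero] at h1
      have h2 : (k : ℂ) • dp k g ∈ Z := by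
        rw [Nat.cast_smul_eq_nsmul, eq_sub_of_add_eq' h1.symm]
        refine Z.sub_mem (Z.smul_of_tower_mem _ (hT k g hg)) (Z.sum_mem fun j hj => ?_)
        exact Z.smul_of_tower_mem _ (ih j (Finset.mem_range.1 hj) _ (hT _ g hg))
      have hk' : (k : ℂ) ≠ 0 := Nat.cast_ne_zero.2 hk.ne'
      rwa [Submodule.smul_mem_iff _ hk'] at h2
  have hc : ∀ N : ℕ, ∀ d : ℕ+ →₀ ℕ, d.degree = N → ∀ g ∈ Z, g.coeff d = 0 := by
    intro N
    induction N with
    | zero =>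
      intro d hd g hg
      rw [Finsupp.degree_eq_zero_iff] at hd
      subst hd
      have h0 := congrArg (coeff 0) ((hZ g).1 hg 0)
      rw [coeff_zero] at h0
      rw [← h0]
      have : ∀ g : SymFun, coeff 0 g = coeff 0 (res 0 g) := by
        intro g
        induction g using MvPolynomial.induction_on with
        | C c =>
          have : res 0 (C c) = C c := (res 0).commutes c
          rw [this, coeff_zero_C, coeff_zero_C]
        | add p q hp hq => rw [map_add, coeff_add, coeff_add, hp, hq]
        | mul_X p i hp => simp [psum, coeff_mul_X']
      exact this g
    | succ N ih =>
      intro d hd g hg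
      have hne : d ≠ 0 := by
        rintro rfl
        simp at hd
      obtain ⟨k, hk⟩ := Finsupp.support_nonempty_iff.2 hne
      have hk1 : 1 ≤ d k := Nat.one_le_iff_ne_zero.2 (Finsupp.mem_support_iff.1 hk)
      have hd' : d - Finsupp.single k 1 + Finsupp.single k 1 = d :=
        tsub_add_cancel_of_le (Finsupp.single_le_iff.2 hk1)
      have h1 := ih (d - Finsupp.single k 1) (by
        have := congrArg Finsupp.degree hd'
        rw [map_add, Finsupp.degree_single] at this
        omega) (dp k g) (hD k g hg)
      rw [dp_coe, coeff_pderiv, hd', mul_eq_zero] at h1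
      rcases h1 with h1 | h1
      · exact h1
      · exfalso
        exact Nat.cast_add_one_ne_zero _ h1
  ext d
  exact hc _ d rfl f ((hZ f).2 h)

theorem eq_zero_of_monCoeff (f : SymFun) (h : ∀ μ, monCoeff μ f = 0) : f = 0 :=
  eq_zero_of_res f fun _ => (res_eq_zero_iff f).2 fun μ _ => h μ

end

noncomputable section

open MvPolynomial

/-! ### The basis of monomial symmetric functions -/

theorem psum_isHomogeneous (n k : ℕ) : (psum (Fin n) ℂ k).IsHomogeneous k :=
  IsHomogeneous.sum _ _ _ fun i _ => isHomogeneous_X_pow i k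

theorem res_isHomogeneous (n : ℕ) {N : ℕ} {f : SymFun} (hf : IsWeightedHomogeneous wt f N) :
    (res n f).IsHomogeneous N := by
  rw [f.as_sum, map_sum]
  refine IsHomogeneous.sum _ _ _ fun d hd => ?_
  have h1 : Finsupp.weight wt d = N := hf (mem_support_iff.1 hd)
  rw [res, aeval_monomial, ← h1, ← zero_add (Finsupp.weight wt d)]
  refine (isHomogeneous_C _ _).mul ?_
  rw [Finsupp.weight_apply, Finsupp.sum, Finsupp.prod]
  refine IsHomogeneous.prod _ _ _ fun k _ => ?_
  rw [smul_eq_mul, mul_comm]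
  exact (psum_isHomogeneous n k).pow _

theorem monCoeff_eq_zero_of_card_ne {N : ℕ} {f : SymFun} (hf : IsWeightedHomogeneous wt f N)
    {μ : YoungDiagram} (hμ : μ.card ≠ N) : monCoeff μ f = 0 := by
  rw [monCoeff_eq le_rfl]
  refine (res_isHomogeneous _ hf).coeff_eq_zero ?_
  rwa [degree_vec le_rfl]

theorem exists_monomial (ν : YoungDiagram) :
    ∃ M : SymFun, IsWeightedHomogeneous wt M ν.card ∧
      ∀ μ, monCoeff μ M = open Classical in if μ = ν then 1 else 0 := by
  classical
  let I := {μ : YoungDiagram // μ.card = ν.card}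
  have : Fintype I := Fintype.ofFinite I
  let Ψ : (I → ℂ) →ₗ[ℂ] SymFun := Fintype.linearCombination ℂ fun κ : I =>
    (monomial (powerExp κ.1) 1 : SymFun)
  have hΨ : ∀ v, IsWeightedHomogeneous wt (Ψ v) ν.card := by
    intro v
    rw [Fintype.linearCombination_apply, ← mem_weightedHomogeneousSubmodule (R := ℂ)]
    refine Submodule.sum_mem _ fun κ _ => Submodule.smul_mem _ _ ?_
    rw [mem_weightedHomogeneousSubmodule]
    exact isWeightedHomogeneous_monomial _ _ _ (by rw [weight_powerExp, κ.2])
  have hΨinj : ∀ v, Ψ v = 0 → v = 0 := by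
    intro v hv
    ext κ
    have h1 := congrArg (coeff (powerExp κ.1)) hv
    rw [Fintype.linearCombination_apply, coeff_sum, coeff_zero,
      Finset.sum_eq_single κ] at h1
    · simpa using h1
    · intro κ' _ hne
      rw [coeff_smul, coeff_monomial, if_neg, smul_zero]
      exact fun h => hne (Subtype.ext (powerExp_injective h))
    · simp
  let Φ : (I → ℂ) →ₗ[ℂ] (I → ℂ) := LinearMap.pi fun μ : I => monCoeff μ.1 ∘ₗ Ψ
  have hΦ : Function.Injective Φ := by
    rw [injective_iff_map_eq_zero]
    intro v hv
    refine hΨinj v (eq_zero_of_monCoeff _ fun μ => ?_)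
    by_cases hμ : μ.card = ν.card
    · exact congrFun hv ⟨μ, hμ⟩
    · exact monCoeff_eq_zero_of_card_ne (hΨ v) hμ
  obtain ⟨v, hv⟩ := (LinearMap.injective_iff_surjective.1 hΦ) (Pi.single ⟨ν, rfl⟩ 1)
  refine ⟨Ψ v, hΨ v, fun μ => ?_⟩
  by_cases hμ : μ.card = ν.card
  · have h1 := congrFun hv ⟨μ, hμ⟩
    rw [Pi.single_apply] at h1
    have h2 : ((⟨μ, hμ⟩ : I) = ⟨ν, rfl⟩) ↔ μ = ν := Subtype.mk_eq_mk
    simp only [h2] at h1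
    change monCoeff μ (Ψ v) = _ at h1
    convert h1
  · rw [monCoeff_eq_zero_of_card_ne (hΨ v) hμ, if_neg]
    rintro rfl
    exact hμ rfl

/-- The monomial symmetric function `m_μ` as an element of `Λ`. -/
def mono (μ : YoungDiagram) : SymFun := (exists_monomial μ).choose

theorem mono_isWeightedHomogeneous (μ : YoungDiagram) :
    IsWeightedHomogeneous wt (mono μ) μ.card := (exists_monomial μ).choose_spec.1

theorem monCoeff_mono (μ ν : YoungDiagram) [Decidable (μ = ν)] :
    monCoeff μ (mono ν) = if μ = ν then 1 else 0 := by
  have := (exists_monomial ν).choose_spec.2 μ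
  rw [mono]
  convert this

theorem expand_mono (ν : YoungDiagram) : expand (mono ν) = monomialSym ν := by
  classical
  ext d
  obtain ⟨n, η, rfl⟩ := exists_eq_pad d
  obtain ⟨μ, h1, σ, h2, h3⟩ := exists_coeff_res η
  rw [coeff_expand_pad, h3, monCoeff_mono, monomialSym_pad h1 σ η h2]

theorem expand_injective : Function.Injective expand := by
  rw [injective_iff_map_eq_zero]
  intro f hf
  refine eq_zero_of_res f fun n => ?_
  ext η
  rw [← coeff_expand_pad, hf]
  simp

theorem linearIndependent_mono : LinearIndependent ℂ mono := by
  classical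
  rw [linearIndependent_iff']
  intro s g hg i hi
  have h1 := congrArg (monCoeff i) hg
  rw [map_sum, map_zero, Finset.sum_eq_single i] at h1
  · simpa [monCoeff_mono] using h1
  · intro j _ hj
    simp [monCoeff_mono, hj.symm]
  · exact fun h => absurd hi h

theorem span_mono : ⊤ ≤ Submodule.span ℂ (Set.range mono) := by
  classical
  intro f _
  rw [f.as_sum]
  refine Submodule.sum_mem _ fun d _ => ?_
  generalize f.coeff d = c
  let N := Finsupp.weight wt d
  have : Fintype {μ : YoungDiagram // μ.card = N} := Fintype.ofFinite _
  have hf : IsWeightedHomogeneous wt (monomial d c) N := isWeightedHomogeneous_monomial _ _ _ rfl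
  have key : monomial d c -
      ∑ κ : {μ : YoungDiagram // μ.card = N}, monCoeff κ.1 (monomial d c) • mono κ.1 = 0 := by
    refine eq_zero_of_monCoeff _ fun μ => ?_
    rw [map_sub, map_sum, sub_eq_zero]
    simp only [map_smul, monCoeff_mono, smul_eq_mul, mul_ite, mul_one, mul_zero]
    by_cases hμ : μ.card = N
    · rw [Finset.sum_eq_single ⟨μ, hμ⟩]
      · simp
      · intro κ _ hκ
        rw [if_neg]
        rintro rfl
        exact hκ rfl
      · simp
    · rw [monCoeff_eq_zero_of_card_ne hf hμ, Finset.sum_eq_zero]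
      intro κ _
      rw [if_neg]
      rintro rfl
      exact hμ κ.2
  rw [sub_eq_zero.1 key]
  exact Submodule.sum_mem _ fun κ _ => Submodule.smul_mem _ _ (Submodule.subset_span ⟨_, rfl⟩)

/-- The basis of monomial symmetric functions. -/
def monoBasis : Module.Basis YoungDiagram ℂ SymFun :=
  Module.Basis.mk linearIndependent_mono span_mono

@[simp] theorem monoBasis_apply (μ : YoungDiagram) : monoBasis μ = mono μ := by
  simp [monoBasis]

theorem monoBasis_repr (f : SymFun) (μ : YoungDiagram) : monoBasis.repr f μ = monCoeff μ f := by
  classical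
  have : (Finsupp.lapply μ : (YoungDiagram →₀ ℂ) →ₗ[ℂ] ℂ) ∘ₗ monoBasis.repr.toLinearMap =
      monCoeff μ := by
    apply monoBasis.ext
    intro ν
    rw [LinearMap.comp_apply, LinearEquiv.coe_coe, Module.Basis.repr_self, monoBasis_apply,
      monCoeff_mono, Finsupp.lapply_apply, Finsupp.single_apply]
    simp only [eq_comm]
  exact DFunLike.congr_fun this f

/-- The span of the `m_μ` with `μ` in a given set. -/
def monoSpan (S : Set YoungDiagram) : Submodule ℂ SymFun := Submodule.span ℂ (mono '' S)

theorem mem_monoSpan {S : Set YoungDiagram} {f : SymFun} :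
    f ∈ monoSpan S ↔ ∀ μ ∉ S, monCoeff μ f = 0 := by
  have h1 : mono '' S = monoBasis '' S := Set.image_congr fun μ _ => (monoBasis_apply μ).symm
  rw [monoSpan, h1, Module.Basis.mem_span_image]
  simp only [Set.subset_def, Finset.mem_coe, Finsupp.mem_support_iff, monoBasis_repr]
  exact forall_congr' fun μ => not_imp_comm

theorem mono_mem_monoSpan {S : Set YoungDiagram} {μ : YoungDiagram} (h : μ ∈ S) :
    mono μ ∈ monoSpan S := Submodule.subset_span ⟨μ, h, rfl⟩

theorem monoSpan_mono {S T : Set YoungDiagram} (h : S ⊆ T) : monoSpan S ≤ monoSpan T :=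
  Submodule.span_mono (Set.image_mono h)

theorem finiteDimensional_monoSpan {S : Set YoungDiagram} (hS : S.Finite) :
    FiniteDimensional ℂ (monoSpan S) :=
  FiniteDimensional.span_of_finite ℂ (hS.image _)

theorem res_conj (n : ℕ) (f : SymFun) :
    res n (conj f) = MvPolynomial.map (starRingEnd ℂ) (res n f) := by
  induction f using MvPolynomial.induction_on with
  | C c =>
    have h1 : ∀ c, res n (C c) = C c := (res n).commutes
    rw [conj, map_C, h1, h1, map_C]
  | add p q hp hq => simp only [map_add, hp, hq]
  | mul_X p i hp =>
    rw [map_mul, map_mul, map_mul, map_mul, hp, conj, map_X, res_X]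
    simp [psum]

theorem monCoeff_conj (μ : YoungDiagram) (f : SymFun) :
    monCoeff μ (conj f) = starRingEnd ℂ (monCoeff μ f) := by
  rw [monCoeff_eq le_rfl, res_conj, coeff_map, monCoeff_eq le_rfl]

theorem conj_mem_monoSpan {S : Set YoungDiagram} {f : SymFun} (hf : f ∈ monoSpan S) :
    conj f ∈ monoSpan S := by
  rw [mem_monoSpan] at hf ⊢
  intro μ hμ
  rw [monCoeff_conj, hf μ hμ, map_zero]

theorem conj_mono (μ : YoungDiagram) : conj (mono μ) = mono μ := by
  classical
  rw [← sub_eq_zero]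
  refine eq_zero_of_monCoeff _ fun ν => ?_
  rw [map_sub, monCoeff_conj, monCoeff_mono]
  split_ifs <;> simp

theorem expand_sub_mem_iff (f : SymFun) (ν : YoungDiagram) (S : Set YoungDiagram) :
    expand f - monomialSym ν ∈ Submodule.span ℂ (monomialSym '' S) ↔ f - mono ν ∈ monoSpan S := by
  have h1 : monomialSym '' S = expand.toLinearMap '' (mono '' S) := by
    rw [Set.image_image]
    exact Set.image_congr fun μ _ => (expand_mono μ).symm
  rw [h1, Submodule.span_image, ← expand_mono, ← map_sub]
  exact Function.Injective.mem_set_image (s := (monoSpan S : Set SymFun)) expand_injective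

theorem scalar_eq_zero_of_ne {a : ℂ} {f g : SymFun} {N N' : ℕ}
    (hf : IsWeightedHomogeneous wt f N) (hg : IsWeightedHomogeneous wt g N') (h : N ≠ N') :
    scalar a f g = 0 := by
  refine Finset.sum_eq_zero fun d hd => ?_
  have h1 : Finsupp.weight wt d = N := hf (mem_support_iff.1 hd)
  rw [hg.coeff_eq_zero d (by rwa [h1]), mul_zero, zero_mul]

end

noncomputable section

open MvPolynomial

/-! ### Dunkl operators on `Λ[w]` -/

/-- The power sum `p_j` in `n` variables, including `p₀ = n`. -/
def pn (n j : ℕ) : SymFun := if h : 0 < j then X ⟨j, h⟩ else C (n : ℂ)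

theorem pn_zero (n : ℕ) : pn n 0 = C (n : ℂ) := rfl

theorem pn_coe (n : ℕ) (k : ℕ+) : pn n k = X k := by
  rw [pn, dif_pos k.pos]
  rfl

theorem res_pn (n j : ℕ) : res n (pn n j) = psum (Fin n) ℂ j := by
  unfold pn
  split_ifs with h
  · exact res_X n _
  · have h1 : res n (C (n : ℂ)) = C (n : ℂ) := (res n).commutes _
    obtain rfl : j = 0 := by omega
    rw [h1]
    simp [psum]

/-- The derivation `p_l ↦ l w ^ l` from `Λ` to `Λ[w]`. -/
def theta : Derivation ℂ SymFun (Polynomial SymFun) :=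
  mkDerivation ℂ fun l : ℕ+ => (l : ℕ) • Polynomial.X ^ (l : ℕ)

theorem coeff_theta (f : SymFun) (j : ℕ) : (theta f).coeff j = j • dp j f := by
  induction f using MvPolynomial.induction_on with
  | C c =>
    have h1 : theta (C c) = 0 := theta.map_algebraMap c
    have h2 : dp j (C c) = 0 := (dp j).map_algebraMap c
    rw [h1, h2, smul_zero, Polynomial.coeff_zero]
  | add p q hp hq => rw [map_add, map_add, Polynomial.coeff_add, hp, hq, smul_add]
  | mul_X p i hp =>
    rw [Derivation.leibniz, Derivation.leibniz, Polynomial.coeff_add, Polynomial.coeff_smul,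
      Polynomial.coeff_smul, hp, dp_X, theta, mkDerivation_X, Polynomial.coeff_smul,
      Polynomial.coeff_X_pow]
    simp only [smul_eq_mul, nsmul_eq_mul]
    by_cases h : (i : ℕ) = j
    · simp [h]; ring
    · simp [h, Ne.symm h]; ring

/-- The coefficient polynomial of the Dunkl operator on `w ^ i`. -/
def dunklPoly (n m i : ℕ) : Polynomial SymFun :=
  (i : ℂ) • Polynomial.X ^ i + (m : ℂ) • (∑ c ∈ Finset.Icc 1 i,
    Polynomial.C (pn n (i - c)) * Polynomial.X ^ c - (i : ℂ) • Polynomial.X ^ i)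

/-- The Dunkl operator in the direction of `w`, one of `n` variables. -/
def dunkl (n m : ℕ) : Polynomial SymFun →ₗ[ℂ] Polynomial SymFun :=
  Polynomial.lsum fun i => LinearMap.mulLeft ℂ (Polynomial.X ^ i) ∘ₗ theta.toLinearMap +
    LinearMap.mulRight ℂ (dunklPoly n m i) ∘ₗ (Polynomial.CAlgHom (R := ℂ)).toLinearMap

theorem dunkl_monomial (n m i : ℕ) (f : SymFun) :
    dunkl n m (Polynomial.monomial i f) =
      Polynomial.X ^ i * theta f + Polynomial.C f * dunklPoly n m i := by
  rw [dunkl, Polynomial.lsum_apply, Polynomial.sum_monomial_index]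
  · simp
  · simp

theorem coeff_dunklPoly (n m i j : ℕ) : (dunklPoly n m i).coeff j =
    (if i = j then C ((i : ℂ) - m * i) else 0) +
      if 1 ≤ j ∧ j ≤ i then C (m : ℂ) * pn n (i - j) else 0 := by
  simp only [dunklPoly, Polynomial.coeff_add, Polynomial.coeff_smul, Polynomial.coeff_sub,
    Polynomial.coeff_X_pow, Polynomial.finsetSum_coeff, Polynomial.coeff_C_mul]
  have h1 : ∑ c ∈ Finset.Icc 1 i, pn n (i - c) * (if j = c then 1 else 0) =
      if 1 ≤ j ∧ j ≤ i then pn n (i - j) else 0 := by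
    simp only [mul_ite, mul_one, mul_zero, Finset.sum_ite_eq, Finset.mem_Icc]
  rw [h1]
  simp only [smul_eq_C_mul, C_sub, C_mul]
  by_cases h : i = j
  · subst h
    split_ifs <;> simp <;> ring
  · rw [if_neg h, if_neg (Ne.symm h)]
    split_ifs <;> simp

theorem coeff_dunkl_monomial (n m i j : ℕ) (f : SymFun) :
    (dunkl n m (Polynomial.monomial i f)).coeff j =
      (if i ≤ j then (j - i) • dp (j - i) f else 0) +
      ((if i = j then ((i : ℂ) - m * i) • f else 0) +
        if 1 ≤ j ∧ j ≤ i then (m : ℂ) • (pn n (i - j) * f) else 0) := by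
  rw [dunkl_monomial, Polynomial.coeff_add, Polynomial.coeff_X_pow_mul', Polynomial.coeff_C_mul,
    coeff_dunklPoly, coeff_theta, mul_add]
  simp only [smul_eq_C_mul]
  congr 1
  congr 1
  · split_ifs <;> ring
  · split_ifs <;> ring

theorem coeff_zero_dunkl (n m : ℕ) (F : Polynomial SymFun) : (dunkl n m F).coeff 0 = 0 := by
  induction F using Polynomial.induction_on' with
  | add p q hp hq => rw [map_add, Polynomial.coeff_add, hp, hq, add_zero]
  | monomial i f =>
    rw [coeff_dunkl_monomial]
    by_cases hi : i = 0
    · subst hi; simp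
    · simp [hi]

/-- The map `w ^ k ↦ p_k` from `Λ[w]` to `Λ`. -/
def trace (n : ℕ) : Polynomial SymFun →ₗ[ℂ] SymFun :=
  Polynomial.lsum fun i => LinearMap.mulLeft ℂ (pn n i)

theorem trace_monomial (n i : ℕ) (f : SymFun) :
    trace n (Polynomial.monomial i f) = pn n i * f := by
  rw [trace, Polynomial.lsum_apply, Polynomial.sum_monomial_index]
  · simp
  · simp

/-- The operator `∑ᵢ D_i ^ (k + 1)` on symmetric functions. -/
def ham (n m k : ℕ) (f : SymFun) : SymFun :=
  trace n ((dunkl n m)^[k + 1] (Polynomial.C f))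

/-! #### Self-adjointness -/

/-- The scalar product on `w Λ[w]` for which the powers of `w` are orthonormal. -/
def polyForm (a : ℂ) : Polynomial SymFun →ₗ[ℂ] Polynomial SymFun →ₗ[ℂ] ℂ :=
  Polynomial.lsum fun i => if i = 0 then 0 else
    (scalarₗ a).compl₂ ((Polynomial.lcoeff SymFun i).restrictScalars ℂ)

theorem polyForm_monomial (a : ℂ) (i : ℕ) (f : SymFun) (G : Polynomial SymFun) :
    polyForm a (Polynomial.monomial i f) G = if i = 0 then 0 else scalar a f (G.coeff i) := by
  rw [polyForm, Polynomial.lsum_apply, Polynomial.sum_monomial_index]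
  · split_ifs <;> simp
  · simp

theorem polyForm_comm (a : ℂ) (F G : Polynomial SymFun) : polyForm a F G = polyForm a G F := by
  induction F using Polynomial.induction_on' with
  | add p q hp hq => rw [map_add, map_add, LinearMap.add_apply, hp, hq]
  | monomial i f =>
    induction G using Polynomial.induction_on' with
    | add p q hp hq => rw [map_add, map_add, LinearMap.add_apply, hp, hq]
    | monomial j g =>
      rw [polyForm_monomial, polyForm_monomial, Polynomial.coeff_monomial,
        Polynomial.coeff_monomial]
      by_cases h : i = j
      · subst h; simp [scalar_comm]
      · simp [h, Ne.symm h]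

theorem scalar_pn_mul {m : ℕ} (hm : 0 < m) (n : ℕ) {k : ℕ} (hk : 0 < k) (f g : SymFun) :
    (m : ℂ) * scalar (m : ℂ) (pn n k * f) g = k * scalar (m : ℂ) f (dp k g) := by
  have hm' : (m : ℂ) ≠ 0 := Nat.cast_ne_zero.2 hm.ne'
  have h1 := scalar_X_mul (m : ℂ) ⟨k, hk⟩ f g
  have h2 : pn n k = X ⟨k, hk⟩ := pn_coe n ⟨k, hk⟩
  have h3 : dp k = pderiv ⟨k, hk⟩ := dp_coe ⟨k, hk⟩
  rw [h2, h3, h1, ← mul_assoc, ← mul_assoc, mul_inv_cancel₀ hm', one_mul]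
  rfl

theorem polyForm_dunkl_monomial {m : ℕ} (hm : 0 < m) (n : ℕ) {i j : ℕ} (hi : i ≠ 0) (hj : j ≠ 0)
    (f g : SymFun) :
    polyForm (m : ℂ) (dunkl n m (Polynomial.monomial i f)) (Polynomial.monomial j g) =
      polyForm (m : ℂ) (Polynomial.monomial i f) (dunkl n m (Polynomial.monomial j g)) := by
  rw [polyForm_comm, polyForm_monomial, polyForm_monomial, if_neg hi, if_neg hj,
    coeff_dunkl_monomial, coeff_dunkl_monomial]
  rcases lt_trichotomy i j with h | h | h
  · rw [if_pos h.le, if_neg h.ne, if_neg (show ¬(1 ≤ j ∧ j ≤ i) by omega),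
      if_neg (show ¬(j ≤ i) by omega), if_neg h.ne', if_pos (show 1 ≤ i ∧ i ≤ j by omega)]
    simp only [add_zero, zero_add]
    rw [← Nat.cast_smul_eq_nsmul ℂ, scalar_smul_right, scalar_smul_right, scalar_comm _ f,
      scalar_pn_mul hm n (by omega)]
  · subst h
    have h1 : 1 ≤ i ∧ i ≤ i := by omega
    rw [if_pos le_rfl, if_pos rfl, if_pos h1, if_pos le_rfl, if_pos rfl, if_pos h1]
    simp only [Nat.sub_self, pn_zero, zero_smul, zero_add, scalar_add_right, scalar_smul_right,
      ← smul_eq_C_mul]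
    rw [scalar_comm _ g f]
  · rw [if_neg (show ¬(i ≤ j) by omega), if_neg h.ne', if_pos (show 1 ≤ j ∧ j ≤ i by omega),
      if_pos h.le, if_neg h.ne, if_neg (show ¬(1 ≤ i ∧ i ≤ j) by omega)]
    simp only [add_zero, zero_add]
    rw [← Nat.cast_smul_eq_nsmul ℂ, scalar_smul_right, scalar_smul_right, scalar_comm _ g,
      scalar_pn_mul hm n (by omega)]

theorem polyForm_dunkl {m : ℕ} (hm : 0 < m) (n : ℕ) (F G : Polynomial SymFun)
    (hF : F.coeff 0 = 0) (hG : G.coeff 0 = 0) :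
    polyForm (m : ℂ) (dunkl n m F) G = polyForm (m : ℂ) F (dunkl n m G) := by
  rw [F.as_sum_support, G.as_sum_support]
  simp only [map_sum, LinearMap.sum_apply]
  refine Finset.sum_congr rfl fun i hi => Finset.sum_congr rfl fun j hj => ?_
  refine polyForm_dunkl_monomial hm n ?_ ?_ _ _
  · rintro rfl
    exact Polynomial.mem_support_iff.1 hj hF
  · rintro rfl
    exact Polynomial.mem_support_iff.1 hi hG

theorem scalar_trace {m : ℕ} (hm : 0 < m) (n : ℕ) (G : Polynomial SymFun) (hG : G.coeff 0 = 0)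
    (g : SymFun) :
    (m : ℂ) * scalar (m : ℂ) (trace n G) g =
      polyForm (m : ℂ) G (dunkl n m (Polynomial.C g)) := by
  rw [G.as_sum_support]
  simp only [map_sum, LinearMap.sum_apply, scalar_sum_left, Finset.mul_sum]
  refine Finset.sum_congr rfl fun i hi => ?_
  have hi0 : i ≠ 0 := by
    rintro rfl
    exact Polynomial.mem_support_iff.1 hi hG
  rw [trace_monomial, scalar_pn_mul hm n (Nat.pos_of_ne_zero hi0), polyForm_monomial, if_neg hi0,
    ← Polynomial.monomial_zero_left, coeff_dunkl_monomial, if_pos (Nat.zero_le i),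
    if_neg (Ne.symm hi0), if_neg (show ¬(1 ≤ i ∧ i ≤ 0) by omega), add_zero, add_zero, Nat.sub_zero,
    ← Nat.cast_smul_eq_nsmul ℂ, scalar_smul_right]

theorem polyForm_iterate {m : ℕ} (hm : 0 < m) (n : ℕ) (f g : SymFun) (k l : ℕ) :
    polyForm (m : ℂ) ((dunkl n m)^[k + 1] (Polynomial.C f))
        ((dunkl n m)^[l + 1] (Polynomial.C g)) =
      polyForm (m : ℂ) (dunkl n m (Polynomial.C f))
        ((dunkl n m)^[k + l + 1] (Polynomial.C g)) := by
  induction k generalizing l with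
  | zero => rw [zero_add, zero_add]; rfl
  | succ k ih =>
    rw [Function.iterate_succ_apply', polyForm_dunkl hm, ← Function.iterate_succ_apply' (dunkl n m),
      ih (l + 1), show k + (l + 1) + 1 = k + 1 + l + 1 by ring]
    · rw [Function.iterate_succ_apply', coeff_zero_dunkl]
    · rw [Function.iterate_succ_apply', coeff_zero_dunkl]

theorem scalar_ham {m : ℕ} (hm : 0 < m) (n k : ℕ) (f g : SymFun) :
    scalar (m : ℂ) (ham n m k f) g = scalar (m : ℂ) f (ham n m k g) := by
  have hm' : (m : ℂ) ≠ 0 := Nat.cast_ne_zero.2 hm.ne'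
  have h0 : ∀ f : SymFun, ((dunkl n m)^[k + 1] (Polynomial.C f)).coeff 0 = 0 := fun f => by
    rw [Function.iterate_succ_apply', coeff_zero_dunkl]
  apply mul_left_cancel₀ hm'
  rw [scalar_comm _ f, ham, ham, scalar_trace hm n _ (h0 f), scalar_trace hm n _ (h0 g)]
  have h1 := polyForm_iterate hm n f g k 0
  rw [add_zero] at h1
  rw [polyForm_comm _ _ (dunkl n m (Polynomial.C f)), ← h1]
  rfl

/-! #### Homogeneity -/

/-- Elements of `Λ` of degree `N - i`. -/
def degSub (N i : ℕ) : Submodule ℂ SymFun where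
  carrier := {f | ∀ d, Finsupp.weight wt d + i ≠ N → f.coeff d = 0}
  zero_mem' := fun d _ => coeff_zero d
  add_mem' := fun hf hg d hd => by rw [coeff_add, hf d hd, hg d hd, add_zero]
  smul_mem' := fun c f hf d hd => by rw [coeff_smul, hf d hd, smul_zero]

theorem mem_degSub_zero {N : ℕ} {f : SymFun} :
    f ∈ degSub N 0 ↔ IsWeightedHomogeneous wt f N :=
  forall_congr' fun _ => not_imp_comm

theorem dp_mem_degSub {N i : ℕ} {f : SymFun} (hf : f ∈ degSub N i) (k : ℕ) :
    dp k f ∈ degSub N (i + k) := by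
  intro d hd
  rcases Nat.eq_zero_or_pos k with rfl | hk
  · simp
  · obtain ⟨k, rfl⟩ : ∃ k' : ℕ+, k = k' := ⟨⟨k, hk⟩, rfl⟩
    rw [dp_coe, coeff_pderiv, hf, zero_mul]
    have hk' : wt k = k := rfl
    rw [map_add, Finsupp.weight_single, one_smul]
    omega

theorem pn_mul_mem_degSub (n : ℕ) {N i : ℕ} {f : SymFun} (k : ℕ) (hf : f ∈ degSub N (i + k)) :
    pn n k * f ∈ degSub N i := by
  classical
  rcases Nat.eq_zero_or_pos k with rfl | hk
  · rw [pn_zero, ← smul_eq_C_mul]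
    exact Submodule.smul_mem _ _ hf
  · intro d hd
    obtain ⟨k, rfl⟩ : ∃ k' : ℕ+, k = k' := ⟨⟨k, hk⟩, rfl⟩
    rw [pn_coe, coeff_X_mul']
    split_ifs with hs
    · refine hf _ fun h => hd ?_
      have h4 : d - Finsupp.single k 1 + Finsupp.single k 1 = d :=
        tsub_add_cancel_of_le (Finsupp.single_le_iff.2
          (Nat.one_le_iff_ne_zero.2 (Finsupp.mem_support_iff.1 hs)))
      have h5 := congrArg (Finsupp.weight wt) h4
      have hk' : wt k = k := rfl
      rw [map_add, Finsupp.weight_single, one_smul] at h5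
      omega
    · rfl

theorem coeff_dunkl_mem_degSub (n m : ℕ) {N : ℕ} {F : Polynomial SymFun}
    (hF : ∀ i, F.coeff i ∈ degSub N i) (j : ℕ) : (dunkl n m F).coeff j ∈ degSub N j := by
  rw [F.as_sum_support, map_sum, Polynomial.finsetSum_coeff]
  refine Submodule.sum_mem _ fun i _ => ?_
  rw [coeff_dunkl_monomial]
  refine add_mem ?_ (add_mem ?_ ?_)
  · split_ifs with h
    · refine Submodule.smul_of_tower_mem _ _ ?_
      have := dp_mem_degSub (hF i) (j - i)
      rwa [Nat.add_sub_cancel' h] at this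
    · exact zero_mem _
  · split_ifs with h
    · subst h
      exact Submodule.smul_mem _ _ (hF i)
    · exact zero_mem _
  · split_ifs with h
    · refine Submodule.smul_mem _ _ (pn_mul_mem_degSub n _ ?_)
      rw [Nat.add_sub_cancel' h.2]
      exact hF i
    · exact zero_mem _

theorem ham_isWeightedHomogeneous (n m k : ℕ) {N : ℕ} {f : SymFun}
    (hf : IsWeightedHomogeneous wt f N) : IsWeightedHomogeneous wt (ham n m k f) N := by
  rw [← mem_degSub_zero] at hf ⊢
  have h1 : ∀ l j, ((dunkl n m)^[l] (Polynomial.C f)).coeff j ∈ degSub N j := by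
    intro l
    induction l with
    | zero =>
      intro j
      rw [Function.iterate_zero_apply, Polynomial.coeff_C]
      split_ifs with h
      · rwa [h]
      · exact zero_mem _
    | succ l ih =>
      intro j
      rw [Function.iterate_succ_apply']
      exact coeff_dunkl_mem_degSub n m ih j
  have h2 := h1 (k + 1)
  rw [ham]
  generalize (dunkl n m)^[k + 1] (Polynomial.C f) = G at h2
  rw [G.as_sum_support, map_sum]
  refine Submodule.sum_mem _ fun i _ => ?_
  rw [trace_monomial]
  exact pn_mul_mem_degSub n i (by rw [zero_add]; exact h2 i)

end

noncomputable section

open MvPolynomial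

/-! ### Divided differences and the dominance order -/

section DividedDifference

variable {n : ℕ}

theorem coeff_rename_swap (i j : Fin n) (G : MvPolynomial (Fin n) ℂ) (η ζ : Fin n →₀ ℕ)
    (h : ∀ k, ζ k = η (Equiv.swap i j k)) :
    (rename (Equiv.swap i j) G).coeff η = G.coeff ζ := by
  have h1 : η = ζ.mapDomain (Equiv.swap i j) := by
    ext k
    rw [← (Equiv.swap i j).apply_symm_apply k,
      Finsupp.mapDomain_apply (Equiv.swap i j).injective, h]
  rw [h1, coeff_rename_mapDomain _ (Equiv.swap i j).injective]

/-- `E` is the divided difference `x_i (G - s_ij G) / (x_i - x_j)`. -/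
def IsDivDiff (i j : Fin n) (G E : MvPolynomial (Fin n) ℂ) : Prop :=
  (X i - X j) * E = X i * (G - rename (Equiv.swap i j) G)

variable {i j : Fin n} {G E : MvPolynomial (Fin n) ℂ}

theorem X_sub_X_ne_zero (hij : i ≠ j) : (X i - X j : MvPolynomial (Fin n) ℂ) ≠ 0 :=
  sub_ne_zero.2 fun h => hij (X_injective h)

theorem IsDivDiff.coeff_rec (h : IsDivDiff i j G E) (hij : i ≠ j) (η : Fin n →₀ ℕ) :
    E.coeff η = (G - rename (Equiv.swap i j) G).coeff η +
      if j ∈ η.support then E.coeff (η + Finsupp.single i 1 - Finsupp.single j 1) else 0 := by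
  have h1 := congrArg (coeff (η + Finsupp.single i 1)) h
  rw [sub_mul, coeff_sub, add_comm η, coeff_X_mul, coeff_X_mul, coeff_X_mul'] at h1
  have h2 : j ∈ (Finsupp.single i 1 + η).support ↔ j ∈ η.support := by
    simp [hij]
  simp only [h2] at h1
  rw [← h1, add_comm η]
  ring

theorem IsDivDiff.sub_swap (h : IsDivDiff i j G E) (hij : i ≠ j) :
    E - rename (Equiv.swap i j) E = G - rename (Equiv.swap i j) G := by
  have h1 := congrArg (rename (Equiv.swap i j)) h
  have h2 : ∀ F : MvPolynomial (Fin n) ℂ,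
      rename (Equiv.swap i j) (rename (Equiv.swap i j) F) = F := by
    intro F
    rw [rename_rename, ← Equiv.coe_trans, Equiv.swap_swap]
    exact rename_id_apply F
  simp only [map_mul, map_sub, rename_X, Equiv.swap_apply_left, Equiv.swap_apply_right, h2] at h1
  refine mul_left_cancel₀ (X_sub_X_ne_zero hij) ?_
  unfold IsDivDiff at h
  linear_combination h + h1

end DividedDifference

/-- Exponents dominated by the partition `ν`. -/
def domSet (n : ℕ) (ν : YoungDiagram) : Set (Fin n →₀ ℕ) :=
  {η | ∀ S : Finset (Fin n), ∑ i ∈ S, η i ≤ ∑ k ∈ Finset.range S.card, ν.rowLen k}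

theorem perm_mem_domSet {n : ℕ} {ν : YoungDiagram} (σ : Equiv.Perm (Fin n)) {η ζ : Fin n →₀ ℕ}
    (h : ∀ i, ζ i = η (σ i)) (hη : η ∈ domSet n ν) : ζ ∈ domSet n ν := by
  intro S
  have h1 := hη (S.map σ.toEmbedding)
  rw [Finset.sum_map, Finset.card_map] at h1
  exact (Finset.sum_congr rfl fun i _ => h i).trans_le h1

theorem perm_mem_domSet_iff {n : ℕ} {ν : YoungDiagram} (σ : Equiv.Perm (Fin n))
    {η ζ : Fin n →₀ ℕ} (h : ∀ i, ζ i = η (σ i)) : ζ ∈ domSet n ν ↔ η ∈ domSet n ν :=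
  ⟨perm_mem_domSet σ.symm fun i => by rw [h, Equiv.apply_symm_apply], perm_mem_domSet σ h⟩

theorem move_add {n : ℕ} {i j : Fin n} {η : Fin n →₀ ℕ} (hj : j ∈ η.support) :
    η + Finsupp.single i 1 - Finsupp.single j 1 + Finsupp.single j 1 =
      η + Finsupp.single i 1 := by
  refine tsub_add_cancel_of_le (Finsupp.single_le_iff.2 ?_)
  have := Finsupp.mem_support_iff.1 hj
  rw [Finsupp.add_apply]
  omega

theorem sum_move {n : ℕ} {i j : Fin n} {η : Fin n →₀ ℕ} (hj : j ∈ η.support)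
    (S : Finset (Fin n)) :
    ∑ k ∈ S, (η + Finsupp.single i 1 - Finsupp.single j 1 : Fin n →₀ ℕ) k + (if j ∈ S then 1 else 0) =
      ∑ k ∈ S, η k + (if i ∈ S then 1 else 0) := by
  have h1 : ∀ l : Fin n, ∑ k ∈ S, (Finsupp.single l 1 : Fin n →₀ ℕ) k =
      if l ∈ S then 1 else 0 := by
    intro l
    simp only [Finsupp.single_apply, Finset.sum_ite_eq]
  rw [← h1 j, ← h1 i, ← Finset.sum_add_distrib, ← Finset.sum_add_distrib]
  exact Finset.sum_congr rfl fun k _ => DFunLike.congr_fun (move_add hj) k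

theorem mem_domSet_of_move {n : ℕ} {ν : YoungDiagram} {i j : Fin n} (hij : i ≠ j)
    {η : Fin n →₀ ℕ} (hj : j ∈ η.support) (hle : η j ≤ η i)
    (h : η + Finsupp.single i 1 - Finsupp.single j 1 ∈ domSet n ν) : η ∈ domSet n ν := by
  intro S
  by_cases hS : j ∈ S ∧ i ∉ S
  · have h1 := h (insert i (S.erase j))
    have h2 := sum_move (i := i) hj (insert i (S.erase j))
    have hi : i ∉ S.erase j := fun h => hS.2 (Finset.mem_of_mem_erase h)
    have hj' : j ∉ insert i (S.erase j) := by simp [hij.symm]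
    have hc : 0 < S.card := Finset.card_pos.2 ⟨j, hS.1⟩
    rw [Finset.card_insert_of_notMem hi, Finset.card_erase_of_mem hS.1,
      Nat.sub_add_cancel hc, Finset.sum_insert hi] at h1
    rw [if_neg hj', if_pos (Finset.mem_insert_self _ _), Finset.sum_insert hi, Finset.sum_insert hi] at h2
    rw [← Finset.add_sum_erase _ _ hS.1]
    omega
  · have h1 := h S
    have h2 := sum_move (i := i) hj S
    by_cases hjS : j ∈ S
    · rw [if_pos hjS, if_pos (by tauto)] at h2
      omega
    · rw [if_neg hjS] at h2
      omega

theorem move_notMem_domSet {n : ℕ} {ν : YoungDiagram} {i j : Fin n} (hij : i ≠ j)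
    {η : Fin n →₀ ℕ} (σ : Equiv.Perm (Fin n)) (hσ : ∀ k, η k = ν.rowLen (σ k))
    (hj : j ∈ η.support) (hle : η j ≤ η i) :
    η + Finsupp.single i 1 - Finsupp.single j 1 ∉ domSet n ν := by
  wlog hlt : σ i < σ j generalizing σ
  · have hlt' : σ j < σ i := lt_of_le_of_ne (not_lt.1 hlt) fun h => hij (σ.injective h).symm
    have heq : η i = η j := by
      refine le_antisymm ?_ hle
      rw [hσ, hσ]
      exact ν.rowLen_anti _ _ hlt'.le
    refine this ((Equiv.swap i j).trans σ) (fun k => ?_) (by simpa using hlt')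
    rw [Equiv.trans_apply, ← hσ]
    rcases eq_or_ne k i with rfl | hki
    · rw [Equiv.swap_apply_left, heq]
    rcases eq_or_ne k j with rfl | hkj
    · rw [Equiv.swap_apply_right, heq]
    rw [Equiv.swap_apply_of_ne_of_ne hki hkj]
  intro h
  let S := (Finset.Iic (σ i)).map σ.symm.toEmbedding
  have h1 := h S
  have h2 := sum_move (i := i) hj S
  have hi : i ∈ S := Finset.mem_map.2 ⟨σ i, by simp, by simp⟩
  have hj' : j ∉ S := by
    intro hjS
    obtain ⟨k, hk, hkj⟩ := Finset.mem_map.1 hjS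
    have : k = σ j := by rw [← hkj]; simp
    subst this
    exact absurd (Finset.mem_Iic.1 hk) (not_le.2 hlt)
  rw [if_neg hj', if_pos hi] at h2
  have hcard : S.card = σ i + 1 := by rw [Finset.card_map, Fin.card_Iic]
  have h3 : ∑ k ∈ S, η k = ∑ k ∈ Finset.range (σ i + 1), ν.rowLen k := by
    rw [Finset.sum_map]
    simp only [Equiv.coe_toEmbedding, hσ, Equiv.apply_symm_apply]
    refine Finset.sum_bij (fun k _ => (k : ℕ)) ?_ ?_ ?_ ?_
    · intro k hk
      exact Finset.mem_range.2 (Nat.lt_succ_of_le (Fin.le_def.1 (Finset.mem_Iic.1 hk)))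
    · intro a _ b _ hab
      exact Fin.ext hab
    · intro b hb
      have hb' := Finset.mem_range.1 hb
      have := (σ i).2
      exact ⟨⟨b, by omega⟩, Finset.mem_Iic.2 (Fin.le_def.2 (by simpa using Nat.lt_succ_iff.1 hb')),
        rfl⟩
    · intro k _
      rfl
  rw [hcard] at h1
  omega

section DividedDifferenceDom

variable {n : ℕ} {ν : YoungDiagram} {i j : Fin n} {G E : MvPolynomial (Fin n) ℂ}

/-- The exponent with coordinates `i` and `j` exchanged. -/
def swapExp (i j : Fin n) (η : Fin n →₀ ℕ) : Fin n →₀ ℕ :=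
  Finsupp.equivFunOnFinite.symm fun k => η (Equiv.swap i j k)

@[simp] theorem swapExp_apply (i j k : Fin n) (η : Fin n →₀ ℕ) :
    swapExp i j η k = η (Equiv.swap i j k) := rfl

theorem coeff_sub_swap (η : Fin n →₀ ℕ) :
    (G - rename (Equiv.swap i j) G).coeff η = G.coeff η - G.coeff (swapExp i j η) := by
  rw [coeff_sub, coeff_rename_swap i j G η (swapExp i j η) fun k => rfl]

theorem coeff_sub_swap_eq_zero (hG : ∀ η ∉ domSet n ν, G.coeff η = 0) {η : Fin n →₀ ℕ}
    (hη : η ∉ domSet n ν) : (G - rename (Equiv.swap i j) G).coeff η = 0 := by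
  rw [coeff_sub_swap, hG η hη, hG, sub_zero]
  rwa [perm_mem_domSet_iff (Equiv.swap i j) (η := η) fun k => rfl]

theorem IsDivDiff.coeff_eq_zero (h : IsDivDiff i j G E) (hij : i ≠ j)
    (hG : ∀ η ∉ domSet n ν, G.coeff η = 0) (η : Fin n →₀ ℕ) (hη : η ∉ domSet n ν) :
    E.coeff η = 0 := by
  have key : ∀ d : ℕ, ∀ η : Fin n →₀ ℕ, η j = d → η j ≤ η i → η ∉ domSet n ν →
      E.coeff η = 0 := by
    intro d
    induction d with
    | zero =>
      intro η hd _ hη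
      rw [h.coeff_rec hij, coeff_sub_swap_eq_zero hG hη, if_neg (by simpa using hd), add_zero]
    | succ d ih =>
      intro η hd hle hη
      have hj : j ∈ η.support := by simp [hd]
      rw [h.coeff_rec hij, coeff_sub_swap_eq_zero hG hη, if_pos hj, zero_add]
      have h1 := DFunLike.congr_fun (move_add (i := i) hj)
      have h2 := h1 j
      have h3 := h1 i
      simp only [Finsupp.add_apply, Finsupp.single_apply, hij, hij.symm, if_true, if_false]
        at h2 h3
      exact ih _ (by omega) (by omega) fun hmem => hη (mem_domSet_of_move hij hj hle hmem)
  rcases le_total (η j) (η i) with hle | hle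
  · exact key _ η rfl hle hη
  · have h1 := congrArg (coeff η) (h.sub_swap hij)
    rw [coeff_sub_swap_eq_zero hG hη, coeff_sub_swap, sub_eq_zero] at h1
    rw [h1]
    refine key _ _ rfl (by simpa using hle) ?_
    rwa [perm_mem_domSet_iff (Equiv.swap i j) (η := η) fun k => rfl]

theorem IsDivDiff.coeff_of_perm (h : IsDivDiff i j G E) (hij : i ≠ j)
    (hG : ∀ η ∉ domSet n ν, G.coeff η = 0) (η : Fin n →₀ ℕ) (σ : Equiv.Perm (Fin n))
    (hσ : ∀ k, η k = ν.rowLen (σ k)) :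
    E.coeff η = if η j < η i then G.coeff η - G.coeff (swapExp i j η) else 0 := by
  have key : ∀ (η : Fin n →₀ ℕ) (σ : Equiv.Perm (Fin n)), (∀ k, η k = ν.rowLen (σ k)) →
      η j ≤ η i → E.coeff η = G.coeff η - G.coeff (swapExp i j η) := by
    intro η σ hσ hle
    rw [h.coeff_rec hij, coeff_sub_swap, add_eq_left]
    split_ifs with hj
    · exact h.coeff_eq_zero hij hG _ (move_notMem_domSet hij σ hσ hj hle)
    · rfl
  have hinv : swapExp i j (swapExp i j η) = η := by
    ext k
    simp
  rcases lt_trichotomy (η j) (η i) with hlt | heq | hgt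
  · rw [if_pos hlt, key η σ hσ hlt.le]
  · rw [if_neg heq.not_lt, key η σ hσ heq.le]
    have : swapExp i j η = η := by
      ext k
      rw [swapExp_apply]
      rcases eq_or_ne k i with rfl | hki
      · rw [Equiv.swap_apply_left, heq]
      rcases eq_or_ne k j with rfl | hkj
      · rw [Equiv.swap_apply_right, heq]
      rw [Equiv.swap_apply_of_ne_of_ne hki hkj]
    rw [this, sub_self]
  · rw [if_neg (not_lt.2 hgt.le)]
    have h1 := congrArg (coeff η) (h.sub_swap hij)
    rw [coeff_sub_swap, coeff_sub_swap] at h1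
    have h2 := key (swapExp i j η) ((Equiv.swap i j).trans σ) (fun k => by simp [hσ])
      (by simpa using hgt.le)
    rw [hinv] at h2
    linear_combination h1 + h2

end DividedDifferenceDom

/-! ### The action of Dunkl operators on leading coefficients -/

/-- The action of a Dunkl operator on the leading coefficients. -/
def topStep (n m : ℕ) (ν : YoungDiagram) (u : Fin n → ℂ) : Fin n → ℂ := fun p =>
  ν.rowLen p * u p + m * ∑ q : Fin n, if ν.rowLen q < ν.rowLen p then u p - u q else 0

/-- The leading coefficients of `D_i ^ k m_ν`. -/
def topSeq (n m : ℕ) (ν : YoungDiagram) (k : ℕ) : Fin n → ℂ :=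
  (topStep n m ν)^[k] fun _ => 1

/-- The leading coefficients of `G`, relative to `ν`, are `c * u`. -/
def IsTop {n : ℕ} (ν : YoungDiagram) (i : Fin n) (c : ℂ) (u : Fin n → ℂ)
    (G : MvPolynomial (Fin n) ℂ) : Prop :=
  (∀ η ∉ domSet n ν, G.coeff η = 0) ∧
    ∀ (η : Fin n →₀ ℕ) (σ : Equiv.Perm (Fin n)), (∀ k, η k = ν.rowLen (σ k)) →
      G.coeff η = c * u (σ i)

theorem coeff_X_mul_pderiv {n : ℕ} (i : Fin n) (G : MvPolynomial (Fin n) ℂ) (η : Fin n →₀ ℕ) :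
    (X i * pderiv i G).coeff η = η i * G.coeff η := by
  rw [coeff_X_mul']
  split_ifs with h
  · have h1 : η - Finsupp.single i 1 + Finsupp.single i 1 = η :=
      tsub_add_cancel_of_le (Finsupp.single_le_iff.2
        (Nat.one_le_iff_ne_zero.2 (Finsupp.mem_support_iff.1 h)))
    have h2 := DFunLike.congr_fun h1 i
    rw [Finsupp.add_apply, Finsupp.single_eq_same] at h2
    rw [coeff_pderiv, h1, mul_comm, ← h2]
    push_cast
    rfl
  · rw [Finsupp.notMem_support_iff.1 h]
    simp

theorem IsTop.step {n : ℕ} (m : ℕ) {ν : YoungDiagram} {i : Fin n} {c : ℂ} {u : Fin n → ℂ}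
    {G : MvPolynomial (Fin n) ℂ} (hG : IsTop ν i c u G) (E : Fin n → MvPolynomial (Fin n) ℂ)
    (hE : ∀ j ≠ i, IsDivDiff i j G (E j)) :
    IsTop ν i c (topStep n m ν u)
      (X i * pderiv i G + (m : ℂ) • ∑ j ∈ Finset.univ.erase i, E j) := by
  constructor
  · intro η hη
    rw [coeff_add, coeff_X_mul_pderiv, hG.1 η hη, coeff_smul, coeff_sum, Finset.sum_eq_zero]
    · simp
    · intro j hj
      have hji := Finset.ne_of_mem_erase hj
      exact (hE j hji).coeff_eq_zero hji.symm hG.1 η hη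
  · intro η σ hσ
    rw [coeff_add, coeff_X_mul_pderiv, hG.2 η σ hσ, coeff_smul, coeff_sum, topStep, hσ i]
    have h1 : ∑ j ∈ Finset.univ.erase i, (E j).coeff η =
        ∑ j ∈ Finset.univ.erase i,
          c * if ν.rowLen (σ j) < ν.rowLen (σ i) then u (σ i) - u (σ j) else 0 := by
      refine Finset.sum_congr rfl fun j hj => ?_
      have hji := Finset.ne_of_mem_erase hj
      rw [(hE j hji).coeff_of_perm hji.symm hG.1 η σ hσ, hG.2 η σ hσ,
        hG.2 (swapExp i j η) ((Equiv.swap i j).trans σ) (fun k => by simp [hσ]), hσ, hσ]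
      simp only [Equiv.trans_apply, Equiv.swap_apply_left]
      split_ifs <;> ring
    rw [h1, Finset.sum_erase _ (by simp),
      Equiv.sum_comp σ fun q => c * if ν.rowLen q < ν.rowLen (σ i) then u (σ i) - u q else 0,
      ← Finset.mul_sum, smul_eq_mul]
    ring

/-- Evaluation of `Λ[w]` in `n` variables, with `w = x_i`. -/
def evalAt {n : ℕ} (i : Fin n) : Polynomial SymFun →ₐ[ℂ] MvPolynomial (Fin n) ℂ :=
  Polynomial.aevalTower (res n) (X i)

theorem evalAt_C {n : ℕ} (i : Fin n) (f : SymFun) : evalAt i (Polynomial.C f) = res n f := by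
  simp [evalAt]

theorem evalAt_X {n : ℕ} (i : Fin n) : evalAt i Polynomial.X = X i := by
  simp [evalAt]

theorem evalAt_monomial {n : ℕ} (i : Fin n) (k : ℕ) (f : SymFun) :
    evalAt i (Polynomial.monomial k f) = res n f * X i ^ k := by
  rw [← Polynomial.C_mul_X_pow_eq_monomial, map_mul, map_pow, evalAt_C, evalAt_X]

theorem rename_res {n : ℕ} (σ : Equiv.Perm (Fin n)) (f : SymFun) :
    rename σ (res n f) = res n f := res_isSymmetric n f σ

theorem rename_evalAt {n : ℕ} (i j : Fin n) (F : Polynomial SymFun) :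
    rename (Equiv.swap i j) (evalAt i F) = evalAt j F := by
  induction F using Polynomial.induction_on' with
  | add p q hp hq => rw [map_add, map_add, map_add, hp, hq]
  | monomial k f =>
    rw [evalAt_monomial, evalAt_monomial, map_mul, map_pow, rename_res, rename_X,
      Equiv.swap_apply_left]

theorem evalAt_theta {n : ℕ} (i : Fin n) (f : SymFun) :
    evalAt i (theta f) = X i * pderiv i (res n f) := by
  induction f using MvPolynomial.induction_on with
  | C c =>
    have h1 : theta (C c) = 0 := theta.map_algebraMap c
    have h2 : res n (C c) = C c := (res n).commutes c
    rw [h1, h2, map_zero, pderiv_C, mul_zero]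
  | add p q hp hq => simp only [map_add, hp, hq, mul_add]
  | mul_X p l hp =>
    have h1 : theta (X l) = (l : ℕ) • Polynomial.X ^ (l : ℕ) := mkDerivation_X _ _ _
    have h2 : X i * pderiv i (psum (Fin n) ℂ l) = (l : ℕ) • X i ^ (l : ℕ) := by
      rw [psum, map_sum, Finset.sum_eq_single i]
      · rw [Derivation.leibniz_pow, pderiv_X_self, mul_smul_comm, smul_eq_mul, mul_one,
          ← pow_succ', Nat.sub_add_cancel l.pos]
      · intro j _ hj
        rw [Derivation.leibniz_pow, pderiv_X_of_ne hj]
        simp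
      · simp
    have h3 : ∀ (a : SymFun) (F : Polynomial SymFun), a • F = Polynomial.C a * F :=
      fun a F => (Polynomial.C_mul' a F).symm
    rw [Derivation.leibniz, h1, h3, h3, map_add, map_mul, map_mul, evalAt_C, evalAt_C, hp,
      map_nsmul, map_pow, evalAt_X, map_mul, Derivation.leibniz, res_X, smul_eq_mul, smul_eq_mul,
      mul_add, ← h2]
    ring

/-- The divided difference `x_i (F(x_i) - F(x_j)) / (x_i - x_j)` of `F ∈ Λ[w]`. -/
def divDiff {n : ℕ} (i j : Fin n) : Polynomial SymFun →ₗ[ℂ] MvPolynomial (Fin n) ℂ :=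
  Polynomial.lsum fun k => LinearMap.mulRight ℂ (∑ c ∈ Finset.Icc 1 k, X i ^ c * X j ^ (k - c)) ∘ₗ
    (res n).toLinearMap

theorem divDiff_monomial {n : ℕ} (i j : Fin n) (k : ℕ) (f : SymFun) :
    divDiff i j (Polynomial.monomial k f) =
      res n f * ∑ c ∈ Finset.Icc 1 k, X i ^ c * X j ^ (k - c) := by
  rw [divDiff, Polynomial.lsum_apply, Polynomial.sum_monomial_index]
  · simp
  · simp

theorem isDivDiff_divDiff {n : ℕ} (i j : Fin n) (F : Polynomial SymFun) :
    IsDivDiff i j (evalAt i F) (divDiff i j F) := by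
  unfold IsDivDiff
  rw [rename_evalAt]
  induction F using Polynomial.induction_on' with
  | add p q hp hq =>
    simp only [map_add, mul_add, hp, hq]
    ring
  | monomial k f =>
    rw [divDiff_monomial, evalAt_monomial, evalAt_monomial]
    have h1 : (∑ c ∈ Finset.Icc 1 k, X i ^ c * X j ^ (k - c) : MvPolynomial (Fin n) ℂ) =
        X i * ∑ c ∈ Finset.range k, X i ^ c * X j ^ (k - 1 - c) := by
      rw [Finset.mul_sum, Finset.range_eq_Ico, Finset.sum_Ico_eq_sum_range,
        ← Finset.Ico_add_one_right_eq_Icc, Finset.sum_Ico_eq_sum_range]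
      refine Finset.sum_congr (by simp) fun c _ => ?_
      rw [show k - (1 + c) = k - 1 - (0 + c) by omega]
      ring
    have h2 := (Commute.all (X i : MvPolynomial (Fin n) ℂ) (X j)).geom_sum₂_mul k
    rw [h1]
    linear_combination (X i * res n f) * h2

theorem evalAt_dunkl {n : ℕ} (m : ℕ) (i : Fin n) (F : Polynomial SymFun) :
    evalAt i (dunkl n m F) = X i * pderiv i (evalAt i F) +
      (m : ℂ) • ∑ j ∈ Finset.univ.erase i, divDiff i j F := by
  induction F using Polynomial.induction_on' with
  | add p q hp hq =>
    simp only [map_add, hp, hq, mul_add, Finset.sum_add_distrib, smul_add]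
    ring
  | monomial k f =>
    have h1 : evalAt i (dunklPoly n m k) = (k : ℂ) • X i ^ k + (m : ℂ) •
        (∑ j ∈ Finset.univ.erase i, ∑ c ∈ Finset.Icc 1 k, X i ^ c * X j ^ (k - c)) := by
      rw [dunklPoly, map_add, map_smul, map_smul, map_sub, map_smul, map_sum, map_pow, evalAt_X]
      congr 2
      have h3 : ∀ c ∈ Finset.Icc 1 k, evalAt i (Polynomial.C (pn n (k - c)) * Polynomial.X ^ c) =
          ∑ j, X i ^ c * X j ^ (k - c) := by
        intro c _
        rw [map_mul, evalAt_C, map_pow, evalAt_X, res_pn, psum, Finset.sum_mul]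
        exact Finset.sum_congr rfl fun j _ => mul_comm _ _
      have h4 : (∑ c ∈ Finset.Icc 1 k, X i ^ c * X i ^ (k - c) : MvPolynomial (Fin n) ℂ) =
          (k : ℂ) • X i ^ k := by
        rw [Finset.sum_congr rfl (g := fun _ => X i ^ k), Finset.sum_const, Nat.card_Icc,
          Nat.cast_smul_eq_nsmul, Nat.add_sub_cancel]
        intro c hc
        rw [← pow_add, Nat.add_sub_cancel' (Finset.mem_Icc.1 hc).2]
      rw [sub_eq_iff_eq_add', Finset.sum_congr rfl h3, Finset.sum_comm,
        ← Finset.add_sum_erase _ _ (Finset.mem_univ i), h4]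
    have h2 : X i * pderiv i ((X i : MvPolynomial (Fin n) ℂ) ^ k) = (k : ℂ) • X i ^ k := by
      rw [Derivation.leibniz_pow, pderiv_X_self, smul_eq_mul, mul_one, mul_smul_comm,
        Nat.cast_smul_eq_nsmul]
      rcases Nat.eq_zero_or_pos k with rfl | hk
      · simp
      · rw [← pow_succ', Nat.sub_add_cancel hk]
    rw [dunkl_monomial, map_add, map_mul, map_mul, map_pow, evalAt_X, evalAt_C, h1, evalAt_theta,
      evalAt_monomial, Derivation.leibniz, smul_eq_mul, smul_eq_mul, mul_add]
    simp only [divDiff_monomial, ← Finset.mul_sum]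
    simp only [smul_eq_C_mul] at h2 ⊢
    linear_combination (-res n f) * h2

theorem res_trace (n : ℕ) (F : Polynomial SymFun) :
    res n (trace n F) = ∑ i, evalAt i F := by
  induction F using Polynomial.induction_on' with
  | add p q hp hq => simp only [map_add, hp, hq, Finset.sum_add_distrib]
  | monomial k f =>
    rw [trace_monomial, map_mul, res_pn, psum, Finset.sum_mul]
    exact Finset.sum_congr rfl fun i _ => by rw [evalAt_monomial, mul_comm]

theorem isTop_iterate {n : ℕ} (m : ℕ) {ν : YoungDiagram} (i : Fin n) {c : ℂ} {f : SymFun}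
    (hf : IsTop ν i c (fun _ => 1) (res n f)) (k : ℕ) :
    IsTop ν i c (topSeq n m ν k) (evalAt i ((dunkl n m)^[k] (Polynomial.C f))) := by
  induction k with
  | zero => rwa [Function.iterate_zero_apply, evalAt_C]
  | succ k ih =>
    rw [Function.iterate_succ_apply', evalAt_dunkl, topSeq, Function.iterate_succ_apply']
    exact ih.step m _ fun j _ => isDivDiff_divDiff i j _

theorem coeff_res_ham {n : ℕ} (m k : ℕ) {ν : YoungDiagram} {f : SymFun}
    (hf : ∀ η ∉ domSet n ν, (res n f).coeff η = 0) (hν : ν.colLen 0 ≤ n) :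
    (∀ η ∉ domSet n ν, (res n (ham n m k f)).coeff η = 0) ∧
      (res n (ham n m k f)).coeff (vec n ν) = (∑ p, topSeq n m ν (k + 1) p) * monCoeff ν f := by
  have h1 : ∀ i, IsTop ν i (monCoeff ν f) (fun _ => 1) (res n f) := fun i =>
    ⟨hf, fun η σ hσ => by rw [coeff_res hν σ η hσ, mul_one]⟩
  have h2 := fun i => isTop_iterate m i (h1 i) (k + 1)
  rw [ham, res_trace]
  constructor
  · intro η hη
    rw [coeff_sum]
    exact Finset.sum_eq_zero fun i _ => (h2 i).1 η hη
  · rw [coeff_sum, Finset.sum_mul]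
    refine Finset.sum_congr rfl fun i _ => ?_
    rw [(h2 i).2 (vec n ν) (Equiv.refl _) fun k => rfl, mul_comm]
    rfl

end

noncomputable section

open MvPolynomial

/-! ### Dominance -/

/-- The dominance order. -/
def DomLE (μ ν : YoungDiagram) : Prop := μ = ν ∨ DomLT μ ν

theorem DomLE.card_eq {μ ν : YoungDiagram} (h : DomLE μ ν) : μ.card = ν.card := by
  rcases h with rfl | h
  exacts [rfl, h.2.1]

theorem DomLE.sum_le {μ ν : YoungDiagram} (h : DomLE μ ν) (i : ℕ) :
    ∑ j ∈ Finset.range i, μ.rowLen j ≤ ∑ j ∈ Finset.range i, ν.rowLen j := by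
  rcases h with rfl | h
  exacts [le_rfl, h.2.2 i]

theorem domLE_of {μ ν : YoungDiagram} (h1 : μ.card = ν.card)
    (h2 : ∀ i, ∑ j ∈ Finset.range i, μ.rowLen j ≤ ∑ j ∈ Finset.range i, ν.rowLen j) :
    DomLE μ ν := by
  by_cases h : μ = ν
  exacts [Or.inl h, Or.inr ⟨h, h1, h2⟩]

theorem DomLE.trans {μ ν κ : YoungDiagram} (h : DomLE μ ν) (h' : DomLE ν κ) : DomLE μ κ :=
  domLE_of (h.card_eq.trans h'.card_eq) fun i => (h.sum_le i).trans (h'.sum_le i)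

theorem DomLE.antisymm {μ ν : YoungDiagram} (h : DomLE μ ν) (h' : DomLE ν μ) : μ = ν := by
  refine youngDiagram_ext fun i => ?_
  have h1 := le_antisymm (h.sum_le i) (h'.sum_le i)
  have h2 := le_antisymm (h.sum_le (i + 1)) (h'.sum_le (i + 1))
  rw [Finset.sum_range_succ, Finset.sum_range_succ, h1] at h2
  exact Nat.add_left_cancel h2

theorem DomLT.trans_le {μ ν κ : YoungDiagram} (h : DomLT μ ν) (h' : DomLE ν κ) : DomLT μ κ := by
  rcases DomLE.trans (Or.inr h) h' with rfl | h''
  · exact absurd (DomLE.antisymm (Or.inr h) h') h.1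
  · exact h''

theorem DomLE.trans_lt {μ ν κ : YoungDiagram} (h : DomLE μ ν) (h' : DomLT ν κ) : DomLT μ κ := by
  rcases h with rfl | h
  exacts [h', h.trans_le (Or.inr h')]

theorem finite_domLE (ν : YoungDiagram) : {μ | DomLE μ ν}.Finite := by
  have h : Set.Finite {μ : YoungDiagram | μ.card = ν.card} :=
    Set.finite_coe_iff.1 (finite_card_eq ν.card)
  exact h.subset fun μ hμ => DomLE.card_eq hμ

theorem domLT_induction {p : YoungDiagram → Prop}
    (h : ∀ ν, (∀ μ, DomLT μ ν → p μ) → p ν) (ν : YoungDiagram) : p ν := by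
  have key : ∀ k : ℕ, ∀ ν, {μ | DomLT μ ν}.ncard = k → p ν := by
    intro k
    induction k using Nat.strong_induction_on with
    | _ k ih =>
      intro ν hν
      refine h ν fun μ hμ => ih _ ?_ μ rfl
      rw [← hν]
      refine Set.ncard_lt_ncard ⟨fun κ hκ => hκ.trans_le (Or.inr hμ), fun hsub => ?_⟩
        ((finite_domLE ν).subset fun κ hκ => Or.inr hκ)
      exact (hsub hμ).1 rfl
  exact key _ ν rfl

theorem sum_rowLen_le (μ : YoungDiagram) (T : Finset ℕ) :
    ∑ k ∈ T, μ.rowLen k ≤ ∑ k ∈ Finset.range T.card, μ.rowLen k := by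
  induction T using Finset.induction_on_max with
  | empty => simp
  | insert a s hs ih =>
    have ha : a ∉ s := fun h => lt_irrefl _ (hs a h)
    rw [Finset.sum_insert ha, Finset.card_insert_of_notMem ha, Finset.sum_range_succ, add_comm]
    refine add_le_add ih (μ.rowLen_anti _ _ ?_)
    have h1 : s ⊆ Finset.range a := fun x hx => Finset.mem_range.2 (hs x hx)
    simpa using Finset.card_le_card h1

theorem mem_domSet_of_domLE {n : ℕ} {μ ν : YoungDiagram} (h : DomLE μ ν)
    (σ : Equiv.Perm (Fin n)) {η : Fin n →₀ ℕ} (hη : ∀ i, η i = μ.rowLen (σ i)) :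
    η ∈ domSet n ν := by
  intro S
  have h1 := sum_rowLen_le μ (S.map (σ.toEmbedding.trans Fin.valEmbedding))
  rw [Finset.sum_map, Finset.card_map] at h1
  refine le_trans (le_trans (le_of_eq ?_) h1) (h.sum_le _)
  exact Finset.sum_congr rfl fun i _ => hη i

theorem domLE_of_vec_mem {n : ℕ} {μ ν : YoungDiagram} (hμ : μ.colLen 0 ≤ n) (hν : ν.colLen 0 ≤ n)
    (hc : μ.card = ν.card) (h : vec n μ ∈ domSet n ν) : DomLE μ ν := by
  refine domLE_of hc fun i => ?_
  rcases le_total i n with hi | hi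
  · have h1 := h (Finset.univ.map (Fin.castLEEmb hi))
    rw [Finset.sum_map, Finset.card_map, Finset.card_univ, Fintype.card_fin] at h1
    rwa [Finset.sum_range]
  · rw [← card_eq_sum_rowLen μ (hμ.trans hi), ← card_eq_sum_rowLen ν (hν.trans hi), hc]

theorem coeff_res_of_mem_monoSpan {n : ℕ} {ν : YoungDiagram} {f : SymFun}
    (hf : f ∈ monoSpan {μ | DomLE μ ν}) (η : Fin n →₀ ℕ) (hη : η ∉ domSet n ν) :
    (res n f).coeff η = 0 := by
  obtain ⟨μ, -, σ, h2, h3⟩ := exists_coeff_res η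
  rw [h3]
  exact mem_monoSpan.1 hf μ fun hμ => hη (mem_domSet_of_domLE hμ σ h2)

theorem isWeightedHomogeneous_of_mem_monoSpan {N : ℕ} {S : Set YoungDiagram}
    (hS : ∀ μ ∈ S, μ.card = N) {f : SymFun} (hf : f ∈ monoSpan S) :
    IsWeightedHomogeneous wt f N := by
  have : monoSpan S ≤ weightedHomogeneousSubmodule ℂ wt N := by
    refine Submodule.span_le.2 ?_
    rintro _ ⟨μ, hμ, rfl⟩
    rw [← hS μ hμ]
    exact mono_isWeightedHomogeneous μ
  exact this hf

theorem ham_mem_monoSpan {n : ℕ} (m k : ℕ) {ν : YoungDiagram} (hn : ν.card ≤ n) {f : SymFun}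
    (hf : f ∈ monoSpan {μ | DomLE μ ν}) : ham n m k f ∈ monoSpan {μ | DomLE μ ν} := by
  rw [mem_monoSpan]
  intro μ hμ
  have hhom := ham_isWeightedHomogeneous n m k
    (isWeightedHomogeneous_of_mem_monoSpan (fun μ hμ => DomLE.card_eq hμ) hf)
  by_cases hc : μ.card = ν.card
  · have h1 : μ.colLen 0 ≤ n := (colLen_le_card μ).trans (hc.trans_le hn)
    have h2 : ν.colLen 0 ≤ n := (colLen_le_card ν).trans hn
    rw [monCoeff_eq h1]
    exact (coeff_res_ham m k (coeff_res_of_mem_monoSpan hf) h2).1 _ fun hmem =>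
      hμ (domLE_of_vec_mem h1 h2 hc hmem)
  · exact monCoeff_eq_zero_of_card_ne hhom hc

theorem monCoeff_ham {n : ℕ} (m k : ℕ) {ν : YoungDiagram} (hn : ν.colLen 0 ≤ n) {f : SymFun}
    (hf : f ∈ monoSpan {μ | DomLE μ ν}) :
    monCoeff ν (ham n m k f) = (∑ p, topSeq n m ν (k + 1) p) * monCoeff ν f := by
  rw [monCoeff_eq hn]
  exact (coeff_res_ham m k (coeff_res_of_mem_monoSpan hf) hn).2

/-! ### The eigenvalues separate partitions -/

theorem topSeq_succ (n m : ℕ) (ν : YoungDiagram) (k : ℕ) :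
    topSeq n m ν (k + 1) = topStep n m ν (topSeq n m ν k) := Function.iterate_succ_apply' _ _ _

theorem topSeq_congr (n m : ℕ) (ν : YoungDiagram) (k : ℕ) {p q : Fin n}
    (h : ν.rowLen p = ν.rowLen q) : topSeq n m ν k p = topSeq n m ν k q := by
  induction k with
  | zero => rfl
  | succ k ih => rw [topSeq_succ, topStep, topStep, h, ih]

/-- The shifted parts of a partition. -/
def shiftedPart (n m : ℕ) (ν : YoungDiagram) (p : Fin n) : ℕ := ν.rowLen p + m * (n - 1 - p)

theorem topSeq_rec (n m : ℕ) (ν : YoungDiagram) (k : ℕ) (p : Fin n) :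
    topSeq n m ν (k + 1) p = shiftedPart n m ν p * topSeq n m ν k p -
      m * ∑ q : Fin n, if p < q then topSeq n m ν k q else 0 := by
  have h1 : ∑ q : Fin n, (if ν.rowLen q < ν.rowLen p then
      topSeq n m ν k p - topSeq n m ν k q else 0) =
      ∑ q : Fin n, if p < q then topSeq n m ν k p - topSeq n m ν k q else 0 := by
    refine Finset.sum_congr rfl fun q _ => ?_
    by_cases hpq : p < q
    · rw [if_pos hpq]
      split_ifs with h
      · rfl
      · have h2 : ν.rowLen q ≤ ν.rowLen p := ν.rowLen_anti _ _ hpq.le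
        rw [topSeq_congr n m ν k (le_antisymm (not_lt.1 h) h2), sub_self]
    · rw [if_neg hpq, if_neg]
      exact not_lt.2 (ν.rowLen_anti _ _ (not_lt.1 hpq))
  have h2 : ∑ q : Fin n, (if p < q then topSeq n m ν k p - topSeq n m ν k q else 0) =
      ((n - 1 - p : ℕ) : ℂ) * topSeq n m ν k p -
        ∑ q : Fin n, if p < q then topSeq n m ν k q else 0 := by
    rw [← Fin.card_Ioi, ← nsmul_eq_mul, ← Finset.sum_const, ← Finset.filter_lt_eq_Ioi,
      Finset.sum_filter, ← Finset.sum_sub_distrib]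
    exact Finset.sum_congr rfl fun q _ => by split_ifs <;> ring
  rw [topSeq_succ, topStep, h1, h2, shiftedPart]
  push_cast
  ring

theorem triangular_product {R : Type*} [CommRing R] (x c : R) {n : ℕ} (l U : Fin n → R)
    (h : ∀ p, (1 - x * l p) * U p = 1 - x * c * ∑ q, if p < q then U q else 0) :
    (1 - x * c * ∑ p, U p) * ∏ p, (1 - x * l p) = ∏ p, (1 - x * (l p + c)) := by
  induction n with
  | zero => simp
  | succ n ih =>
    have h1 := ih (fun p => l p.succ) (fun p => U p.succ) fun p => by
      rw [h p.succ, Fin.sum_univ_succ]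
      simp
    have h2 := h 0
    rw [Fin.sum_univ_succ] at h2
    simp only [lt_self_iff_false, if_false, zero_add, Fin.succ_pos, if_true] at h2
    rw [Fin.sum_univ_succ, Fin.prod_univ_succ, Fin.prod_univ_succ, ← h1]
    linear_combination (-x * c * ∏ p : Fin n, (1 - x * l p.succ)) * h2

theorem topSeq_series (n m : ℕ) (ν : YoungDiagram) :
    (1 - PowerSeries.X * (m : PowerSeries ℂ) *
        ∑ p, PowerSeries.mk fun k => topSeq n m ν k p) *
      ∏ p, (1 - PowerSeries.X * (shiftedPart n m ν p : PowerSeries ℂ)) =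
    ∏ p, (1 - PowerSeries.X * ((shiftedPart n m ν p : PowerSeries ℂ) + (m : PowerSeries ℂ))) := by
  refine triangular_product _ _ (fun p => (shiftedPart n m ν p : PowerSeries ℂ)) _ fun p => ?_
  have hc : ∀ a : ℕ, (a : PowerSeries ℂ) = PowerSeries.C (a : ℂ) := fun a => by simp
  have h1 : (∑ q, if p < q then PowerSeries.mk (fun k => topSeq n m ν k q) else 0) =
      PowerSeries.mk fun k => ∑ q, if p < q then topSeq n m ν k q else 0 := by
    ext k
    rw [map_sum, PowerSeries.coeff_mk]
    refine Finset.sum_congr rfl fun q _ => ?_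
    split_ifs <;> simp
  rw [h1, hc, hc, sub_mul, one_mul, mul_assoc, mul_assoc]
  ext k
  rcases k with _ | k
  · simp [topSeq]
  · rw [map_sub, map_sub, PowerSeries.coeff_succ_X_mul, PowerSeries.coeff_succ_X_mul,
      PowerSeries.coeff_C_mul, PowerSeries.coeff_C_mul, PowerSeries.coeff_mk,
      PowerSeries.coeff_mk, PowerSeries.coeff_mk, topSeq_rec, PowerSeries.coeff_one,
      if_neg (Nat.succ_ne_zero k)]
    ring

/-- A monic polynomial is determined by the ratio of its values at points at distance `c`. -/
theorem eq_of_shift_eq {f g : Polynomial ℂ} (hf : f.Monic) (hg : g.Monic) {m : ℕ} (hm : 0 < m)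
    (N : ℕ) (hfN : ∀ k : ℕ, N ≤ k → f.eval (k : ℂ) ≠ 0) (hgN : ∀ k : ℕ, N ≤ k → g.eval (k : ℂ) ≠ 0)
    (h : ∀ k : ℕ, N ≤ k → f.eval (k : ℂ) * g.eval ((k + m : ℕ) : ℂ) =
      g.eval (k : ℂ) * f.eval ((k + m : ℕ) : ℂ)) : f = g := by
  have key : ∀ j : ℕ, f.eval ((N + j * m : ℕ) : ℂ) * g.eval (N : ℂ) =
      g.eval ((N + j * m : ℕ) : ℂ) * f.eval (N : ℂ) := by
    intro j
    induction j with
    | zero => simp; ring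
    | succ j ih =>
      have h1 := h (N + j * m) (Nat.le_add_right _ _)
      have h2 := hfN (N + j * m) (Nat.le_add_right _ _)
      rw [show N + j * m + m = N + (j + 1) * m by ring] at h1
      apply mul_left_cancel₀ (hgN (N + j * m) (Nat.le_add_right _ _))
      linear_combination (-g.eval (N : ℂ)) * h1 + g.eval ((N + (j + 1) * m : ℕ) : ℂ) * ih
  have hpoly : Polynomial.C (g.eval (N : ℂ)) * f = Polynomial.C (f.eval (N : ℂ)) * g := by
    apply Polynomial.eq_of_infinite_eval_eq
    have hinj : Function.Injective fun j : ℕ => ((N + j * m : ℕ) : ℂ) := by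
      intro a b hab
      have := Nat.cast_injective hab
      exact Nat.eq_of_mul_eq_mul_right hm (Nat.add_left_cancel this)
    refine (Set.infinite_range_of_injective hinj).mono ?_
    rintro _ ⟨j, rfl⟩
    simp only [Set.mem_ofPred_eq, Polynomial.eval_mul, Polynomial.eval_C]
    linear_combination key j
  have hlead := congrArg Polynomial.leadingCoeff hpoly
  rw [Polynomial.leadingCoeff_mul, Polynomial.leadingCoeff_mul, Polynomial.leadingCoeff_C,
    Polynomial.leadingCoeff_C, hf.leadingCoeff, hg.leadingCoeff, mul_one, mul_one] at hlead
  rw [hlead] at hpoly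
  exact mul_left_cancel₀ (Polynomial.C_ne_zero.2 (hfN N le_rfl)) hpoly

theorem eq_of_topSeq_eq {n m : ℕ} (hm : 0 < m) {μ ν : YoungDiagram} (hμ : μ.colLen 0 ≤ n)
    (hν : ν.colLen 0 ≤ n)
    (h : ∀ k, ∑ p, topSeq n m μ (k + 1) p = ∑ p, topSeq n m ν (k + 1) p) : μ = ν := by
  have hser : (∑ p, PowerSeries.mk fun k => topSeq n m μ k p) =
      ∑ p, PowerSeries.mk fun k => topSeq n m ν k p := by
    ext k
    simp only [map_sum, PowerSeries.coeff_mk]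
    rcases k with _ | k
    · rfl
    · exact h k
  have h1 := topSeq_series n m μ
  have h2 := topSeq_series n m ν
  rw [hser] at h1
  let A : YoungDiagram → Polynomial ℂ := fun κ =>
    ∏ p, (1 - Polynomial.X * (shiftedPart n m κ p : Polynomial ℂ))
  let B : YoungDiagram → Polynomial ℂ := fun κ =>
    ∏ p, (1 - Polynomial.X * ((shiftedPart n m κ p : Polynomial ℂ) + (m : Polynomial ℂ)))
  have hA : ∀ κ, ((A κ : Polynomial ℂ) : PowerSeries ℂ) =
      ∏ p, (1 - PowerSeries.X * (shiftedPart n m κ p : PowerSeries ℂ)) := by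
    intro κ
    rw [← Polynomial.coeToPowerSeries.ringHom_apply, map_prod]
    simp only [map_sub, map_one, map_mul, map_natCast]
    simp only [Polynomial.coeToPowerSeries.ringHom_apply, Polynomial.coe_X]
  have hB : ∀ κ, ((B κ : Polynomial ℂ) : PowerSeries ℂ) =
      ∏ p, (1 - PowerSeries.X * ((shiftedPart n m κ p : PowerSeries ℂ) + (m : PowerSeries ℂ))) := by
    intro κ
    rw [← Polynomial.coeToPowerSeries.ringHom_apply, map_prod]
    simp only [map_sub, map_one, map_mul, map_add, map_natCast]
    simp only [Polynomial.coeToPowerSeries.ringHom_apply, Polynomial.coe_X]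
  have hAB : B μ * A ν = B ν * A μ := by
    apply Polynomial.coe_injective
    rw [Polynomial.coe_mul, Polynomial.coe_mul, hA, hA, hB, hB, ← h1, ← h2]
    ring
  let f : YoungDiagram → Polynomial ℂ := fun κ =>
    ∏ p : Fin n, (Polynomial.X - Polynomial.C (shiftedPart n m κ p : ℂ))
  have hfA : ∀ κ (z : ℂ), z ≠ 0 → (f κ).eval z = z ^ n * (A κ).eval z⁻¹ := by
    intro κ z hz
    have hn : z ^ n = ∏ _p : Fin n, z := by simp
    rw [Polynomial.eval_prod, Polynomial.eval_prod, hn, ← Finset.prod_mul_distrib]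
    refine Finset.prod_congr rfl fun p _ => ?_
    simp only [Polynomial.eval_sub, Polynomial.eval_X, Polynomial.eval_C, Polynomial.eval_one,
      Polynomial.eval_mul, Polynomial.eval_natCast]
    field_simp
  have hfB : ∀ κ (z : ℂ), z ≠ 0 → (f κ).eval (z - m) = z ^ n * (B κ).eval z⁻¹ := by
    intro κ z hz
    have hn : z ^ n = ∏ _p : Fin n, z := by simp
    rw [Polynomial.eval_prod, Polynomial.eval_prod, hn, ← Finset.prod_mul_distrib]
    refine Finset.prod_congr rfl fun p _ => ?_
    simp only [Polynomial.eval_sub, Polynomial.eval_X, Polynomial.eval_C, Polynomial.eval_one,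
      Polynomial.eval_mul, Polynomial.eval_natCast, Polynomial.eval_add]
    field_simp
    ring
  let N : ℕ := 1 + ∑ p, (shiftedPart n m μ p + shiftedPart n m ν p)
  have hN : ∀ p, shiftedPart n m μ p < N ∧ shiftedPart n m ν p < N := by
    intro p
    have := Finset.single_le_sum (f := fun p => shiftedPart n m μ p + shiftedPart n m ν p)
      (fun _ _ => Nat.zero_le _) (Finset.mem_univ p)
    constructor <;> omega
  have hroot : ∀ κ (z : ℂ), (f κ).eval z = 0 ↔ ∃ p, z = shiftedPart n m κ p := by
    intro κ z
    rw [Polynomial.eval_prod, Finset.prod_eq_zero_iff]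
    simp [sub_eq_zero]
  have hmonic : ∀ κ, (f κ).Monic := fun κ =>
    Polynomial.monic_prod_of_monic _ _ fun p _ => Polynomial.monic_X_sub_C _
  have hfeq : f μ = f ν := by
    refine eq_of_shift_eq (hmonic μ) (hmonic ν) hm N ?_ ?_ ?_
    · intro k hk h0
      obtain ⟨p, hp⟩ := (hroot μ _).1 h0
      have := Nat.cast_injective hp
      have := (hN p).1
      omega
    · intro k hk h0
      obtain ⟨p, hp⟩ := (hroot ν _).1 h0
      have := Nat.cast_injective hp
      have := (hN p).2
      omega
    · intro k hk
      have hz : ((k + m : ℕ) : ℂ) ≠ 0 := Nat.cast_ne_zero.2 (by omega)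
      have e1 := hfB μ _ hz
      have e2 := hfB ν _ hz
      have e3 := congrArg (Polynomial.eval ((k + m : ℕ) : ℂ)⁻¹) hAB
      rw [Polynomial.eval_mul, Polynomial.eval_mul] at e3
      rw [show ((k + m : ℕ) : ℂ) - m = k by push_cast; ring] at e1 e2
      rw [e1, e2, hfA μ _ hz, hfA ν _ hz]
      linear_combination (((k + m : ℕ) : ℂ) ^ n * ((k + m : ℕ) : ℂ) ^ n) * e3
  have hanti : ∀ κ : YoungDiagram, StrictMono fun p : Fin n => shiftedPart n m κ p.rev := by
    intro κ p q hpq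
    have h3 : κ.rowLen p.rev ≤ κ.rowLen q.rev :=
      κ.rowLen_anti _ _ (Fin.rev_le_rev.2 hpq.le)
    have h4 : (n - 1 - (p.rev : ℕ)) < n - 1 - (q.rev : ℕ) := by
      rw [Fin.val_rev, Fin.val_rev]
      have := q.2
      have := Fin.lt_def.1 hpq
      omega
    have h5 := Nat.mul_lt_mul_of_pos_left h4 hm
    simp only [shiftedPart]
    omega
  have hrange : Set.range (fun p : Fin n => shiftedPart n m μ p.rev) =
      Set.range fun p : Fin n => shiftedPart n m ν p.rev := by
    have : ∀ κ, Set.range (fun p : Fin n => shiftedPart n m κ p.rev) =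
        {a : ℕ | (f κ).eval (a : ℂ) = 0} := by
      intro κ
      ext a
      simp only [Set.mem_range, Set.mem_ofPred_eq, hroot, Nat.cast_inj]
      constructor
      · rintro ⟨p, rfl⟩
        exact ⟨p.rev, rfl⟩
      · rintro ⟨p, rfl⟩
        exact ⟨p.rev, by rw [Fin.rev_rev]⟩
    rw [this, this, hfeq]
  have hfun := (StrictMono.range_inj (hanti μ) (hanti ν)).1 hrange
  refine vec_injective hμ hν ?_
  ext p
  have h6 := congrFun hfun p.rev
  simp only [Fin.rev_rev, shiftedPart] at h6
  simpa using h6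

end

noncomputable section

open MvPolynomial

/-! ### Jack polynomials -/

/-- The span of the `m_μ` with `μ < ν`. -/
abbrev lowerSpan (ν : YoungDiagram) : Submodule ℂ SymFun := monoSpan {μ | DomLT μ ν}

/-- `f` is a Jack polynomial for `ν`. -/
def IsJack (m : ℕ) (ν : YoungDiagram) (f : SymFun) : Prop :=
  f - mono ν ∈ lowerSpan ν ∧ ∀ g ∈ lowerSpan ν, scalar (m : ℂ) f g = 0

theorem exists_isJack {m : ℕ} (hm : 0 < m) (ν : YoungDiagram) : ∃ f, IsJack m ν f := by
  have : FiniteDimensional ℂ (lowerSpan ν) :=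
    finiteDimensional_monoSpan ((finite_domLE ν).subset fun κ hκ => Or.inr hκ)
  obtain ⟨v, hv, h⟩ := exists_orthogonal_projection hm (lowerSpan ν)
    (fun f hf => conj_mem_monoSpan hf) (mono ν)
  refine ⟨mono ν - v, ?_, h⟩
  rw [sub_sub_cancel_left]
  exact neg_mem hv

theorem IsJack.unique {m : ℕ} (hm : 0 < m) {ν : YoungDiagram} {f g : SymFun}
    (hf : IsJack m ν f) (hg : IsJack m ν g) : f = g := by
  rw [← sub_eq_zero]
  refine eq_zero_of_scalar_eq_zero hm (lowerSpan ν) (fun f hf => conj_mem_monoSpan hf) _ ?_ ?_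
  · have := sub_mem hf.1 hg.1
    rwa [sub_sub_sub_cancel_right] at this
  · intro h hh
    rw [scalar_sub_left, hf.2 h hh, hg.2 h hh, sub_zero]

theorem IsJack.conj_eq {m : ℕ} (hm : 0 < m) {ν : YoungDiagram} {f : SymFun}
    (hf : IsJack m ν f) : conj f = f := by
  refine IsJack.unique hm ⟨?_, fun g hg => ?_⟩ hf
  · have := conj_mem_monoSpan hf.1
    rwa [map_sub, conj_mono] at this
  · rw [← conj_conj g, conj_scalar, hf.2 _ (conj_mem_monoSpan hg), map_zero]

theorem mem_lowerSpan {ν : YoungDiagram} {f : SymFun} (h1 : f ∈ monoSpan {μ | DomLE μ ν})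
    (h2 : monCoeff ν f = 0) : f ∈ lowerSpan ν := by
  rw [mem_monoSpan] at h1 ⊢
  intro μ hμ
  by_cases h : μ = ν
  · rw [h, h2]
  · exact h1 μ fun h3 => h3.elim h hμ

theorem IsJack.mem {m : ℕ} {ν : YoungDiagram} {f : SymFun} (hf : IsJack m ν f) :
    f ∈ monoSpan {μ | DomLE μ ν} := by
  have h1 := monoSpan_mono (fun μ (hμ : DomLT μ ν) => (Or.inr hμ : DomLE μ ν)) hf.1
  have h2 : mono ν ∈ monoSpan {μ | DomLE μ ν} := mono_mem_monoSpan (Or.inl rfl)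
  have h3 := add_mem h1 h2
  rwa [sub_add_cancel] at h3

theorem IsJack.monCoeff_self {m : ℕ} {ν : YoungDiagram} {f : SymFun} (hf : IsJack m ν f) :
    monCoeff ν f = 1 := by
  classical
  have h1 := mem_monoSpan.1 hf.1 ν fun h => h.1 rfl
  rw [map_sub, monCoeff_mono, if_pos rfl] at h1
  exact sub_eq_zero.1 h1

theorem IsJack.isWeightedHomogeneous {m : ℕ} {ν : YoungDiagram} {f : SymFun}
    (hf : IsJack m ν f) : IsWeightedHomogeneous wt f ν.card :=
  isWeightedHomogeneous_of_mem_monoSpan (fun _ hμ => DomLE.card_eq hμ) hf.mem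

/-- `ham` as a linear map. -/
def hamₗ (n m k : ℕ) : SymFun →ₗ[ℂ] SymFun :=
  trace n ∘ₗ (dunkl n m ^ (k + 1)) ∘ₗ (Polynomial.CAlgHom (R := ℂ)).toLinearMap

theorem hamₗ_apply (n m k : ℕ) (f : SymFun) : hamₗ n m k f = ham n m k f := by
  rw [hamₗ, LinearMap.comp_apply, LinearMap.comp_apply, Module.End.pow_apply]
  rfl

theorem ham_mem_lowerSpan {n : ℕ} (m k : ℕ) {ν : YoungDiagram} (hn : ν.card ≤ n) {f : SymFun}
    (hf : f ∈ lowerSpan ν) : ham n m k f ∈ lowerSpan ν := by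
  have : lowerSpan ν ≤ (lowerSpan ν).comap (hamₗ n m k) := by
    refine Submodule.span_le.2 ?_
    rintro _ ⟨μ, hμ, rfl⟩
    rw [SetLike.mem_coe, Submodule.mem_comap, hamₗ_apply]
    have h1 : mono μ ∈ monoSpan {κ | DomLE κ μ} := mono_mem_monoSpan (Or.inl rfl)
    refine monoSpan_mono ?_ (ham_mem_monoSpan m k (hμ.2.1.trans_le hn) h1)
    exact fun κ hκ => DomLE.trans_lt hκ hμ
  have h2 := this hf
  rwa [Submodule.mem_comap, hamₗ_apply] at h2

theorem IsJack.ham_eq {m : ℕ} (hm : 0 < m) {n : ℕ} (k : ℕ) {ν : YoungDiagram} (hn : ν.card ≤ n)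
    {f : SymFun} (hf : IsJack m ν f) :
    ham n m k f = (∑ p, topSeq n m ν (k + 1) p) • f := by
  rw [← sub_eq_zero]
  refine eq_zero_of_scalar_eq_zero hm (lowerSpan ν) (fun f hf => conj_mem_monoSpan hf) _ ?_ ?_
  · refine mem_lowerSpan (sub_mem (ham_mem_monoSpan m k hn hf.mem)
      (Submodule.smul_mem _ _ hf.mem)) ?_
    rw [map_sub, map_smul, monCoeff_ham m k ((colLen_le_card ν).trans hn) hf.mem, smul_eq_mul,
      sub_self]
  · intro g hg
    rw [scalar_sub_left, scalar_smul_left, scalar_ham hm, hf.2 g hg,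
      hf.2 _ (ham_mem_lowerSpan m k hn hg), mul_zero, sub_zero]

theorem IsJack.orthogonal {m : ℕ} (hm : 0 < m) {μ ν : YoungDiagram} (hμν : μ ≠ ν) {f g : SymFun}
    (hf : IsJack m μ f) (hg : IsJack m ν g) : scalar (m : ℂ) f g = 0 := by
  by_cases hc : μ.card = ν.card
  · by_contra hne
    refine hμν (eq_of_topSeq_eq hm (colLen_le_card μ) ((colLen_le_card ν).trans hc.ge) fun k => ?_)
    have h1 := scalar_ham hm μ.card k f g
    rw [hf.ham_eq hm k le_rfl, hg.ham_eq hm k hc.ge, scalar_smul_left, scalar_smul_right] at h1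
    exact mul_right_cancel₀ hne h1
  · exact scalar_eq_zero_of_ne hf.isWeightedHomogeneous hg.isWeightedHomogeneous hc

theorem IsJack.scalar_self_ne_zero {m : ℕ} (hm : 0 < m) {ν : YoungDiagram} {f : SymFun}
    (hf : IsJack m ν f) : scalar (m : ℂ) f f ≠ 0 := by
  intro h
  have h1 : f = 0 := eq_zero_of_scalar_conj hm f (by rw [hf.conj_eq hm, h])
  have h2 := hf.monCoeff_self
  rw [h1, map_zero] at h2
  exact zero_ne_one h2

theorem mono_mem_span_of_triangular {J : YoungDiagram → SymFun}
    (hJ : ∀ ν, J ν - mono ν ∈ lowerSpan ν) (ν : YoungDiagram) :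
    mono ν ∈ Submodule.span ℂ (J '' {μ | DomLE μ ν}) := by
  induction ν using domLT_induction with
  | h ν ih =>
    have h1 : lowerSpan ν ≤ Submodule.span ℂ (J '' {μ | DomLE μ ν}) := by
      refine Submodule.span_le.2 ?_
      rintro _ ⟨μ, hμ, rfl⟩
      exact Submodule.span_mono
        (Set.image_mono fun κ hκ => DomLE.trans hκ (Or.inr hμ)) (ih μ hμ)
    have h2 : J ν ∈ Submodule.span ℂ (J '' {μ | DomLE μ ν}) :=
      Submodule.subset_span ⟨ν, Or.inl rfl, rfl⟩
    have := sub_mem h2 (h1 (hJ ν))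
    rwa [sub_sub_cancel] at this

theorem monoSpan_le_span {J : YoungDiagram → SymFun}
    (hJ : ∀ ν, J ν - mono ν ∈ lowerSpan ν) {S : Set YoungDiagram}
    (hS : ∀ μ ∈ S, ∀ κ, DomLE κ μ → κ ∈ S) : monoSpan S ≤ Submodule.span ℂ (J '' S) := by
  refine Submodule.span_le.2 ?_
  rintro _ ⟨μ, hμ, rfl⟩
  exact Submodule.span_mono (Set.image_mono (hS μ hμ)) (mono_mem_span_of_triangular hJ μ)

theorem IsJackFamily.isJack {m : ℕ} {J : YoungDiagram → SymFun}
    (hJ : IsJackFamily (m : ℂ) J) (ν : YoungDiagram) : IsJack m ν (J ν) := by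
  have h1 : ∀ ν, J ν - mono ν ∈ lowerSpan ν := fun ν =>
    (expand_sub_mem_iff _ _ _).1 (hJ.triangular ν)
  refine ⟨h1 ν, fun g hg => ?_⟩
  have h2 : Submodule.span ℂ (J '' {μ | DomLT μ ν}) ≤
      LinearMap.ker (scalarₗ (m : ℂ) (J ν)) := by
    refine Submodule.span_le.2 ?_
    rintro _ ⟨μ, hμ, rfl⟩
    exact hJ.orthogonal ν μ hμ.1.symm
  exact h2 (monoSpan_le_span h1 (fun μ hμ κ hκ => DomLE.trans_lt hκ hμ) hg)

theorem isJackFamily_iff {m : ℕ} (hm : 0 < m) {J : YoungDiagram → SymFun} :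
    IsJackFamily (m : ℂ) J ↔ ∀ ν, IsJack m ν (J ν) := by
  constructor
  · intro h ν
    exact IsJackFamily.isJack h ν
  · intro h
    constructor
    · intro ν
      rw [expand_sub_mem_iff]
      exact (h ν).1
    · intro μ ν hμν
      exact IsJack.orthogonal hm hμν (h μ) (h ν)

theorem existsUnique_isJackFamily {m : ℕ} (hm : 0 < m) :
    ∃! J : YoungDiagram → SymFun, IsJackFamily (m : ℂ) J := by
  obtain ⟨J, hJ⟩ := Classical.axiomOfChoice (exists_isJack hm)
  refine ⟨J, (isJackFamily_iff hm).2 hJ, fun J' hJ' => funext fun ν => ?_⟩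
  exact IsJack.unique hm (IsJackFamily.isJack hJ' ν) (hJ ν)

end

noncomputable section

open MvPolynomial

/-! ### Rectangular partitions: the derivatives lie in the span -/

theorem mem_rect {s r i j : ℕ} : (i, j) ∈ rect s r ↔ i < r ∧ j < s := by
  rw [← YoungDiagram.mem_cells]
  simp [rect]

theorem rowLen_rect_of_lt {s r i : ℕ} (hi : i < r) : (rect s r).rowLen i = s :=
  eq_of_forall_lt_iff fun j => by
    rw [← YoungDiagram.mem_iff_lt_rowLen, mem_rect, and_iff_right hi]

theorem rowLen_rect_le (s r i : ℕ) : (rect s r).rowLen i ≤ s := by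
  by_contra h
  have h1 := YoungDiagram.mem_iff_lt_rowLen.2 (not_le.1 h)
  rw [mem_rect] at h1
  exact lt_irrefl _ h1.2

theorem colLen_rect_le (s r : ℕ) : (rect s r).colLen 0 ≤ r := by
  by_contra h
  have h1 := YoungDiagram.mem_iff_lt_colLen.2 (not_le.1 h)
  rw [mem_rect] at h1
  exact lt_irrefl _ h1.1

theorem le_rect_iff {s r : ℕ} {μ : YoungDiagram} :
    μ ≤ rect s r ↔ μ.rowLen 0 ≤ s ∧ μ.colLen 0 ≤ r := by
  constructor
  · intro h
    constructor
    · by_contra hlt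
      have h1 : (0, s) ∈ μ := YoungDiagram.mem_iff_lt_rowLen.2 (not_le.1 hlt)
      have h2 : (0, s) ∈ rect s r := h h1
      rw [mem_rect] at h2
      exact lt_irrefl _ h2.2
    · by_contra hlt
      have h1 : (r, 0) ∈ μ := YoungDiagram.mem_iff_lt_colLen.2 (not_le.1 hlt)
      have h2 : (r, 0) ∈ rect s r := h h1
      rw [mem_rect] at h2
      exact lt_irrefl _ h2.1
  · rintro ⟨h1, h2⟩ ⟨i, j⟩ hij
    have h3 : (i, 0) ∈ μ := μ.up_left_mem le_rfl (Nat.zero_le _) hij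
    have h4 : (0, j) ∈ μ := μ.up_left_mem (Nat.zero_le _) le_rfl hij
    rw [YoungDiagram.mem_iff_lt_colLen] at h3
    rw [YoungDiagram.mem_iff_lt_rowLen] at h4
    exact mem_rect.2 ⟨h3.trans_le h2, h4.trans_le h1⟩

theorem DomLE.colLen_le {κ μ : YoungDiagram} (h : DomLE κ μ) : μ.colLen 0 ≤ κ.colLen 0 := by
  by_contra hlt
  have h1 := h.sum_le (κ.colLen 0)
  rw [← card_eq_sum_rowLen κ le_rfl, h.card_eq, card_eq_sum_rowLen μ le_rfl] at h1
  have h2 : ∑ i ∈ Finset.range (κ.colLen 0 + 1), μ.rowLen i ≤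
      ∑ i ∈ Finset.range (μ.colLen 0), μ.rowLen i :=
    Finset.sum_le_sum_of_subset (Finset.range_mono (by omega))
  rw [Finset.sum_range_succ] at h2
  have h3 := rowLen_pos_iff.2 (not_le.1 hlt)
  omega

theorem DomLE.rowLen_le {κ μ : YoungDiagram} (h : DomLE κ μ) : κ.rowLen 0 ≤ μ.rowLen 0 := by
  simpa using h.sum_le 1

variable {m : ℕ} {J : YoungDiagram → SymFun}

theorem res_jack_eq_zero (hJ : ∀ ν, IsJack m ν (J ν)) {r : ℕ} {ν : YoungDiagram}
    (h : r < ν.colLen 0) : res r (J ν) = 0 := by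
  rw [res_eq_zero_iff]
  intro μ hμ
  refine mem_monoSpan.1 (hJ ν).mem μ fun hle => ?_
  have := DomLE.colLen_le hle
  omega

theorem scalar_jack_eq_zero_of_res (hm : 0 < m) (hJ : ∀ ν, IsJack m ν (J ν)) {r : ℕ}
    {ν : YoungDiagram} (hν : ν.colLen 0 ≤ r) {h : SymFun} (hh : res r h = 0) :
    scalar (m : ℂ) (J ν) h = 0 := by
  have h1 : h ∈ monoSpan {κ | r < κ.colLen 0} := mem_monoSpan.2 fun μ hμ =>
    (res_eq_zero_iff h).1 hh μ (not_lt.1 hμ)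
  have h2 := monoSpan_le_span (S := {κ | r < κ.colLen 0}) (fun ν => (hJ ν).1)
    (fun μ (hμ : r < μ.colLen 0) κ hκ => lt_of_lt_of_le hμ (DomLE.colLen_le hκ)) h1
  have h3 : Submodule.span ℂ (J '' {κ | r < κ.colLen 0}) ≤
      LinearMap.ker (scalarₗ (m : ℂ) (J ν)) := by
    refine Submodule.span_le.2 ?_
    rintro _ ⟨μ, hμ, rfl⟩
    refine (hJ ν).orthogonal hm ?_ (hJ μ)
    rintro rfl
    exact absurd hν (not_le.2 hμ)
  exact h3 h2

/-- Symmetric functions of degree at most `s` in every variable, orthogonal to those vanishing in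
`r` variables. -/
def rectSpace (m s r : ℕ) : Submodule ℂ SymFun where
  carrier := {F | (∀ k, s < k → shiftCoeff k F = 0) ∧
    ∀ h, res r h = 0 → scalar (m : ℂ) F h = 0}
  zero_mem' := ⟨fun k _ => by simp [shiftCoeff], fun h _ => scalar_zero_left _ _⟩
  add_mem' := fun hF hG => ⟨fun k hk => by rw [shiftCoeff_add, hF.1 k hk, hG.1 k hk, add_zero],
    fun h hh => by rw [scalar_add_left, hF.2 h hh, hG.2 h hh, add_zero]⟩
  smul_mem' := fun c F hF => ⟨fun k hk => by
      have : shiftCoeff k (c • F) = c • shiftCoeff k F := by simp [shiftCoeff]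
      rw [this, hF.1 k hk, smul_zero],
    fun h hh => by rw [scalar_smul_left, hF.2 h hh, mul_zero]⟩

theorem jack_rect_mem_rectSpace (hm : 0 < m) (hJ : ∀ ν, IsJack m ν (J ν)) (s r : ℕ) :
    J (rect s r) ∈ rectSpace m s r := by
  refine ⟨fun k hk => eq_zero_of_res _ fun n => ?_, fun h hh =>
    scalar_jack_eq_zero_of_res hm hJ (colLen_rect_le s r) hh⟩
  ext η
  rw [coeff_res_shiftCoeff, coeff_zero]
  refine coeff_res_of_mem_monoSpan (hJ _).mem _ fun hmem => ?_
  have h1 := hmem {0}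
  rw [Finset.sum_singleton, Finset.card_singleton, Finset.sum_range_one, Finsupp.cons_zero] at h1
  have := rowLen_rect_le s r 0
  omega

theorem pderiv_mem_rectSpace (hm : 0 < m) {s r : ℕ} {F : SymFun} (hF : F ∈ rectSpace m s r)
    (k : ℕ+) : pderiv k F ∈ rectSpace m s r := by
  constructor
  · intro l hl
    rw [← dp_coe, shiftCoeff_dp, hF.1 l hl, map_zero]
  · intro h hh
    have h1 := hF.2 (X k * h) (by rw [map_mul, hh, mul_zero])
    rw [scalar_mul_X_right] at h1
    have h2 : (m : ℂ)⁻¹ * (k : ℕ) ≠ 0 :=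
      mul_ne_zero (inv_ne_zero (Nat.cast_ne_zero.2 hm.ne')) (Nat.cast_ne_zero.2 k.ne_zero)
    exact (mul_eq_zero.1 h1).resolve_left h2

theorem diffOrbit_le {f : SymFun} {W : Submodule ℂ SymFun} (hf : f ∈ W)
    (hW : ∀ g ∈ W, ∀ k : ℕ+, pderiv k g ∈ W) : diffOrbit f ≤ W := by
  rintro _ ⟨A, hA, rfl⟩
  rw [LinearMap.applyₗ_apply_apply]
  have key : ∀ A ∈ diffOps, ∀ g ∈ W, A g ∈ W := by
    intro A hA
    induction hA using Algebra.adjoin_induction with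
    | mem A hA =>
      obtain ⟨k, rfl⟩ := hA
      exact fun g hg => hW g hg k
    | algebraMap c => exact fun g hg => W.smul_mem c hg
    | add A B _ _ hA hB => exact fun g hg => W.add_mem (hA g hg) (hB g hg)
    | mul A B _ _ hA hB => exact fun g hg => hA _ (hB g hg)
  exact key A hA f hf

theorem monCoeff_eq_zero_of_shiftCoeff {s : ℕ} {F : SymFun}
    (hF : ∀ k, s < k → shiftCoeff k F = 0) {μ : YoungDiagram} (hμ : s < μ.rowLen 0) :
    monCoeff μ F = 0 := by
  rw [monCoeff_eq (Nat.le_succ _), ← Finsupp.cons_tail (vec _ μ), ← coeff_res_shiftCoeff, hF,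
    map_zero, coeff_zero]
  exact hμ

theorem rectSpace_le (hm : 0 < m) (hJ : ∀ ν, IsJack m ν (J ν)) (s r : ℕ) :
    rectSpace m s r ≤ Submodule.span ℂ (J '' {μ | μ ≤ rect s r}) := by
  intro F hF
  have h1 : F ∈ monoSpan {κ | κ.rowLen 0 ≤ s} := mem_monoSpan.2 fun μ hμ =>
    monCoeff_eq_zero_of_shiftCoeff hF.1 (not_le.1 hμ)
  have h2 := monoSpan_le_span (S := {κ | κ.rowLen 0 ≤ s}) (fun ν => (hJ ν).1)
    (fun μ (hμ : μ.rowLen 0 ≤ s) κ hκ => le_trans (DomLE.rowLen_le hκ) hμ) h1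
  rw [Finsupp.mem_span_image_iff_linearCombination] at h2
  obtain ⟨l, hl, rfl⟩ := h2
  rw [Finsupp.linearCombination_apply, Finsupp.sum]
  refine Submodule.sum_mem _ fun ν hν => ?_
  by_cases hle : ν ≤ rect s r
  · exact Submodule.smul_mem _ _ (Submodule.subset_span ⟨ν, hle, rfl⟩)
  · exfalso
    have h3 : r < ν.colLen 0 := by
      by_contra hlt
      exact hle (le_rect_iff.2 ⟨(Finsupp.mem_supported _ _).1 hl hν, not_lt.1 hlt⟩)
    have h4 := hF.2 (J ν) (res_jack_eq_zero hJ h3)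
    rw [Finsupp.linearCombination_apply, Finsupp.sum, scalar_sum_left,
      Finset.sum_eq_single ν, scalar_smul_left] at h4
    · rcases mul_eq_zero.1 h4 with h5 | h5
      · exact Finsupp.mem_support_iff.1 hν h5
      · exact (hJ ν).scalar_self_ne_zero hm h5
    · intro κ _ hκ
      rw [scalar_smul_left, (hJ κ).orthogonal hm hκ (hJ ν), mul_zero]
    · exact fun h => absurd hν h

theorem diffOrbit_jack_rect_le (hm : 0 < m) (hJ : ∀ ν, IsJack m ν (J ν)) (s r : ℕ) :
    diffOrbit (J (rect s r)) ≤ Submodule.span ℂ (J '' {μ | μ ≤ rect s r}) :=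
  (diffOrbit_le (jack_rect_mem_rectSpace hm hJ s r) fun _ hg k =>
    pderiv_mem_rectSpace hm hg k).trans (rectSpace_le hm hJ s r)

end

noncomputable section

open MvPolynomial

/-! ### Constant terms on the torus -/

section Reversal

variable {n : ℕ}

/-- `Q = x ^ u * conj P (x⁻¹)`, for `P` of multidegree at most `u`. -/
def IsReversal (u : Fin n →₀ ℕ) (P Q : MvPolynomial (Fin n) ℂ) : Prop :=
  ∃ (T : Type) (_ : Fintype T) (η ζ : T → Fin n →₀ ℕ) (c : T → ℂ), (∀ t, η t + ζ t = u) ∧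
    P = ∑ t, monomial (η t) (c t) ∧ Q = ∑ t, monomial (ζ t) (starRingEnd ℂ (c t))

variable {u v : Fin n →₀ ℕ} {P Q P' Q' : MvPolynomial (Fin n) ℂ}

theorem IsReversal.mul (h : IsReversal u P Q) (h' : IsReversal v P' Q') :
    IsReversal (u + v) (P * P') (Q * Q') := by
  obtain ⟨T, _, η, ζ, c, h1, rfl, rfl⟩ := h
  obtain ⟨T', _, η', ζ', c', h1', rfl, rfl⟩ := h'
  refine ⟨T × T', inferInstance, fun t => η t.1 + η' t.2, fun t => ζ t.1 + ζ' t.2,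
    fun t => c t.1 * c' t.2, fun t => ?_, ?_, ?_⟩
  · rw [← h1 t.1, ← h1' t.2, add_add_add_comm]
  · rw [Finset.sum_mul_sum, Fintype.sum_prod_type]
    simp only [monomial_mul]
  · rw [Finset.sum_mul_sum, Fintype.sum_prod_type]
    simp only [monomial_mul, map_mul]

theorem isReversal_monomial (u η ζ : Fin n →₀ ℕ) (h : η + ζ = u) :
    IsReversal u (monomial η 1) (monomial ζ 1) :=
  ⟨Unit, inferInstance, fun _ => η, fun _ => ζ, fun _ => 1, fun _ => h, by simp, by simp⟩

theorem isReversal_X_sub_X (i j : Fin n) :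
    IsReversal (Finsupp.single i 1 + Finsupp.single j 1) (X i - X j) (X j - X i) := by
  refine ⟨Bool, inferInstance, fun b => Finsupp.single (if b then i else j) 1,
    fun b => Finsupp.single (if b then j else i) 1, fun b => if b then 1 else -1, ?_, ?_, ?_⟩
  · rintro (_ | _)
    · exact add_comm _ _
    · rfl
  · simp [X, sub_eq_add_neg]
  · simp [X, sub_eq_add_neg]

theorem IsReversal.prod {ι : Type*} (s : Finset ι) (u : ι → Fin n →₀ ℕ)
    (P Q : ι → MvPolynomial (Fin n) ℂ) (h : ∀ i ∈ s, IsReversal (u i) (P i) (Q i)) :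
    IsReversal (∑ i ∈ s, u i) (∏ i ∈ s, P i) (∏ i ∈ s, Q i) := by
  classical
  induction s using Finset.induction_on with
  | empty => exact isReversal_monomial 0 0 0 (add_zero 0)
  | insert a s ha ih =>
    rw [Finset.sum_insert ha, Finset.prod_insert ha, Finset.prod_insert ha]
    exact (h a (Finset.mem_insert_self a s)).mul
      (ih fun i hi => h i (Finset.mem_insert_of_mem hi))

theorem IsReversal.pow (h : IsReversal u P Q) (k : ℕ) : IsReversal (k • u) (P ^ k) (Q ^ k) := by
  have := IsReversal.prod (Finset.range k) (fun _ => u) (fun _ => P) (fun _ => Q) fun _ _ => h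
  simpa using this

theorem IsReversal.coeff_eq_conj (h : IsReversal u P Q) {η ζ : Fin n →₀ ℕ} (hu : η + ζ = u) :
    Q.coeff ζ = starRingEnd ℂ (P.coeff η) := by
  classical
  obtain ⟨T, _, e, z, c, h1, rfl, rfl⟩ := h
  rw [coeff_sum, coeff_sum, map_sum]
  refine Finset.sum_congr rfl fun t _ => ?_
  have h2 : z t = ζ ↔ e t = η := by
    have h3 := (h1 t).trans hu.symm
    constructor
    · intro h4
      rw [h4] at h3
      exact add_right_cancel h3
    · intro h4
      rw [h4] at h3
      exact add_left_cancel h3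
  rw [coeff_monomial, coeff_monomial]
  simp only [h2]
  split_ifs <;> simp

theorem IsReversal.coeff_left_eq_zero (h : IsReversal u P Q) {η : Fin n →₀ ℕ} (hu : ¬ η ≤ u) :
    P.coeff η = 0 := by
  classical
  obtain ⟨T, _, e, z, c, h1, rfl, rfl⟩ := h
  rw [coeff_sum]
  refine Finset.sum_eq_zero fun t _ => ?_
  rw [coeff_monomial, if_neg]
  rintro rfl
  exact hu (h1 t ▸ le_self_add)

theorem IsReversal.coeff_right_eq_zero (h : IsReversal u P Q) {ζ : Fin n →₀ ℕ} (hu : ¬ ζ ≤ u) :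
    Q.coeff ζ = 0 := by
  classical
  obtain ⟨T, _, e, z, c, h1, rfl, rfl⟩ := h
  rw [coeff_sum]
  refine Finset.sum_eq_zero fun t _ => ?_
  rw [coeff_monomial, if_neg]
  rintro rfl
  exact hu (h1 t ▸ le_add_self)

theorem IsReversal.eq_zero (h : IsReversal u P Q) (h0 : (P * Q).coeff u = 0) : P = 0 := by
  classical
  rw [coeff_mul] at h0
  have h1 : ∑ x ∈ Finset.HasAntidiagonal.antidiagonal u, Complex.normSq (P.coeff x.1) = 0 := by
    rw [← Complex.ofReal_eq_zero, ← h0, Complex.ofReal_sum]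
    refine Finset.sum_congr rfl fun x hx => ?_
    rw [h.coeff_eq_conj (Finset.HasAntidiagonal.mem_antidiagonal.1 hx), Complex.mul_conj]
  rw [Finset.sum_eq_zero_iff_of_nonneg fun x _ => Complex.normSq_nonneg _] at h1
  ext η
  rw [coeff_zero]
  by_cases hη : η ≤ u
  · exact Complex.normSq_eq_zero.1
      (h1 (η, u - η) (Finset.HasAntidiagonal.mem_antidiagonal.2 (add_tsub_cancel_of_le hη)))
  · exact h.coeff_left_eq_zero hη

theorem exists_isReversal (hP : ∀ η, ¬ η ≤ u → P.coeff η = 0) : ∃ Q, IsReversal u P Q := by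
  refine ⟨_, P.support, inferInstance, fun t => t, fun t => u - t, fun t => P.coeff t, fun t => ?_,
    ?_, rfl⟩
  · refine add_tsub_cancel_of_le ?_
    by_contra h
    exact mem_support_iff.1 t.2 (hP _ h)
  · conv_lhs => rw [P.as_sum]
    exact (Finset.sum_coe_sort P.support fun η => monomial η (P.coeff η)).symm

end Reversal

/-! ### The squared Vandermonde product -/

@[to_additive]
theorem prod_offDiag_eq {M : Type*} [CommMonoid M] {n : ℕ} (g : Fin n × Fin n → M) :
    ∏ p ∈ Finset.univ.offDiag, g p =
      (∏ p ∈ Finset.univ.offDiag with p.1 < p.2, g p) *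
        ∏ p ∈ Finset.univ.offDiag with p.1 < p.2, g p.swap := by
  rw [← Finset.prod_filter_mul_prod_filter_not _ fun p : Fin n × Fin n => p.1 < p.2]
  congr 1
  refine Finset.prod_nbij' Prod.swap Prod.swap ?_ ?_ ?_ ?_ ?_
  · rintro ⟨i, j⟩ h
    simp only [Finset.mem_filter, Finset.mem_offDiag, Finset.mem_univ, true_and, not_lt,
      Prod.swap] at h ⊢
    exact ⟨h.1.symm, lt_of_le_of_ne h.2 h.1.symm⟩
  · rintro ⟨i, j⟩ h
    simp only [Finset.mem_filter, Finset.mem_offDiag, Finset.mem_univ, true_and, not_lt,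
      Prod.swap] at h ⊢
    exact ⟨h.1.symm, h.2.le⟩
  · intro p _
    exact p.swap_swap
  · intro p _
    exact p.swap_swap
  · intro p _
    rw [p.swap_swap]

/-- The product of `x_i - x_j` over all `i ≠ j`. -/
def disc (n : ℕ) : MvPolynomial (Fin n) ℂ := ∏ p ∈ Finset.univ.offDiag, (X p.1 - X p.2)

/-- The constant exponent. -/
def constExp (n c : ℕ) : Fin n →₀ ℕ := Finsupp.equivFunOnFinite.symm fun _ => c

@[simp] theorem constExp_apply (n c : ℕ) (i : Fin n) : constExp n c i = c := rfl

theorem exists_isReversal_disc (n : ℕ) : ∃ P Q : MvPolynomial (Fin n) ℂ,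
    P ≠ 0 ∧ IsReversal (constExp n (n - 1)) P Q ∧ disc n = P * Q := by
  classical
  refine ⟨∏ p ∈ Finset.univ.offDiag with p.1 < p.2, (X p.1 - X p.2),
    ∏ p ∈ Finset.univ.offDiag with p.1 < p.2, (X p.2 - X p.1), ?_, ?_, ?_⟩
  · rw [Finset.prod_ne_zero_iff]
    intro p hp
    exact X_sub_X_ne_zero (Finset.mem_offDiag.1 (Finset.mem_filter.1 hp).1).2.2
  · have h := IsReversal.prod (Finset.univ.offDiag.filter fun p : Fin n × Fin n => p.1 < p.2)
      (fun p => Finsupp.single p.1 1 + Finsupp.single p.2 1) (fun p => X p.1 - X p.2)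
      (fun p => X p.2 - X p.1) fun p _ => isReversal_X_sub_X p.1 p.2
    convert h using 1
    rw [Finset.sum_add_distrib]
    have h2 := sum_offDiag_eq (n := n) fun p => (Finsupp.single p.1 1 : Fin n →₀ ℕ)
    simp only [Prod.fst_swap] at h2
    rw [← h2]
    ext k
    rw [Finsupp.finsetSum_apply]
    simp only [Finsupp.single_apply]
    rw [Finset.sum_boole, Nat.cast_id, constExp_apply]
    have h3 : (Finset.univ.offDiag.filter fun p : Fin n × Fin n => p.1 = k) =
        (Finset.univ.erase k).map ⟨fun j => (k, j), fun a b hab => (Prod.mk.inj hab).2⟩ := by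
      ext ⟨i, j⟩
      simp only [Finset.mem_filter, Finset.mem_offDiag, Finset.mem_univ, true_and,
        Finset.mem_map, Finset.mem_erase]
      constructor
      · rintro ⟨h, rfl⟩
        exact ⟨j, ⟨Ne.symm h, trivial⟩, rfl⟩
      · rintro ⟨a, ⟨h, -⟩, h2⟩
        obtain ⟨rfl, rfl⟩ := Prod.mk.inj h2
        exact ⟨Ne.symm h, rfl⟩
    rw [h3, Finset.card_map, Finset.card_erase_of_mem (Finset.mem_univ k), Finset.card_univ,
      Fintype.card_fin]
  · exact prod_offDiag_eq fun p : Fin n × Fin n => (X p.1 - X p.2 : MvPolynomial (Fin n) ℂ)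

theorem eq_zero_of_coeff_disc_pow_mul {n m s : ℕ} {F G : MvPolynomial (Fin n) ℂ}
    (h : IsReversal (constExp n s) F G)
    (h0 : (disc n ^ m * (F * G)).coeff (constExp n (s + m * (n - 1))) = 0) : F = 0 := by
  obtain ⟨P, Q, hP, hPQ, hd⟩ := exists_isReversal_disc n
  have h1 := (hPQ.pow m).mul h
  have h2 : m • constExp n (n - 1) + constExp n s = constExp n (s + m * (n - 1)) := by
    ext i
    simp [add_comm]
  rw [h2] at h1
  have h3 := h1.eq_zero (by rw [← h0, hd]; ring_nf)
  exact (mul_eq_zero.1 h3).resolve_left (pow_ne_zero m hP)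

theorem exists_res_eq {n : ℕ} {P : MvPolynomial (Fin n) ℂ}
    (hP : ∀ (σ : Equiv.Perm (Fin n)) (η ζ : Fin n →₀ ℕ), (∀ i, η i = ζ (σ i)) →
      P.coeff η = P.coeff ζ) : ∃ f, res n f = P := by
  classical
  have hfin : {μ : YoungDiagram | μ.colLen 0 ≤ n ∧ P.coeff (vec n μ) ≠ 0}.Finite := by
    refine Set.Finite.of_finite_image (f := vec n)
      (P.support.finite_toSet.subset ?_) fun μ hμ ν hν h => vec_injective hμ.1 hν.1 h
    rintro _ ⟨μ, hμ, rfl⟩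
    exact mem_support_iff.2 hμ.2
  refine ⟨∑ μ ∈ hfin.toFinset, P.coeff (vec n μ) • mono μ, ?_⟩
  ext η
  obtain ⟨μ, hμ, σ, h1, h2⟩ := exists_coeff_res η
  rw [h2, map_sum, hP σ η (vec n μ) h1]
  simp only [map_smul, monCoeff_mono, smul_eq_mul, mul_ite, mul_one, mul_zero]
  by_cases h3 : P.coeff (vec n μ) = 0
  · rw [h3]
    refine Finset.sum_eq_zero fun κ _ => ?_
    split_ifs with h4
    · rw [← h3, h4]
    · rfl
  · rw [Finset.sum_eq_single μ, if_pos rfl]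
    · intro κ _ hκ
      rw [if_neg]
      exact fun h => hκ h.symm
    · intro h
      exact absurd (hfin.mem_toFinset.2 ⟨hμ, h3⟩) h

theorem exists_isReversal_res {n s : ℕ} (f : SymFun)
    (hf : ∀ η, ¬ η ≤ constExp n s → (res n f).coeff η = 0) :
    ∃ g, IsReversal (constExp n s) (res n f) (res n g) := by
  obtain ⟨Q, hQ⟩ := exists_isReversal hf
  obtain ⟨g, rfl⟩ : ∃ g, res n g = Q := by
    refine exists_res_eq fun σ η ζ h => ?_
    have key : ζ ≤ constExp n s ↔ η ≤ constExp n s := by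
      constructor
      · intro h1 i
        rw [h]
        exact h1 (σ i)
      · intro h1 i
        have := h1 (σ.symm i)
        rwa [h, Equiv.apply_symm_apply] at this
    by_cases hη : η ≤ constExp n s
    · rw [hQ.coeff_eq_conj (tsub_add_cancel_of_le hη),
        hQ.coeff_eq_conj (tsub_add_cancel_of_le (key.2 hη)),
        coeff_symmetric (res_isSymmetric n f) σ _ (constExp n s - ζ)]
      intro i
      rw [Finsupp.tsub_apply, Finsupp.tsub_apply, h]
      rfl
    · rw [hQ.coeff_right_eq_zero hη, hQ.coeff_right_eq_zero fun h => hη (key.1 h)]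
  exact ⟨g, hQ⟩

end

noncomputable section

open MvPolynomial

/-! ### The Laplace–Beltrami operator and the torus functional -/

theorem pderiv_prod {σ ι : Type*} [DecidableEq ι] (k : σ) (s : Finset ι)
    (f : ι → MvPolynomial σ ℂ) :
    pderiv k (∏ i ∈ s, f i) = ∑ i ∈ s, (∏ j ∈ s.erase i, f j) * pderiv k (f i) := by
  induction s using Finset.induction_on with
  | empty => simp
  | insert a s ha ih =>
    rw [Finset.prod_insert ha, Derivation.leibniz, Finset.sum_insert ha, Finset.erase_insert ha, ih,
      smul_eq_mul, smul_eq_mul, Finset.mul_sum, add_comm]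
    congr 1
    refine Finset.sum_congr rfl fun i hi => ?_
    have hia : a ≠ i := fun h => ha (h ▸ hi)
    rw [Finset.erase_insert_of_ne hia, Finset.prod_insert fun h => ha (Finset.mem_of_mem_erase h),
      mul_assoc]

/-- The cofactor of `x_i - x_j` in `disc n`. -/
def discCofactor {n : ℕ} (i j : Fin n) : MvPolynomial (Fin n) ℂ :=
  ∏ p ∈ Finset.univ.offDiag.erase (i, j), (X p.1 - X p.2)

theorem sub_mul_discCofactor {n : ℕ} {i j : Fin n} (hij : i ≠ j) :
    (X i - X j) * discCofactor i j = disc n :=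
  Finset.mul_prod_erase Finset.univ.offDiag
    (fun p : Fin n × Fin n => (X p.1 - X p.2 : MvPolynomial (Fin n) ℂ)) (a := (i, j)) (by simp [hij])

theorem discCofactor_swap {n : ℕ} {i j : Fin n} (hij : i ≠ j) :
    discCofactor j i = -discCofactor i j := by
  apply mul_left_cancel₀ (X_sub_X_ne_zero hij)
  have h1 := sub_mul_discCofactor hij
  have h2 := sub_mul_discCofactor hij.symm
  linear_combination h1 - h2

theorem X_mul_pderiv_disc {n : ℕ} (i : Fin n) :
    X i * pderiv i (disc n) = 2 * (X i * ∑ j ∈ Finset.univ.erase i, discCofactor i j) := by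
  have h1 : pderiv i (disc n) = ∑ p ∈ Finset.univ.offDiag,
      ((if p.1 = i then discCofactor p.1 p.2 else 0) -
        if p.2 = i then discCofactor p.1 p.2 else 0) := by
    rw [disc, pderiv_prod]
    refine Finset.sum_congr rfl fun p _ => ?_
    rw [map_sub, pderiv_X, pderiv_X, mul_sub, Pi.single_apply, Pi.single_apply]
    simp only [mul_ite, mul_one, mul_zero]
    rfl
  have h2 : ∑ p ∈ Finset.univ.offDiag, (if p.1 = i then discCofactor p.1 p.2 else 0) =
      ∑ j ∈ Finset.univ.erase i, discCofactor i j := by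
    rw [Finset.sum_finset_product _ Finset.univ (fun a => Finset.univ.erase a)
      (by rintro ⟨a, b⟩; simp [eq_comm]), Finset.sum_eq_single i]
    · exact Finset.sum_congr rfl fun j _ => if_pos rfl
    · intro a _ ha
      exact Finset.sum_eq_zero fun j _ => if_neg ha
    · exact fun h => absurd (Finset.mem_univ i) h
  have h3 : ∑ p ∈ Finset.univ.offDiag, (if p.2 = i then discCofactor p.1 p.2 else 0) =
      -∑ j ∈ Finset.univ.erase i, discCofactor i j := by
    rw [Finset.sum_finset_product_right _ Finset.univ (fun a => Finset.univ.erase a)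
      (by rintro ⟨a, b⟩; simp), Finset.sum_eq_single i, ← Finset.sum_neg_distrib]
    · exact Finset.sum_congr rfl fun j hj => by
        rw [if_pos rfl, discCofactor_swap (Finset.ne_of_mem_erase hj).symm]
    · intro a _ ha
      exact Finset.sum_eq_zero fun j _ => if_neg ha
    · exact fun h => absurd (Finset.mem_univ i) h
  rw [h1, Finset.sum_sub_distrib, h2, h3]
  ring

theorem disc_mul_sum {n : ℕ} (G : Fin n → MvPolynomial (Fin n) ℂ)
    (E : Fin n → Fin n → MvPolynomial (Fin n) ℂ)
    (hE : ∀ i j, (X i - X j) * E i j = X i * (G i - G j)) :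
    disc n * ∑ i, ∑ j ∈ Finset.univ.erase i, E i j =
      ∑ i, X i * pderiv i (disc n) * G i - ((n - 1 : ℕ) : MvPolynomial (Fin n) ℂ) *
        (disc n * ∑ i, G i) := by
  have h1 : ∀ i, ∀ j ∈ Finset.univ.erase i, disc n * E i j =
      X i * discCofactor i j * G i - X i * discCofactor i j * G j := fun i j hj => by
    rw [← sub_mul_discCofactor (Finset.ne_of_mem_erase hj).symm]
    linear_combination discCofactor i j * hE i j
  have h2 : ∑ i, ∑ j ∈ Finset.univ.erase i, X i * discCofactor i j * G j =
      ∑ j, ∑ i ∈ Finset.univ.erase j, (disc n * G j - X j * discCofactor j i * G j) := by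
    rw [Finset.sum_comm' (t' := Finset.univ) (s' := fun j => Finset.univ.erase j)]
    · refine Finset.sum_congr rfl fun j _ => Finset.sum_congr rfl fun i hi => ?_
      have hij := Finset.ne_of_mem_erase hi
      rw [discCofactor_swap hij, ← sub_mul_discCofactor hij]
      ring
    · intro i j
      simp [eq_comm]
  rw [Finset.mul_sum]
  simp only [Finset.mul_sum]
  rw [Finset.sum_congr rfl fun i _ => Finset.sum_congr rfl (h1 i)]
  simp only [Finset.sum_sub_distrib]
  rw [h2]
  simp only [Finset.sum_sub_distrib, Finset.sum_const, Finset.card_erase_of_mem (Finset.mem_univ _),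
    Finset.card_univ, Fintype.card_fin, X_mul_pderiv_disc, nsmul_eq_mul, ← Finset.sum_mul,
    ← Finset.mul_sum]
  rw [sub_sub_eq_add_sub, sub_left_inj, ← Finset.sum_add_distrib]
  exact Finset.sum_congr rfl fun i _ => by ring

theorem dunkl_C (n m : ℕ) (f : SymFun) : dunkl n m (Polynomial.C f) = theta f := by
  rw [← Polynomial.monomial_zero_left, dunkl_monomial]
  simp [dunklPoly]

theorem ham_one (n m : ℕ) (f : SymFun) : ham n m 1 f = trace n (dunkl n m (theta f)) := by
  rw [ham, Function.iterate_succ_apply, Function.iterate_one, dunkl_C]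

theorem sum_X_mul_pderiv_disc_pow {n m : ℕ} (hm : 0 < m) (f : SymFun) :
    ∑ i, X i * pderiv i (disc n ^ m * (X i * pderiv i (res n f))) =
      disc n ^ m * res n (ham n m 1 f) + ((m * (n - 1) : ℕ) : MvPolynomial (Fin n) ℂ) *
        (disc n ^ m * ∑ i, X i * pderiv i (res n f)) := by
  have h1 := disc_mul_sum (fun i => X i * pderiv i (res n f))
    (fun i j => divDiff i j (theta f)) fun i j => by
      have := isDivDiff_divDiff i j (theta f)
      rwa [IsDivDiff, rename_evalAt, evalAt_theta, evalAt_theta] at this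
  have h2 : res n (ham n m 1 f) = ∑ i, X i * pderiv i (X i * pderiv i (res n f)) +
      (m : MvPolynomial (Fin n) ℂ) * ∑ i, ∑ j ∈ Finset.univ.erase i, divDiff i j (theta f) := by
    rw [ham_one, res_trace, Finset.mul_sum, ← Finset.sum_add_distrib]
    refine Finset.sum_congr rfl fun i _ => ?_
    rw [evalAt_dunkl, evalAt_theta, Nat.cast_smul_eq_nsmul, nsmul_eq_mul]
  obtain ⟨k, rfl⟩ : ∃ k, m = k + 1 := ⟨m - 1, by omega⟩
  have h3 : ∀ i, X i * pderiv i (disc n ^ (k + 1) * (X i * pderiv i (res n f))) =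
      disc n ^ (k + 1) * (X i * pderiv i (X i * pderiv i (res n f))) +
      ((k + 1 : ℕ) : MvPolynomial (Fin n) ℂ) * disc n ^ k *
        (X i * pderiv i (disc n) * (X i * pderiv i (res n f))) := fun i => by
    rw [Derivation.leibniz, Derivation.leibniz_pow, smul_eq_mul, smul_eq_mul, smul_eq_mul,
      nsmul_eq_mul, Nat.add_sub_cancel]
    ring
  rw [Finset.sum_congr rfl fun i _ => h3 i, Finset.sum_add_distrib, ← Finset.mul_sum,
    ← Finset.mul_sum, h2]
  push_cast
  linear_combination -((k : MvPolynomial (Fin n) ℂ) + 1) * disc n ^ k * h1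

/-- The coefficient of `(x₁ ⋯ x_n) ^ (s + m * (n - 1))` in `disc n ^ m * f`. -/
def torusForm (n m s : ℕ) : SymFun →ₗ[ℂ] ℂ :=
  lcoeff ℂ (constExp n (s + m * (n - 1))) ∘ₗ LinearMap.mulLeft ℂ (disc n ^ m) ∘ₗ
    (res n).toLinearMap

theorem torusForm_apply (n m s : ℕ) (f : SymFun) :
    torusForm n m s f = (disc n ^ m * res n f).coeff (constExp n (s + m * (n - 1))) := rfl

theorem torusForm_ham {n m s N : ℕ} (hm : 0 < m) {f : SymFun} (hf : IsWeightedHomogeneous wt f N) :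
    torusForm n m s (ham n m 1 f) = s * N * torusForm n m s f := by
  have h1 := congrArg (coeff (constExp n (s + m * (n - 1)))) (sum_X_mul_pderiv_disc_pow (n := n) hm f)
  have h2 := (res_isHomogeneous n hf).sum_X_mul_pderiv
  rw [coeff_sum] at h1
  simp only [coeff_X_mul_pderiv, constExp_apply] at h1
  rw [← Finset.mul_sum, ← coeff_sum, ← Finset.mul_sum, h2, coeff_add] at h1
  simp only [mul_smul_comm, ← nsmul_eq_mul, coeff_smul] at h1
  simp only [nsmul_eq_mul] at h1
  rw [torusForm_apply, torusForm_apply]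
  push_cast at h1
  linear_combination -h1

theorem disc_isHomogeneous (n : ℕ) : (disc n).IsHomogeneous (n * (n - 1)) := by
  have := IsHomogeneous.prod (Finset.univ.offDiag : Finset (Fin n × Fin n))
    (fun p => (X p.1 - X p.2 : MvPolynomial (Fin n) ℂ)) (fun _ => 1)
    fun p _ => (isHomogeneous_X _ _).sub (isHomogeneous_X _ _)
  rw [Finset.sum_const, Finset.offDiag_card, Finset.card_univ, Fintype.card_fin, smul_eq_mul,
    mul_one, ← Nat.mul_sub_one] at this
  exact this

theorem torusForm_eq_zero_of_ne {n m s N : ℕ} {f : SymFun} (hf : IsWeightedHomogeneous wt f N)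
    (hN : N ≠ n * s) : torusForm n m s f = 0 := by
  rw [torusForm_apply]
  refine (((disc_isHomogeneous n).pow m).mul (res_isHomogeneous n hf)).coeff_eq_zero ?_
  have : (constExp n (s + m * (n - 1))).degree = n * (s + m * (n - 1)) := by
    rw [Finsupp.degree_eq_sum]
    simp
  rw [this]
  intro h
  apply hN
  have h2 : n * (s + m * (n - 1)) = n * (n - 1) * m + n * s := by ring
  rw [h2] at h
  exact (Nat.add_left_cancel h).symm

theorem trace_eq_of_coeff_zero {G : Polynomial SymFun} (hG : G.coeff 0 = 0) (n n' : ℕ) :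
    trace n G = trace n' G := by
  rw [trace, trace, Polynomial.lsum_apply, Polynomial.lsum_apply]
  refine Finset.sum_congr rfl fun i hi => ?_
  have hi0 : 0 < i := by
    rw [pos_iff_ne_zero]
    rintro rfl
    exact Polynomial.mem_support_iff.1 hi hG
  simp [pn, hi0]

theorem trace_theta {N : ℕ} {f : SymFun} (hf : IsWeightedHomogeneous wt f N) (n : ℕ) :
    trace n (theta f) = (N : ℂ) • f := by
  rw [← sub_eq_zero]
  refine eq_zero_of_res _ fun l => ?_
  have h0 : (theta f).coeff 0 = 0 := by rw [coeff_theta, zero_smul]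
  rw [trace_eq_of_coeff_zero h0 n l, map_sub, res_trace, map_smul, sub_eq_zero]
  simp only [evalAt_theta]
  rw [(res_isHomogeneous l hf).sum_X_mul_pderiv, Nat.cast_smul_eq_nsmul]

theorem dunkl_eq (n m : ℕ) {F : Polynomial SymFun} (hF : F.coeff 0 = 0) :
    dunkl n m F = dunkl 0 m F + ((m * n : ℕ) : ℂ) • F := by
  have key : ∀ F : Polynomial SymFun, dunkl n m F = dunkl 0 m F +
      ((m * n : ℕ) : ℂ) • (F - Polynomial.C (F.coeff 0)) := by
    intro F
    induction F using Polynomial.induction_on' with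
    | add p q hp hq =>
      rw [map_add, map_add, hp, hq, Polynomial.coeff_add, Polynomial.C_add]
      module
    | monomial i f =>
      rw [dunkl_monomial, dunkl_monomial]
      rcases Nat.eq_zero_or_pos i with rfl | hi
      · simp [dunklPoly]
      · have h1 : ∀ n, dunklPoly n m i = (i : ℂ) • Polynomial.X ^ i + (m : ℂ) •
            (∑ c ∈ Finset.Ico 1 i, Polynomial.C (pn 0 (i - c)) * Polynomial.X ^ c +
              (n : ℂ) • Polynomial.X ^ i - (i : ℂ) • Polynomial.X ^ i) := by
          intro n
          rw [dunklPoly, ← Finset.Ico_insert_right hi, Finset.sum_insert Finset.right_notMem_Ico,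
            Nat.sub_self, pn_zero, add_comm (Polynomial.C _ * _)]
          congr 4
          · refine Finset.sum_congr rfl fun c hc => ?_
            have hc' : 0 < i - c := by
              have := (Finset.mem_Ico.1 hc).2
              omega
            simp [pn, hc']
          · exact (Algebra.smul_def (n : ℂ) (Polynomial.X ^ i : Polynomial SymFun)).symm
        rw [h1 n, h1 0, Polynomial.coeff_monomial, if_neg hi.ne', map_zero, sub_zero,
          ← Polynomial.C_mul_X_pow_eq_monomial]
        rw [Nat.cast_mul, mul_smul, ← mul_smul_comm, ← mul_smul_comm, add_assoc, ← mul_add]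
        congr 2
        simp only [Nat.cast_zero, zero_smul, add_zero]
        module
  rw [key, hF, map_zero, sub_zero]

theorem ham_one_eq {N : ℕ} {f : SymFun} (hf : IsWeightedHomogeneous wt f N) (n m : ℕ) :
    ham n m 1 f = ham 0 m 1 f + ((m * n * N : ℕ) : ℂ) • f := by
  have h0 : (theta f).coeff 0 = 0 := by rw [coeff_theta, zero_smul]
  rw [ham_one, ham_one, dunkl_eq n m h0, map_add, map_smul, trace_theta hf,
    trace_eq_of_coeff_zero (coeff_zero_dunkl 0 m _) n 0, smul_smul]
  push_cast
  rfl

theorem IsJack.ham_one_eq {m : ℕ} (hm : 0 < m) {n : ℕ} {ν : YoungDiagram} (hn : ν.colLen 0 ≤ n)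
    {f : SymFun} (hf : IsJack m ν f) : ham n m 1 f = (∑ p, topSeq n m ν 2 p) • f := by
  have h1 := hf.ham_eq hm 1 le_rfl
  rw [JackRect.ham_one_eq hf.isWeightedHomogeneous] at h1
  obtain ⟨e, he⟩ : ∃ e : ℂ, ham n m 1 f = e • f := by
    refine ⟨∑ p, topSeq ν.card m ν 2 p - ((m * ν.card * ν.card : ℕ) : ℂ) +
      ((m * n * ν.card : ℕ) : ℂ), ?_⟩
    rw [JackRect.ham_one_eq hf.isWeightedHomogeneous, add_smul, sub_smul, ← h1, add_sub_cancel_right]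
  have h2 := monCoeff_ham m 1 hn hf.mem
  rw [he, map_smul, hf.monCoeff_self, smul_eq_mul, mul_one, mul_one] at h2
  rw [he, h2]

theorem sum_topSeq_two_ne {n m s : ℕ} {ν : YoungDiagram} (hn : ν.colLen 0 ≤ n)
    (hc : ν.card = n * s) (hν : ν ≠ rect s n) :
    ∑ p, topSeq n m ν 2 p ≠ (s * ν.card : ℂ) := by
  have h1 : ∀ p, topSeq n m ν 1 p = ν.rowLen p := fun p => by
    simp [topSeq, topStep]
  let d : Fin n → Fin n → ℝ := fun p q =>
    if ν.rowLen q < ν.rowLen p then (ν.rowLen p : ℝ) - ν.rowLen q else 0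
  have h2 : ∑ p, topSeq n m ν 2 p =
      ((∑ p : Fin n, ((ν.rowLen p : ℝ) * ν.rowLen p + m * ∑ q, d p q) : ℝ) : ℂ) := by
    rw [Complex.ofReal_sum]
    refine Finset.sum_congr rfl fun p _ => ?_
    rw [topSeq_succ, topStep]
    simp only [h1]
    push_cast
    congr 2
    refine Finset.sum_congr rfl fun q _ => ?_
    simp only [d]
    split_ifs <;> simp
  rw [h2]
  intro h
  have h3 : ∑ p : Fin n, ((ν.rowLen p : ℝ) * ν.rowLen p + m * ∑ q, d p q) = s * ν.card := by
    exact_mod_cast h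
  have h4 : (ν.card : ℝ) = ∑ p : Fin n, (ν.rowLen p : ℝ) := by
    rw [card_eq_sum_rowLen ν hn, Finset.sum_range, Nat.cast_sum]
  have h5 : ∑ p : Fin n, (((ν.rowLen p : ℝ) - s) ^ 2 + m * ∑ q, d p q) = 0 := by
    have h6 : ∀ p : Fin n, ((ν.rowLen p : ℝ) - s) ^ 2 + m * ∑ q, d p q =
        ((ν.rowLen p : ℝ) * ν.rowLen p + m * ∑ q, d p q) - 2 * s * ν.rowLen p + s * s :=
      fun p => by ring
    rw [Finset.sum_congr rfl fun p _ => h6 p, Finset.sum_add_distrib, Finset.sum_sub_distrib, h3,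
      ← Finset.mul_sum, ← h4, hc]
    simp
    ring
  have hd : ∀ p q, 0 ≤ d p q := fun p q => by
    simp only [d]
    split_ifs with hlt
    · exact sub_nonneg.2 (Nat.cast_le.2 hlt.le)
    · exact le_rfl
  have hd' : ∀ p, 0 ≤ (m : ℝ) * ∑ q, d p q := fun p =>
    mul_nonneg (Nat.cast_nonneg m) (Finset.sum_nonneg fun q _ => hd p q)
  rw [Finset.sum_eq_zero_iff_of_nonneg fun p _ => add_nonneg (sq_nonneg _) (hd' p)] at h5
  refine hν (youngDiagram_ext fun i => ?_)
  rcases lt_or_ge i n with hi | hi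
  · rw [rowLen_rect_of_lt hi]
    have h6 := h5 ⟨i, hi⟩ (Finset.mem_univ _)
    have h7 := ((add_eq_zero_iff_of_nonneg (sq_nonneg _) (hd' _)).1 h6).1
    exact_mod_cast sub_eq_zero.1 (pow_eq_zero_iff (two_ne_zero)|>.1 h7)
  · rw [rowLen_eq_zero (hn.trans hi), rowLen_eq_zero ((colLen_rect_le s n).trans hi)]

variable {m : ℕ} {J : YoungDiagram → SymFun}

theorem torusForm_jack_eq_zero (hm : 0 < m) (hJ : ∀ ν, IsJack m ν (J ν)) {n s : ℕ}
    {ν : YoungDiagram} (hν : ν ≠ rect s n) : torusForm n m s (J ν) = 0 := by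
  rcases lt_or_ge n (ν.colLen 0) with h | hn
  · rw [torusForm_apply, res_jack_eq_zero hJ h, mul_zero, coeff_zero]
  by_cases hc : ν.card = n * s
  · have h1 := torusForm_ham (n := n) (s := s) hm (hJ ν).isWeightedHomogeneous
    rw [(hJ ν).ham_one_eq hm hn, map_smul, smul_eq_mul] at h1
    by_contra h0
    exact sum_topSeq_two_ne hn hc hν (mul_right_cancel₀ h0 h1)
  · exact torusForm_eq_zero_of_ne (hJ ν).isWeightedHomogeneous hc

theorem torusForm_mul_scalar (hm : 0 < m) (hJ : ∀ ν, IsJack m ν (J ν)) (n s : ℕ) (h : SymFun) :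
    torusForm n m s h * scalar (m : ℂ) (J (rect s n)) (J (rect s n)) =
      torusForm n m s (J (rect s n)) * scalar (m : ℂ) (J (rect s n)) h := by
  have h1 : h ∈ Submodule.span ℂ (J '' Set.univ) :=
    monoSpan_le_span (S := Set.univ) (fun ν => (hJ ν).1) (fun _ _ _ _ => trivial)
      (mem_monoSpan.2 fun μ hμ => absurd trivial hμ)
  induction h1 using Submodule.span_induction with
  | mem x hx =>
    obtain ⟨ν, -, rfl⟩ := hx
    by_cases hν : ν = rect s n
    · rw [hν]
    · rw [torusForm_jack_eq_zero hm hJ hν, (hJ _).orthogonal hm (Ne.symm hν) (hJ ν), zero_mul,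
        mul_zero]
  | zero => rw [map_zero, scalar_zero_right, zero_mul, mul_zero]
  | add x y _ _ hx hy => rw [map_add, scalar_add_right, add_mul, hx, hy, mul_add]
  | smul c x _ hx => rw [map_smul, scalar_smul_right, smul_eq_mul, mul_assoc, hx, mul_left_comm]

end

noncomputable section

open MvPolynomial

/-! ### The derivatives of a rectangular Jack polynomial -/

variable {m : ℕ} {J : YoungDiagram → SymFun}

theorem eq_zero_of_scalar_mul_jack_rect (hm : 0 < m) (hJ : ∀ ν, IsJack m ν (J ν)) {s r : ℕ}
    {f : SymFun} (hf : f ∈ Submodule.span ℂ (J '' {μ | μ ≤ rect s r}))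
    (h : ∀ g, scalar (m : ℂ) (J (rect s r)) (f * g) = 0) : f = 0 := by
  have h1 : ∀ η, ¬ η ≤ constExp r s → (res r f).coeff η = 0 := by
    intro η hη
    clear h
    induction hf using Submodule.span_induction with
    | mem x hx =>
      obtain ⟨μ, hμ, rfl⟩ := hx
      refine coeff_res_of_mem_monoSpan (hJ μ).mem η fun hmem => hη fun i => ?_
      have h2 := hmem {i}
      rw [Finset.sum_singleton, Finset.card_singleton, Finset.sum_range_one] at h2
      exact h2.trans (le_rect_iff.1 hμ).1
    | zero => rw [map_zero, coeff_zero]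
    | add x y _ _ hx hy => rw [map_add, coeff_add, hx, hy, add_zero]
    | smul c x _ hx => rw [map_smul, coeff_smul, hx, smul_zero]
  have h2 : ∀ g, res r g = 0 → scalar (m : ℂ) f g = 0 := by
    intro g hg
    clear h h1
    induction hf using Submodule.span_induction with
    | mem x hx =>
      obtain ⟨μ, hμ, rfl⟩ := hx
      exact scalar_jack_eq_zero_of_res hm hJ (le_rect_iff.1 hμ).2 hg
    | zero => exact scalar_zero_left _ _
    | add x y _ _ hx hy => rw [scalar_add_left, hx, hy, add_zero]
    | smul c x _ hx => rw [scalar_smul_left, hx, mul_zero]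
  obtain ⟨g, hg⟩ := exists_isReversal_res f h1
  have h3 : torusForm r m s (f * g) = 0 := by
    have h4 := torusForm_mul_scalar hm hJ r s (f * g)
    rw [h, mul_zero] at h4
    exact (mul_eq_zero.1 h4).resolve_right ((hJ _).scalar_self_ne_zero hm)
  rw [torusForm_apply, map_mul] at h3
  have h5 := eq_zero_of_coeff_disc_pow_mul hg h3
  exact eq_zero_of_scalar_conj hm f (h2 _ (by rw [res_conj, h5, map_zero]))

theorem exists_adjoint_mul (m : ℕ) (J g : SymFun) :
    ∃ A ∈ diffOps, ∀ f, scalar (m : ℂ) J (f * g) = scalar (m : ℂ) (A J) f := by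
  induction g using MvPolynomial.induction_on generalizing J with
  | C c =>
    refine ⟨algebraMap ℂ _ c, diffOps.algebraMap_mem c, fun f => ?_⟩
    rw [mul_comm, ← smul_eq_C_mul, scalar_smul_right, Module.algebraMap_end_apply,
      scalar_smul_left]
  | add p q hp hq =>
    obtain ⟨A, hA, hA'⟩ := hp J
    obtain ⟨B, hB, hB'⟩ := hq J
    refine ⟨A + B, add_mem hA hB, fun f => ?_⟩
    rw [mul_add, scalar_add_right, hA', hB', LinearMap.add_apply, scalar_add_left]
  | mul_X p k hp =>
    obtain ⟨A, hA, hA'⟩ := hp (((m : ℂ)⁻¹ * (k : ℕ)) • pderiv k J)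
    refine ⟨A * (((m : ℂ)⁻¹ * (k : ℕ)) • (pderiv k : Derivation ℂ SymFun SymFun).toLinearMap),
      mul_mem hA (diffOps.smul_mem (Algebra.subset_adjoin ⟨k, rfl⟩) _), fun f => ?_⟩
    rw [← mul_assoc, mul_comm, scalar_mul_X_right, ← scalar_smul_left, hA']
    rfl

theorem conj_mem_diffOrbit {f g : SymFun} (hf : conj f = f) (hg : g ∈ diffOrbit f) :
    conj g ∈ diffOrbit f := by
  have key : ∀ A ∈ diffOps, ∃ B ∈ diffOps, ∀ h : SymFun, conj (A h) = B (conj h) := by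
    intro A hA
    induction hA using Algebra.adjoin_induction with
    | mem A hA =>
      obtain ⟨k, rfl⟩ := hA
      exact ⟨_, Algebra.subset_adjoin ⟨k, rfl⟩, fun h => conj_pderiv k h⟩
    | algebraMap c =>
      refine ⟨_, diffOps.algebraMap_mem (starRingEnd ℂ c), fun h => ?_⟩
      rw [Module.algebraMap_end_apply, Module.algebraMap_end_apply, conj_smul]
    | add A B _ _ hA hB =>
      obtain ⟨A', hA, hA'⟩ := hA
      obtain ⟨B', hB, hB'⟩ := hB
      exact ⟨A' + B', add_mem hA hB, fun h => by
        rw [LinearMap.add_apply, map_add, hA', hB', LinearMap.add_apply]⟩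
    | mul A B _ _ hA hB =>
      obtain ⟨A', hA, hA'⟩ := hA
      obtain ⟨B', hB, hB'⟩ := hB
      exact ⟨A' * B', mul_mem hA hB, fun h => by
        rw [Module.End.mul_apply, hA', hB', Module.End.mul_apply]⟩
  obtain ⟨A, hA, rfl⟩ := hg
  obtain ⟨B, hB, h⟩ := key A hA
  refine ⟨B, hB, ?_⟩
  rw [LinearMap.applyₗ_apply_apply, LinearMap.applyₗ_apply_apply, h, hf]

theorem finite_le_rect (s r : ℕ) : {μ : YoungDiagram | μ ≤ rect s r}.Finite := by
  refine Set.Finite.of_finite_image (f := YoungDiagram.cells)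
    ((rect s r).cells.powerset.finite_toSet.subset ?_) fun μ _ ν _ h => YoungDiagram.ext h
  rintro _ ⟨μ, hμ, rfl⟩
  exact Finset.mem_coe.2 (Finset.mem_powerset.2 hμ)

theorem diffOrbit_jack_rect (hm : 0 < m) (hJ : ∀ ν, IsJack m ν (J ν)) (s r : ℕ) :
    diffOrbit (J (rect s r)) = Submodule.span ℂ (J '' {μ | μ ≤ rect s r}) := by
  have hle := diffOrbit_jack_rect_le hm hJ s r
  refine le_antisymm hle fun w hw => ?_
  have : FiniteDimensional ℂ (Submodule.span ℂ (J '' {μ | μ ≤ rect s r})) :=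
    FiniteDimensional.span_of_finite ℂ ((finite_le_rect s r).image J)
  have : FiniteDimensional ℂ (diffOrbit (J (rect s r))) := Submodule.finiteDimensional_of_le hle
  obtain ⟨v, hv, hvw⟩ := exists_orthogonal_projection hm (diffOrbit (J (rect s r)))
    (fun f hf => conj_mem_diffOrbit ((hJ _).conj_eq hm) hf) w
  have h1 : w - v = 0 := by
    refine eq_zero_of_scalar_mul_jack_rect hm hJ (sub_mem hw (hle hv)) fun g => ?_
    obtain ⟨A, hA, h⟩ := exists_adjoint_mul m (J (rect s r)) g
    rw [h, scalar_comm]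
    exact hvw _ ⟨A, hA, rfl⟩
  rw [sub_eq_zero.1 h1]
  exact hv

end

end JackRect

theorem mainTheorem9 (m : ℕ) (hm : 0 < m) :
    (∃! J : YoungDiagram → JackRect.SymFun, JackRect.IsJackFamily (m : ℂ) J) ∧
      ∀ J : YoungDiagram → JackRect.SymFun, JackRect.IsJackFamily (m : ℂ) J →
        ∀ s r : ℕ,
          JackRect.diffOrbit (J (JackRect.rect s r)) =
            Submodule.span ℂ (J '' {μ : YoungDiagram | μ ≤ JackRect.rect s r}) :=
  ⟨JackRect.existsUnique_isJackFamily hm, fun _ hJ s r =>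
    JackRect.diffOrbit_jack_rect hm ((JackRect.isJackFamily_iff hm).1 hJ) s r⟩
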